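/- Work over $\mathbf{C}$. Let $\mathbf{P}=\mathbf{P}(1,1,1,1,4)$ with homogeneous coordinates $y_1,\dots,y_5$, and let $\Phi\colon\mathbf{P}\to\mathbf{P}$ be the morphism $[y_1:\dots:y_5]\mapsto[y_1^2:\dots:y_5^2]$. Let $\mu_2=\{1,-1\}$, let $K\subset\mu_2^5$ be the subgroup generated by $(-1,-1,-1,-1,1)$, let $G=\mu_2^5/K$ act on $\mathbf{P}$ by $g\cdot[y_1:\dots:y_5]=[g_1y_1:\dots:g_5y_5]$, and let $G'\subset G$ be the kernel of the homomorphism $G\to\mu_2$ induced by $(g_1,\dots,g_5)\mapsto\prod_i g_i$. A morphism $\pi\colon Y\to X$ is called a double cover branched along a reduced divisor $D\subset X$ if it is affine and $X$ is covered by affine open sets $U$ such that the ideal of $D$ on $U$ is generated by a nonzerodivisor $s\in\mathcal{O}(U)$ and $\pi^{-1}(U)=\operatorname{Spec}\mathcal{O}(U)[w]/(w^2-s)$ over $U$. Quotients are geometric quotients of schemes. (1) The morphism $\Phi$ is the quotient of $\mathbf{P}$ by $G$ (so $\mathbf{P}/G\cong\mathbf{P}$). The quotient $q\colon\mathbf{P}\to\mathbf{P}/G'$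 exists, and the unique morphism $p\colon\mathbf{P}/G'\to\mathbf{P}/G\cong\mathbf{P}$ with $p\circ q=\Phi$ is a double cover branched along the union $\bigcup_{i=1}^5\{y_i=0\}$ of all toric divisors. (2) Let $f\in\mathbf{C}[z_1,\dots,z_4]$ be homogeneous of degree $4$ such that $z_1z_2z_3z_4f$ is squarefree (for instance, such that the divisor $\{f=0\}\cup\bigcup_{i=1}^4\{z_i=0\}$ in $\mathbf{P}^3$ has simple normal crossings), and put $D=\{f=0\}\cup\bigcup_{i=1}^4\{z_i=0\}\subset\mathbf{P}^3$. Let $Y'\subset\mathbf{P}$ be the $G$-invariant hypersurface $y_5^2=f(y_1^2,\dots,y_4^2)$. Then the quotient $Y'/G'$ exists, the map $Y'\to\mathbf{P}^3$, $[y_1:\dots:y_5]\mapsto[y_1^2:\dots:y_4^2]$, factors uniquely through a morphism $Y'/G'\to\mathbf{P}^3$, this morphism is a double cover branched along $D$, and every double cover $Y\to\mathbf{P}^3$ branched along $D$ is isomorphic to $Y'/G'$ over $\mathbf{P}^3$. In particular $Y\simeq Y'/G'$. -/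

import Mathlib

open AlgebraicGeometry CategoryTheory HomogeneousLocalization

set_option linter.unusedSectionVars false

noncomputable section

namespace ProjTools

variable {A B : Type} [CommRing A] [CommRing B] [Algebra ℂ A] [Algebra ℂ B]
  {𝒜 : ℕ → Submodule ℂ A} {ℬ : ℕ → Submodule ℂ B} [GradedAlgebra 𝒜] [GradedAlgebra ℬ]

theorem powers_le_comap (φ : A →+* B) (s : A) :
    Submonoid.powers s ≤ (Submonoid.powers (φ s)).comap φ := by
  rintro _ ⟨n, rfl⟩
  exact ⟨n, by simp⟩

/-- The fraction `φ a / φ b` attached to a fraction `a / b` of homogeneous elements of the same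
degree. -/
def mapFraction (φ : A →+* B) (d : ℕ) (hφ : ∀ n, ∀ a ∈ 𝒜 n, φ a ∈ ℬ (d * n)) (s : A)
    (x : NumDenSameDeg 𝒜 (Submonoid.powers s)) : NumDenSameDeg ℬ (Submonoid.powers (φ s)) :=
  ⟨d * x.deg, ⟨_, hφ _ _ x.num.2⟩, ⟨_, hφ _ _ x.den.2⟩, powers_le_comap φ s x.den_mem⟩

theorem embedding_mapFraction (φ : A →+* B) (d : ℕ) (hφ : ∀ n, ∀ a ∈ 𝒜 n, φ a ∈ ℬ (d * n))
    (s : A) (x : NumDenSameDeg 𝒜 (Submonoid.powers s)) :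
    (mapFraction φ d hφ s x).embedding =
      IsLocalization.map (Localization (Submonoid.powers (φ s))) φ (powers_le_comap φ s)
        x.embedding := by
  simp only [mapFraction, NumDenSameDeg.embedding, Localization.mk_eq_mk', IsLocalization.map_mk']

/-- The underlying function of `awayMapDeg`. -/
def awayMapDegFun (φ : A →+* B) (d : ℕ) (hφ : ∀ n, ∀ a ∈ 𝒜 n, φ a ∈ ℬ (d * n)) (s : A)
    (x : Away 𝒜 s) : Away ℬ (φ s) :=
  Quotient.map' (mapFraction φ d hφ s)
    (fun x y (e : x.embedding = y.embedding) ↦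
      show (mapFraction φ d hφ s x).embedding = (mapFraction φ d hφ s y).embedding by
        rw [embedding_mapFraction, embedding_mapFraction, e]) x

theorem val_awayMapDegFun (φ : A →+* B) (d : ℕ) (hφ : ∀ n, ∀ a ∈ 𝒜 n, φ a ∈ ℬ (d * n))
    (s : A) (x : Away 𝒜 s) :
    (awayMapDegFun φ d hφ s x).val =
      IsLocalization.map (Localization (Submonoid.powers (φ s))) φ (powers_le_comap φ s)
        x.val := by
  obtain ⟨x, rfl⟩ := HomogeneousLocalization.mk_surjective x
  exact embedding_mapFraction φ d hφ s x

/-- A ring homomorphism `φ : A → B` with `φ (A_n) ⊆ B_{d n}` induces `A_{(s)} → B_{(φ s)}`,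
`a / s ^ k ↦ φ a / (φ s) ^ k`. -/
def awayMapDeg (φ : A →+* B) (d : ℕ) (hφ : ∀ n, ∀ a ∈ 𝒜 n, φ a ∈ ℬ (d * n)) (s : A) :
    Away 𝒜 s →+* Away ℬ (φ s) where
  toFun := awayMapDegFun φ d hφ s
  map_one' := HomogeneousLocalization.val_injective _ (by simp [val_awayMapDegFun])
  map_zero' := HomogeneousLocalization.val_injective _ (by simp [val_awayMapDegFun])
  map_add' _ _ := HomogeneousLocalization.val_injective _ (by simp [val_awayMapDegFun])
  map_mul' _ _ := HomogeneousLocalization.val_injective _ (by simp [val_awayMapDegFun])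

theorem awayMapDeg_mk (φ : A →+* B) (d : ℕ) (hφ : ∀ n, ∀ a ∈ 𝒜 n, φ a ∈ ℬ (d * n)) (s : A)
    {i : ℕ} (hs : s ∈ 𝒜 i) (n : ℕ) (a : A) (ha : a ∈ 𝒜 (n • i)) :
    awayMapDeg φ d hφ s (Away.mk 𝒜 hs n a ha) = Away.mk ℬ (hφ i s hs) n (φ a)
      (by have := hφ _ a ha; simpa [mul_left_comm] using this) := by
  apply HomogeneousLocalization.val_injective
  have h : awayMapDeg φ d hφ s (Away.mk 𝒜 hs n a ha) =
    awayMapDegFun φ d hφ s (Away.mk 𝒜 hs n a ha) := rfl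
  rw [h, val_awayMapDegFun, Away.val_mk, Away.val_mk, Localization.mk_eq_mk', Localization.mk_eq_mk',
    IsLocalization.map_mk']
  simp only [map_pow]

/-- The opens `D₊(φ s)` cover `Proj B` when `B₊ ⊆ √(φ(A₊) B)`. -/
def coverDeg (φ : A →+* B) (d : ℕ) (hd : 0 < d) (hφ : ∀ n, ∀ a ∈ 𝒜 n, φ a ∈ ℬ (d * n))
    (hirr : (HomogeneousIdeal.irrelevant ℬ).toIdeal ≤
      ((HomogeneousIdeal.irrelevant 𝒜).toIdeal.map φ).radical) :
    (Proj ℬ).AffineOpenCover :=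
  have hex : ∀ x : Proj ℬ, ∃ s : Σ i : PNat, 𝒜 i, x ∈ Proj.basicOpen ℬ (φ s.2) := by
    intro x
    by_contra! H
    refine x.not_irrelevant_le (hirr.trans (x.isPrime.radical_le_iff.mpr ?_))
    rw [Ideal.map_le_iff_le_comap, HomogeneousIdeal.toIdeal_irrelevant_le]
    intro i hi a ha
    by_contra hc
    exact H ⟨⟨i, hi⟩, ⟨a, ha⟩⟩ hc
  { I₀ := Σ i : PNat, 𝒜 i
    X := fun s ↦ .of (Away ℬ (φ s.2))
    f := fun s ↦ Proj.awayι ℬ (φ s.2) (hφ _ _ s.2.2) (Nat.mul_pos hd s.1.pos)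
    idx := fun x ↦ (hex x).choose
    covers := fun x ↦ by
      change x ∈ (Proj.awayι ℬ _ _ _).opensRange
      rw [Proj.opensRange_awayι]
      exact (hex x).choose_spec }

theorem awayMapDeg_awayMap (φ : A →+* B) (d : ℕ) (hφ : ∀ n, ∀ a ∈ 𝒜 n, φ a ∈ ℬ (d * n))
    {s t x : A} {i j : ℕ} (hs : s ∈ 𝒜 i) (ht : t ∈ 𝒜 j) (hx : x = s * t) :
    (awayMap ℬ (hφ _ _ ht) (show φ x = φ s * φ t by rw [hx, map_mul])).comp
      (awayMapDeg φ d hφ s) = (awayMapDeg φ d hφ x).comp (awayMap 𝒜 ht hx) := by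
  ext y
  obtain ⟨n, a, ha, rfl⟩ := Away.mk_surjective 𝒜 hs y
  simp only [RingHom.comp_apply]
  rw [awayMap_mk, awayMapDeg_mk, awayMapDeg_mk, awayMap_mk]
  simp only [Away.val_mk, map_mul, map_pow]

theorem fst_awayMapDeg (φ : A →+* B) (d : ℕ) (hd : 0 < d)
    (hφ : ∀ n, ∀ a ∈ 𝒜 n, φ a ∈ ℬ (d * n)) (s t : Σ i : PNat, 𝒜 i) :
    Limits.pullback.fst
        (Proj.awayι ℬ (φ s.2) (hφ _ _ s.2.2) (Nat.mul_pos hd s.1.pos))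
        (Proj.awayι ℬ (φ t.2) (hφ _ _ t.2.2) (Nat.mul_pos hd t.1.pos)) ≫
      Spec.map (CommRingCat.ofHom (awayMapDeg φ d hφ (s.2 : A))) ≫
        Proj.awayι 𝒜 (s.2 : A) s.2.2 s.1.pos =
    Limits.pullback.snd
        (Proj.awayι ℬ (φ s.2) (hφ _ _ s.2.2) (Nat.mul_pos hd s.1.pos))
        (Proj.awayι ℬ (φ t.2) (hφ _ _ t.2.2) (Nat.mul_pos hd t.1.pos)) ≫
      Spec.map (CommRingCat.ofHom (awayMapDeg φ d hφ (t.2 : A))) ≫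
        Proj.awayι 𝒜 (t.2 : A) t.2.2 t.1.pos := by
  rw [← cancel_epi (Proj.pullbackAwayιIso ℬ (hφ _ _ s.2.2) (Nat.mul_pos hd s.1.pos) (hφ _ _ t.2.2)
    (Nat.mul_pos hd t.1.pos) (map_mul φ (s.2 : A) (t.2 : A))).inv,
    Proj.pullbackAwayιIso_inv_fst_assoc, Proj.pullbackAwayιIso_inv_snd_assoc,
    ← Spec.map_comp_assoc, ← Spec.map_comp_assoc, ← CommRingCat.ofHom_comp,
    ← CommRingCat.ofHom_comp, awayMapDeg_awayMap φ d hφ s.2.2 t.2.2 rfl,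
    awayMapDeg_awayMap φ d hφ t.2.2 s.2.2 (mul_comm _ _), CommRingCat.ofHom_comp,
    CommRingCat.ofHom_comp, Spec.map_comp_assoc, Spec.map_comp_assoc,
    Proj.SpecMap_awayMap_awayι, Proj.SpecMap_awayMap_awayι]
  rfl

/-- The morphism `Proj B ⟶ Proj A` induced by a ring homomorphism `φ : A → B` with
`φ (A_n) ⊆ B_{d n}` for some `d > 0` and `B₊ ⊆ √(φ(A₊) B)`: on `D₊(φ s)` it is
`a / s ^ k ↦ φ a / (φ s) ^ k`. -/
def projMapDeg (φ : A →+* B) (d : ℕ) (hd : 0 < d) (hφ : ∀ n, ∀ a ∈ 𝒜 n, φ a ∈ ℬ (d * n))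
    (hirr : (HomogeneousIdeal.irrelevant ℬ).toIdeal ≤
      ((HomogeneousIdeal.irrelevant 𝒜).toIdeal.map φ).radical) :
    Proj ℬ ⟶ Proj 𝒜 :=
  (coverDeg φ d hd hφ hirr).openCover.glueMorphisms
    (fun s : Σ i : PNat, 𝒜 i ↦ Spec.map (CommRingCat.ofHom (awayMapDeg φ d hφ (s.2 : A))) ≫
      Proj.awayι 𝒜 (s.2 : A) s.2.2 s.1.pos) (fst_awayMapDeg φ d hd hφ)

theorem irrelevant_le_map {H : Type} [CommGroup H] (ρ : H →* (𝒜 →+*ᵍ 𝒜)) (g : H) :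
    HomogeneousIdeal.irrelevant 𝒜 ≤ (HomogeneousIdeal.irrelevant 𝒜).map (ρ g) := by
  intro a ha
  have h : a = ρ g (ρ g⁻¹ a) := by
    change a = (ρ g * ρ g⁻¹) a
    rw [← map_mul, mul_inv_cancel, map_one]
    rfl
  have hle : HomogeneousIdeal.irrelevant 𝒜 ≤ (HomogeneousIdeal.irrelevant 𝒜).comap (ρ g⁻¹) :=
    (HomogeneousIdeal.irrelevant_le 𝒜).mpr fun i hi x hx ↦
      HomogeneousIdeal.mem_irrelevant_of_mem 𝒜 hi ((ρ g⁻¹).map_mem hx)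
  rw [h]
  exact Ideal.mem_map_of_mem (ρ g) (hle ha)

theorem map_action_mul {H : Type} [CommGroup H] (ρ : H →* (𝒜 →+*ᵍ 𝒜)) (g h : H) :
    Proj.map (ρ (g * h)) (irrelevant_le_map ρ _) =
      Proj.map (ρ g) (irrelevant_le_map ρ g) ≫ Proj.map (ρ h) (irrelevant_le_map ρ h) := by
  rw [← Proj.map_comp]
  congr 1
  rw [map_mul]
  rfl

theorem map_action_one {H : Type} [CommGroup H] (ρ : H →* (𝒜 →+*ᵍ 𝒜)) :
    Proj.map (ρ 1) (irrelevant_le_map ρ 1) = 𝟙 (Proj 𝒜) := by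
  rw [← Proj.map_id (𝒜 := 𝒜)]
  congr 1
  rw [map_one]
  rfl

/-- A commutative group acting on a graded ring by graded automorphisms acts on its `Proj`. -/
def projAction {H : Type} [CommGroup H] (ρ : H →* (𝒜 →+*ᵍ 𝒜)) : H →* Aut (Proj 𝒜) where
  toFun g :=
    { hom := Proj.map (ρ g) (irrelevant_le_map ρ g)
      inv := Proj.map (ρ g⁻¹) (irrelevant_le_map ρ g⁻¹)
      hom_inv_id := by
        rw [← map_action_mul, ← map_action_one ρ]
        congr 2
        exact mul_inv_cancel g
      inv_hom_id := by
        rw [← map_action_mul, ← map_action_one ρ]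
        congr 2
        exact inv_mul_cancel g }
  map_one' := by
    ext1
    exact map_action_one ρ
  map_mul' g h := by
    ext1
    change Proj.map (ρ (g * h)) (irrelevant_le_map ρ _) =
      Proj.map (ρ h) (irrelevant_le_map ρ h) ≫ Proj.map (ρ g) (irrelevant_le_map ρ g)
    rw [← map_action_mul]
    congr 2
    exact mul_comm g h

/-- An element acting on `A_n` by multiplication by `c ^ n` acts trivially on `Proj A`. -/
theorem projAction_eq_one {H : Type} [CommGroup H] (ρ : H →* (𝒜 →+*ᵍ 𝒜)) (g : H) (c : ℂ)
    (hc : ∀ n, ∀ a ∈ 𝒜 n, ρ g a = c ^ n • a) : projAction ρ g = 1 := by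
  ext1
  change Proj.map (ρ g) (irrelevant_le_map ρ g) = 𝟙 _
  refine (Proj.mapAffineOpenCover (ρ g) (irrelevant_le_map ρ g)).openCover.hom_ext _ _
    fun (s : Σ i : PNat, 𝒜 i) ↦ ?_
  obtain ⟨i, s, hs⟩ := s
  have h0 : algebraMap ℂ A (c ^ (i : ℕ)) ∈ 𝒜 0 := SetLike.algebraMap_mem_graded 𝒜 _
  have hx : ρ g s = s * algebraMap ℂ A (c ^ (i : ℕ)) := by
    rw [hc _ s hs, Algebra.smul_def, mul_comm]
  have hmap : Away.map (ρ g) s = awayMap 𝒜 h0 hx := by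
    ext y
    obtain ⟨n, a, ha, rfl⟩ := Away.mk_surjective 𝒜 hs y
    rw [Away.map_mk, awayMap_mk]
    simp only [Away.val_mk]
    rw [hc _ a ha, Algebra.smul_def, mul_comm, smul_eq_mul, mul_comm n, pow_mul, map_pow _ _ n]
  change Proj.awayι 𝒜 (ρ g s) ((ρ g).map_mem hs) i.pos ≫ _ =
    Proj.awayι 𝒜 (ρ g s) ((ρ g).map_mem hs) i.pos ≫ 𝟙 _
  rw [Proj.awayι_comp_map (ρ g) (irrelevant_le_map ρ g) i.pos s hs, hmap,
    Proj.SpecMap_awayMap_awayι, Category.comp_id]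

/-- The grading of `A / I` for a homogeneous ideal `I`: the image of the grading of `A`. -/
def quotGrading (I : HomogeneousIdeal 𝒜) (n : ℕ) : Submodule ℂ (A ⧸ I.toIdeal) :=
  (𝒜 n).map (Ideal.Quotient.mkₐ ℂ I.toIdeal).toLinearMap

theorem mk_mem_quotGrading (I : HomogeneousIdeal 𝒜) {n : ℕ} {a : A} (ha : a ∈ 𝒜 n) :
    Ideal.Quotient.mk I.toIdeal a ∈ quotGrading I n :=
  ⟨a, ha, rfl⟩

instance (I : HomogeneousIdeal 𝒜) : SetLike.GradedMonoid (quotGrading I) where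
  one_mem := mk_mem_quotGrading I SetLike.GradedOne.one_mem
  mul_mem := by
    rintro i j _ _ ⟨a, ha, rfl⟩ ⟨b, hb, rfl⟩
    exact ⟨a * b, SetLike.GradedMul.mul_mem ha hb, by simp⟩

/-- The components of the class of an element are the classes of its components. -/
def quotDecomposeAux (I : HomogeneousIdeal 𝒜) : A →ₐ[ℂ] DirectSum ℕ fun i ↦ quotGrading I i :=
  (DirectSum.toAlgebra ℂ (fun i ↦ 𝒜 i)
    (fun i ↦ DirectSum.lof ℂ ℕ (fun i ↦ quotGrading I i) i ∘ₗ
      ((Ideal.Quotient.mkₐ ℂ I.toIdeal).toLinearMap.restrict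
        (p := 𝒜 i) (q := quotGrading I i) fun _ h ↦ mk_mem_quotGrading I h))
    rfl (by
      intro i j a b
      simp only [LinearMap.comp_apply, DirectSum.lof_eq_of, DirectSum.of_mul_of]
      congr 1)).comp (DirectSum.decomposeAlgEquiv 𝒜).toAlgHom

theorem quotDecomposeAux_of_mem (I : HomogeneousIdeal 𝒜) {n : ℕ} {a : A} (ha : a ∈ 𝒜 n) :
    quotDecomposeAux I a = DirectSum.of (fun i ↦ quotGrading I i) n
      ⟨Ideal.Quotient.mk I.toIdeal a, mk_mem_quotGrading I ha⟩ := by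
  simp only [quotDecomposeAux, AlgHom.comp_apply]
  change DirectSum.toAlgebra _ _ _ _ _ (DirectSum.decompose 𝒜 a) = _
  rw [DirectSum.decompose_of_mem 𝒜 ha]
  exact DirectSum.toAddMonoid_of _ _ _

instance (I : HomogeneousIdeal 𝒜) : GradedAlgebra (quotGrading I) :=
  GradedAlgebra.ofAlgHom (quotGrading I)
    (Ideal.Quotient.liftₐ I.toIdeal (quotDecomposeAux I) (by
      intro a ha
      classical
      rw [← DirectSum.sum_support_decompose 𝒜 a, map_sum]
      refine Finset.sum_eq_zero fun i _ ↦ ?_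
      rw [quotDecomposeAux_of_mem I (SetLike.coe_mem (DirectSum.decompose 𝒜 a i))]
      have h : (⟨Ideal.Quotient.mk I.toIdeal (DirectSum.decompose 𝒜 a i : A),
        mk_mem_quotGrading I (SetLike.coe_mem _)⟩ : quotGrading I i) = 0 :=
        Subtype.ext (Ideal.Quotient.eq_zero_iff_mem.mpr (I.isHomogeneous i ha))
      rw [h, map_zero]))
    (by
      apply AlgHom.ext
      intro x
      obtain ⟨a, rfl⟩ := Ideal.Quotient.mk_surjective x
      classical
      rw [← DirectSum.sum_support_decompose 𝒜 a, map_sum, map_sum, map_sum]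
      refine Finset.sum_congr rfl fun i _ ↦ ?_
      change DirectSum.coeAlgHom (quotGrading I) (quotDecomposeAux I _) = _
      rw [quotDecomposeAux_of_mem I (SetLike.coe_mem (DirectSum.decompose 𝒜 a i)),
        DirectSum.coeAlgHom_of]
      rfl)
    (by
      rintro i ⟨_, a, ha, rfl⟩
      exact quotDecomposeAux_of_mem I ha)

/-- A graded action preserving `I` induces a graded action on `A / I`. -/
def quotAction {H : Type} [Group H] (ρ : H →* (𝒜 →+*ᵍ 𝒜)) (I : HomogeneousIdeal 𝒜)
    (hI : ∀ g, I.toIdeal ≤ I.toIdeal.comap (ρ g).toRingHom) :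
    H →* (quotGrading I →+*ᵍ quotGrading I) where
  toFun g := ⟨Ideal.quotientMap I.toIdeal (ρ g).toRingHom (hI g), by
    rintro i _ ⟨a, ha, rfl⟩
    exact mk_mem_quotGrading I ((ρ g).map_mem ha)⟩
  map_one' := by
    ext x
    obtain ⟨a, rfl⟩ := Ideal.Quotient.mk_surjective x
    change Ideal.Quotient.mk I.toIdeal (ρ 1 a) = Ideal.Quotient.mk I.toIdeal a
    rw [map_one]
    rfl
  map_mul' g h := by
    ext x
    obtain ⟨a, rfl⟩ := Ideal.Quotient.mk_surjective x
    change Ideal.Quotient.mk I.toIdeal (ρ (g * h) a) = Ideal.Quotient.mk I.toIdeal (ρ g (ρ h a))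
    rw [map_mul]
    rfl

end ProjTools

namespace DoubleCover

open MvPolynomial ProjTools TopologicalSpace

/-! ### Weighted projective spaces -/

instance weightedGrading {n : ℕ} (w : Fin n → ℕ) :
    GradedAlgebra (weightedHomogeneousSubmodule ℂ w) :=
  weightedGradedAlgebra ℂ w

/-- The weighted projective space `P(w_1, …, w_n)` over `ℂ`. -/
abbrev WP {n : ℕ} (w : Fin n → ℕ) : Scheme.{0} := Proj (weightedHomogeneousSubmodule ℂ w)

/-- Projective three-space `P^3 = P(1,1,1,1)`. -/
abbrev P3 : Scheme.{0} := WP (1 : Fin 4 → ℕ)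

/-- The weights `(1,1,1,1,4)`. -/
abbrev wt : Fin 5 → ℕ := ![1, 1, 1, 1, 4]

/-- The weighted projective space `P(1,1,1,1,4)`. -/
abbrev P11114 : Scheme.{0} := WP wt

/-- The closed subset `{F = 0}` of a weighted projective space. -/
def zeros {n : ℕ} (w : Fin n → ℕ) (F : MvPolynomial (Fin n) ℂ) : Closeds (WP w) :=
  ⟨ProjectiveSpectrum.zeroLocus (weightedHomogeneousSubmodule ℂ w) {F},
    ProjectiveSpectrum.isClosed_zeroLocus _ _⟩

/-- The union of all toric divisors `{x_i = 0}` of `P(1,1,1,1,4)`. -/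
def toricBoundary : Closeds P11114 := Finset.univ.sup fun i : Fin 5 ↦ zeros wt (X i)

/-- The union of the four hyperplanes `{z_i = 0}` and of the quartic `{f = 0}` in `P^3`. -/
def branchLocus (f : MvPolynomial (Fin 4) ℂ) : Closeds P3 :=
  (Finset.univ.sup fun i : Fin 4 ↦ zeros 1 (X i)) ⊔ zeros 1 f

theorem aeval_mem {n : ℕ} {w : Fin n → ℕ} {B : Type} [CommRing B] [Algebra ℂ B]
    (ℬ : ℕ → Submodule ℂ B) [GradedAlgebra ℬ] (d : ℕ) (g : Fin n → B)
    (hg : ∀ i, g i ∈ ℬ (d * w i)) (m : ℕ) (p : MvPolynomial (Fin n) ℂ)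
    (hp : p ∈ weightedHomogeneousSubmodule ℂ w m) : aeval g p ∈ ℬ (d * m) := by
  rw [aeval_def, eval₂_eq']
  refine Submodule.sum_mem _ fun e he ↦ ?_
  rw [← Algebra.smul_def]
  refine Submodule.smul_mem _ _ ?_
  have hm : d * m = ∑ i, e i * (d * w i) := by
    rw [← (mem_weightedHomogeneousSubmodule ℂ w m p).mp hp (mem_support_iff.mp he),
      Finsupp.weight_apply, Finsupp.sum_fintype _ _ (by simp), Finset.mul_sum]
    refine Finset.sum_congr rfl fun i _ ↦ ?_
    rw [smul_eq_mul]
    ring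
  rw [hm]
  refine SetLike.prod_mem_graded ℬ (fun i ↦ e i * (d * w i)) _ fun i _ ↦ ?_
  exact SetLike.pow_mem_graded (e i) (hg i)

theorem irrelevant_le_span_X {n : ℕ} (w : Fin n → ℕ) {m : ℕ} (hm : 0 < m)
    {p : MvPolynomial (Fin n) ℂ} (hp : p ∈ weightedHomogeneousSubmodule ℂ w m) :
    p ∈ Ideal.span (Set.range (X : Fin n → MvPolynomial (Fin n) ℂ)) := by
  rw [← Set.image_univ, mem_ideal_span_X_image]
  intro e he
  by_contra! h
  have he0 : e = 0 := by
    ext i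
    exact h i (Set.mem_univ i)
  have := (mem_weightedHomogeneousSubmodule ℂ w m p).mp hp (mem_support_iff.mp he)
  rw [he0, map_zero] at this
  omega

/-! ### The squaring map -/

/-- The homomorphism `x_i ↦ y_i ^ 2` of coordinate rings. -/
def squareHom : MvPolynomial (Fin 5) ℂ →ₐ[ℂ] MvPolynomial (Fin 5) ℂ := aeval fun i ↦ X i ^ 2

theorem X_mem {n : ℕ} (w : Fin n → ℕ) (i : Fin n) :
    (X i : MvPolynomial (Fin n) ℂ) ∈ weightedHomogeneousSubmodule ℂ w (w i) :=
  isWeightedHomogeneous_X ℂ w i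

theorem squareHom_mem (n : ℕ) (a : MvPolynomial (Fin 5) ℂ)
    (ha : a ∈ weightedHomogeneousSubmodule ℂ wt n) :
    squareHom a ∈ weightedHomogeneousSubmodule ℂ wt (2 * n) :=
  aeval_mem _ 2 _ (fun i ↦ SetLike.pow_mem_graded 2 (X_mem wt i)) n a ha

theorem wt_pos (i : Fin 5) : 0 < wt i := by
  fin_cases i <;> simp

theorem squareHom_irrelevant :
    (HomogeneousIdeal.irrelevant (weightedHomogeneousSubmodule ℂ wt)).toIdeal ≤
      ((HomogeneousIdeal.irrelevant (weightedHomogeneousSubmodule ℂ wt)).toIdeal.map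
        squareHom.toRingHom).radical := by
  rw [HomogeneousIdeal.toIdeal_irrelevant_le]
  intro n hn a ha
  refine (Ideal.span_le.mpr ?_ : Ideal.span (Set.range X) ≤ _) (irrelevant_le_span_X wt hn ha)
  rintro _ ⟨i, rfl⟩
  refine ⟨2, ?_⟩
  have h : squareHom.toRingHom (X i) = X i ^ 2 := aeval_X _ i
  rw [← h]
  exact Ideal.mem_map_of_mem _ (HomogeneousIdeal.mem_irrelevant_of_mem _ (wt_pos i) (X_mem wt i))

/-- The map `Φ : P(1,1,1,1,4) ⟶ P(1,1,1,1,4)`, `[y_1 : … : y_5] ↦ [y_1 ^ 2 : … : y_5 ^ 2]`. -/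
def Phi : P11114 ⟶ P11114 :=
  projMapDeg squareHom.toRingHom 2 two_pos squareHom_mem squareHom_irrelevant

/-! ### The groups `G` and `G'` and their actions -/

/-- The group `μ_2 ^ 5`, where `μ_2 = {1, -1} = ℤˣ`. -/
abbrev Mu : Type := Fin 5 → ℤˣ

/-- The element `(-1, -1, -1, -1, 1)`. -/
abbrev kGen : Mu := ![-1, -1, -1, -1, 1]

/-- The subgroup `K` generated by `(-1, -1, -1, -1, 1)`. -/
abbrev K : Subgroup Mu := Subgroup.zpowers kGen

/-- The group `G = μ_2 ^ 5 / K`. -/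
abbrev G : Type := Mu ⧸ K

/-- The homomorphism `G → μ_2` induced by `(g_1, …, g_5) ↦ ∏ g_i`. -/
def prodHom : G →* ℤˣ :=
  QuotientGroup.lift K
    { toFun := fun g : Mu ↦ ∏ i, g i
      map_one' := by simp
      map_mul' := fun g h ↦ by simp [Finset.prod_mul_distrib] }
    (by
      rw [Subgroup.zpowers_le, MonoidHom.mem_ker]
      simp [Fin.prod_univ_succ])

/-- The subgroup `G'` of `G`: the kernel of `G → μ_2`. -/
abbrev Gprime : Subgroup G := prodHom.ker

/-- The automorphism `y_i ↦ g_i y_i` of the coordinate ring of `P(1,1,1,1,4)`. -/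
def signHom (g : Mu) : MvPolynomial (Fin 5) ℂ →ₐ[ℂ] MvPolynomial (Fin 5) ℂ :=
  aeval fun i ↦ C (((g i : ℤˣ) : ℤ) : ℂ) * X i

theorem signHom_mem (g : Mu) {n : ℕ} {a : MvPolynomial (Fin 5) ℂ}
    (ha : a ∈ weightedHomogeneousSubmodule ℂ wt n) :
    signHom g a ∈ weightedHomogeneousSubmodule ℂ wt n := by
  have h := aeval_mem (weightedHomogeneousSubmodule ℂ wt) 1
    (fun i : Fin 5 ↦ (C (((g i : ℤˣ) : ℤ) : ℂ) * X i : MvPolynomial (Fin 5) ℂ))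
    (fun i ↦ by
      rw [one_mul]
      exact (isWeightedHomogeneous_X ℂ wt i).C_mul _) n a ha
  rwa [one_mul] at h

theorem signHom_one : signHom 1 = AlgHom.id ℂ _ := by
  refine MvPolynomial.algHom_ext fun i ↦ ?_
  simp [signHom]

theorem signHom_mul (g h : Mu) : signHom (g * h) = (signHom g).comp (signHom h) := by
  refine MvPolynomial.algHom_ext fun i ↦ ?_
  simp [signHom, mul_left_comm, mul_assoc]

/-- The action `y_i ↦ g_i y_i` of `μ_2 ^ 5` on the graded coordinate ring of `P(1,1,1,1,4)`. -/
def signAction : Mu →* (weightedHomogeneousSubmodule ℂ wt →+*ᵍ weightedHomogeneousSubmodule ℂ wt)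
    where
  toFun g := ⟨(signHom g).toRingHom, signHom_mem g⟩
  map_one' := GradedRingHom.ext fun a ↦ AlgHom.congr_fun signHom_one a
  map_mul' g h := GradedRingHom.ext fun a ↦ AlgHom.congr_fun (signHom_mul g h) a

theorem signAction_X (g : Mu) (i : Fin 5) :
    signAction g (X i) = C (((g i : ℤˣ) : ℤ) : ℂ) * X i :=
  aeval_X _ i

theorem signAction_kGen (n : ℕ) (a : MvPolynomial (Fin 5) ℂ)
    (ha : a ∈ weightedHomogeneousSubmodule ℂ wt n) :
    signAction kGen a = (-1 : ℂ) ^ n • a := by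
  conv_lhs => rw [a.as_sum]
  conv_rhs => rw [a.as_sum]
  rw [map_sum, Finset.smul_sum]
  refine Finset.sum_congr rfl fun e he ↦ ?_
  have hn := (mem_weightedHomogeneousSubmodule ℂ wt n a).mp ha (mem_support_iff.mp he)
  rw [Finsupp.weight_apply, Finsupp.sum_fintype _ _ (by simp)] at hn
  simp only [Fin.sum_univ_five, smul_eq_mul] at hn
  have hsgn : (-1 : ℂ) ^ n = (-1) ^ (e 0 + e 1 + e 2 + e 3) := by
    rw [← hn]
    simp [pow_add, pow_mul']
    norm_num
  rw [monomial_eq, Finsupp.prod_fintype _ _ (by simp), map_mul, map_prod]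
  simp only [map_pow, signAction_X, mul_pow, Finset.prod_mul_distrib]
  have hC : signAction kGen (C (coeff e a)) = C (coeff e a) := aeval_C _ _
  rw [hC, hsgn, smul_eq_C_mul]
  simp [Fin.prod_univ_five, pow_add]
  ring

/-- The action of `G` on `P(1,1,1,1,4)`, `g · [y_1 : … : y_5] = [g_1 y_1 : … : g_5 y_5]`. -/
def actionG : G →* Aut P11114 :=
  QuotientGroup.lift K (projAction signAction) (by
    rw [Subgroup.zpowers_le, MonoidHom.mem_ker]
    exact projAction_eq_one signAction kGen (-1) signAction_kGen)

/-! ### The hypersurface `Y'` -/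

/-- The polynomial `y_5 ^ 2 - f (y_1 ^ 2, …, y_4 ^ 2)`. -/
def hypersurfacePoly (f : MvPolynomial (Fin 4) ℂ) : MvPolynomial (Fin 5) ℂ :=
  X 4 ^ 2 - aeval (fun i : Fin 4 ↦ (X i.castSucc ^ 2 : MvPolynomial (Fin 5) ℂ)) f

theorem sq_castSucc_mem (i : Fin 4) : (X i.castSucc ^ 2 : MvPolynomial (Fin 5) ℂ) ∈
    weightedHomogeneousSubmodule ℂ wt (2 * (1 : Fin 4 → ℕ) i) := by
  have h : wt i.castSucc = 1 := by fin_cases i <;> rfl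
  have := SetLike.pow_mem_graded 2 (X_mem wt i.castSucc)
  rwa [h] at this

theorem hypersurfacePoly_mem (f : MvPolynomial (Fin 4) ℂ) (hf : f.IsHomogeneous 4) :
    hypersurfacePoly f ∈ weightedHomogeneousSubmodule ℂ wt 8 :=
  Submodule.sub_mem _ (SetLike.pow_mem_graded 2 (X_mem wt 4))
    (aeval_mem (weightedHomogeneousSubmodule ℂ wt) 2 _ sq_castSucc_mem 4 f hf)

/-- The homogeneous ideal generated by `y_5 ^ 2 - f (y_1 ^ 2, …, y_4 ^ 2)`. -/
def hypersurfaceIdeal (f : MvPolynomial (Fin 4) ℂ) (hf : f.IsHomogeneous 4) :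
    HomogeneousIdeal (weightedHomogeneousSubmodule ℂ wt) :=
  ⟨Ideal.span {hypersurfacePoly f}, Ideal.homogeneous_span _ _ (by
    rintro _ rfl
    exact ⟨8, hypersurfacePoly_mem f hf⟩)⟩

/-- The hypersurface `Y' = {y_5 ^ 2 = f (y_1 ^ 2, …, y_4 ^ 2)}` in `P(1,1,1,1,4)`, that is, the
`Proj` of its homogeneous coordinate ring. -/
abbrev Yprime (f : MvPolynomial (Fin 4) ℂ) (hf : f.IsHomogeneous 4) : Scheme.{0} :=
  Proj (quotGrading (hypersurfaceIdeal f hf))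

theorem signAction_hypersurface (f : MvPolynomial (Fin 4) ℂ) (hf : f.IsHomogeneous 4) (g : Mu) :
    (hypersurfaceIdeal f hf).toIdeal ≤
      (hypersurfaceIdeal f hf).toIdeal.comap (signAction g).toRingHom := by
  refine Ideal.span_le.mpr ?_
  rintro _ rfl
  have hsq : ∀ i, signAction g (X i ^ 2) = X i ^ 2 := by
    intro i
    rw [map_pow, signAction_X, mul_pow, ← C_pow]
    norm_cast
    simp
  have hcomp : (signHom g).comp
      (aeval (R := ℂ) (fun i : Fin 4 ↦ (X i.castSucc ^ 2 : MvPolynomial (Fin 5) ℂ))) =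
      aeval (R := ℂ) (fun i : Fin 4 ↦ (X i.castSucc ^ 2 : MvPolynomial (Fin 5) ℂ)) := by
    refine MvPolynomial.algHom_ext fun i ↦ ?_
    rw [AlgHom.comp_apply, aeval_X]
    exact hsq i.castSucc
  have hF : (signAction g).toRingHom (hypersurfacePoly f) = hypersurfacePoly f := by
    rw [hypersurfacePoly, map_sub]
    exact congrArg₂ (· - ·) (hsq 4) (AlgHom.congr_fun hcomp f)
  rw [SetLike.mem_coe, Ideal.mem_comap, hF]
  exact Ideal.mem_span_singleton_self _

/-- The action of `G` on `Y'`, `g · [y_1 : … : y_5] = [g_1 y_1 : … : g_5 y_5]`. -/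
def actionYprime (f : MvPolynomial (Fin 4) ℂ) (hf : f.IsHomogeneous 4) : G →* Aut (Yprime f hf) :=
  QuotientGroup.lift K (projAction (quotAction signAction (hypersurfaceIdeal f hf)
      (signAction_hypersurface f hf))) (by
    rw [Subgroup.zpowers_le, MonoidHom.mem_ker]
    refine projAction_eq_one _ kGen (-1) ?_
    rintro n _ ⟨a, ha, rfl⟩
    change Ideal.Quotient.mk _ (signAction kGen a) = _
    rw [signAction_kGen n a ha]
    rfl)

/-- The homomorphism `z_i ↦ y_i ^ 2` from the coordinate ring of `P^3` to that of `Y'`. -/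
def coverHom (f : MvPolynomial (Fin 4) ℂ) (hf : f.IsHomogeneous 4) :
    MvPolynomial (Fin 4) ℂ →ₐ[ℂ] MvPolynomial (Fin 5) ℂ ⧸ (hypersurfaceIdeal f hf).toIdeal :=
  (Ideal.Quotient.mkₐ ℂ _).comp
    (aeval fun i : Fin 4 ↦ (X i.castSucc ^ 2 : MvPolynomial (Fin 5) ℂ))

theorem coverHom_mem (f : MvPolynomial (Fin 4) ℂ) (hf : f.IsHomogeneous 4) (n : ℕ)
    (a : MvPolynomial (Fin 4) ℂ) (ha : a ∈ weightedHomogeneousSubmodule ℂ (1 : Fin 4 → ℕ) n) :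
    coverHom f hf a ∈ quotGrading (hypersurfaceIdeal f hf) (2 * n) :=
  mk_mem_quotGrading _ (aeval_mem (weightedHomogeneousSubmodule ℂ wt) 2 _ sq_castSucc_mem n a ha)

theorem coverHom_irrelevant (f : MvPolynomial (Fin 4) ℂ) (hf : f.IsHomogeneous 4) :
    (HomogeneousIdeal.irrelevant (quotGrading (hypersurfaceIdeal f hf))).toIdeal ≤
      ((HomogeneousIdeal.irrelevant
        (weightedHomogeneousSubmodule ℂ (1 : Fin 4 → ℕ))).toIdeal.map
        (coverHom f hf).toRingHom).radical := by
  rw [HomogeneousIdeal.toIdeal_irrelevant_le]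
  rintro n hn _ ⟨a, ha, rfl⟩
  refine (Ideal.span_le.mpr ?_ : Ideal.span (Set.range X) ≤
    Ideal.comap (Ideal.Quotient.mk (hypersurfaceIdeal f hf).toIdeal)
      (((HomogeneousIdeal.irrelevant
        (weightedHomogeneousSubmodule ℂ (1 : Fin 4 → ℕ))).toIdeal.map
        (coverHom f hf).toRingHom).radical))
    (irrelevant_le_span_X wt hn ha)
  rintro _ ⟨i, rfl⟩
  refine ⟨2, ?_⟩
  rw [← map_pow]
  induction i using Fin.lastCases with
  | last =>
    have h : Ideal.Quotient.mk (hypersurfaceIdeal f hf).toIdeal (X (Fin.last 4) ^ 2) =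
        (coverHom f hf).toRingHom f :=
      Ideal.Quotient.eq.mpr (Ideal.mem_span_singleton_self (hypersurfacePoly f))
    rw [h]
    exact Ideal.mem_map_of_mem _
      (HomogeneousIdeal.mem_irrelevant_of_mem _ (show 0 < 4 by norm_num) hf)
  | cast i =>
    have h : Ideal.Quotient.mk (hypersurfaceIdeal f hf).toIdeal (X i.castSucc ^ 2) =
        (coverHom f hf).toRingHom (X i) :=
      congrArg (Ideal.Quotient.mk (hypersurfaceIdeal f hf).toIdeal)
        (aeval_X (fun i : Fin 4 ↦ (X i.castSucc ^ 2 : MvPolynomial (Fin 5) ℂ)) i).symm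
    rw [h]
    exact Ideal.mem_map_of_mem _
      (HomogeneousIdeal.mem_irrelevant_of_mem _ (show 0 < 1 by norm_num) (X_mem 1 i))

/-- The map `Y' ⟶ P^3`, `[y_1 : … : y_5] ↦ [y_1 ^ 2 : … : y_4 ^ 2]`. -/
def coverMap (f : MvPolynomial (Fin 4) ℂ) (hf : f.IsHomogeneous 4) : Yprime f hf ⟶ P3 :=
  projMapDeg (coverHom f hf).toRingHom 2 two_pos (coverHom_mem f hf) (coverHom_irrelevant f hf)

/-! ### Quotients and double covers -/

/-- `q : X ⟶ Z` is the (geometric) quotient of `X` by the action `ρ` of a group `H`: `q` is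
invariant, it is a topological quotient map whose fibres are the orbits, and the functions on an
open `U ⊆ Z` are the invariant functions on `q⁻¹ U`. Such a quotient is unique up to a unique
isomorphism. -/
structure IsGeometricQuotient {H : Type} [Group H] {X Z : Scheme.{0}} (ρ : H →* Aut X)
    (q : X ⟶ Z) : Prop where
  invariant : ∀ g : H, (ρ g).hom ≫ q = q
  isQuotientMap : Topology.IsQuotientMap q
  orbit : ∀ x y : X, q x = q y → ∃ g : H, (ρ g).hom x = y
  injective : ∀ U : Z.Opens, Function.Injective (q.app U)
  invariants : ∀ (U : Z.Opens) (b : Γ(X, q ⁻¹ᵁ U)),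
    (∀ g : H, (ρ g).hom.appLE (q ⁻¹ᵁ U) (q ⁻¹ᵁ U)
      (by rw [← Scheme.Hom.comp_preimage, invariant g]) b = b) → ∃ a : Γ(Z, U), q.app U a = b

/-- `π : Y ⟶ X` is a double cover branched along the reduced divisor `D`: it is affine, and `X` is
covered by affine opens `U` on which `D` has an equation `s`, a nonzerodivisor generating the
ideal of functions on `U` vanishing on `D`, and over which `Y` is
`Spec Γ(X, U)[w] / (w ^ 2 - s)`. -/
structure IsDoubleCover {X Y : Scheme.{0}} (π : Y ⟶ X) (D : Closeds X) : Prop where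
  isAffineHom : IsAffineHom π
  local_equation : ∀ x : X, ∃ U : X.affineOpens, x ∈ U.1 ∧
    ∃ (s : Γ(X, U.1)) (w : Γ(Y, π ⁻¹ᵁ U.1)),
      s ∈ nonZeroDivisors Γ(X, U.1) ∧
      (Scheme.IdealSheafData.vanishingIdeal D).ideal U = Ideal.span {s} ∧
      w ^ 2 = π.app U.1 s ∧
      ∀ b : Γ(Y, π ⁻¹ᵁ U.1), ∃! c : Γ(X, U.1) × Γ(X, U.1),
        b = π.app U.1 c.1 + π.app U.1 c.2 * w

end DoubleCover

end

open DoubleCover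

noncomputable section

namespace DoubleCover

open TopologicalSpace

/-! ### Geometric quotients are categorical quotients -/

section Epi

variable {X Z T : Scheme.{0}}

/-! Quotients. Let a finite group `H` act on a graded ring `B`. An invariant fraction acquires an
invariant numerator by averaging over `H`, so on each chart the invariant functions are the
fractions from `B^H`. Since `B` is integral over `B^H` and `H` is transitive on the primes over a
given prime, `Proj B ⟶ Proj B^H` is a geometric quotient (`isGeometricQuotient_projMapDeg`).
Geometric quotients are categorical (`IsGeometricQuotient.exists_desc`), so factorizations exist
uniquely and any quotient may be compared with this model. As `K` acts trivially on `Proj`, the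
groups `G` and `G'` may be replaced by `μ_2 ^ 5` and its subgroup of elements with product `1`.

Double covers. The invariants of `μ_2 ^ 5` are the polynomials in the `y_i ^ 2`, which gives `Phi`.
Changing two signs at a time shows that in a polynomial invariant under the smaller group the
exponents of each monomial have one common parity; so its invariants are `A ⊕ A W`, with `A` the
polynomials in the squares and `W = y_1 ⋯ y_5`. With `x_i = y_i ^ 2`, the square of `W` is `x_1 ⋯
x_5`; on `Y'`, where `y_5 ^ 2 = f`, it is `z_1 z_2 z_3 z_4 f`. In both cases `W ^ 2` is a squarefree
element `P` of the base ring, and `IsGeometricQuotient.isDoubleCover` applies: where `t ≠ 0`, the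
section `w = W / t` has square `P / t ^ 2`, which generates the radical ideal of the branch locus.

Uniqueness. Let `X` be normal and integral with function field `K`, and let a double cover have an
equation equal to `h r ^ 2` in `K`. Sending its generator to `r √h` embeds its local rings in
`K(√h)`, and their images are the integral closures of the rings of the base, because the equation
is reduced and `2` is invertible. The cover is therefore the normalization of `X` in `Spec K(√h)`,
and only `h` modulo squares matters. For two covers with the same branch divisor the quotient `h' /
h` is locally a unit times a square. On `P^3` such a rational function is a square: write it as `a b
/ b ^ 2` with `a`, `b` homogeneous of equal degree; a prime of odd multiplicity in `a b` would be a
point of `P^3` with odd valuation, so `a b` is a constant times a square, and constants are squares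
(`exists_eq_sq_of_stalk`). -/

theorem exists_ringHom_comp_eq {R S R' : Type} [CommRing R] [CommRing S] [CommRing R']
    (i : S →+* R) (hi : Function.Injective i) (f : R' →+* R) (h : ∀ x, ∃ s, i s = f x) :
    ∃ θ : R' →+* S, i.comp θ = f := by
  choose θ hθ using h
  exact ⟨{ toFun := θ
           map_one' := hi (by simp [hθ])
           map_zero' := hi (by simp [hθ])
           map_add' := fun _ _ ↦ hi (by simp [hθ])
           map_mul' := fun _ _ ↦ hi (by simp [hθ]) }, RingHom.ext hθ⟩

/-- Surjectivity of `q` determines the map on points, and injectivity on sections then determines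
the map of sheaves. -/
theorem hom_ext_of_app_injective (q : X ⟶ Z) (hs : Function.Surjective q)
    (hi : ∀ U : Z.Opens, Function.Injective (q.app U)) {a b : Z ⟶ T} (h : q ≫ a = q ≫ b) :
    a = b := by
  have hb : a.base = b.base := by
    ext z
    obtain ⟨x, rfl⟩ := hs z
    have := congr($h x)
    simpa using this
  refine Scheme.Hom.ext hb fun U ↦ ?_
  ext t
  have hab : a ⁻¹ᵁ U = b ⁻¹ᵁ U := by
    ext z
    have : a z = b z := congr($hb z)
    simp [this]
  apply hi (b ⁻¹ᵁ U)
  have h1 : (a.app U ≫ Z.presheaf.map (eqToHom hab.symm).op) ≫ q.app (b ⁻¹ᵁ U) =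
      b.app U ≫ q.app (b ⁻¹ᵁ U) := by
    simp only [Scheme.Hom.app_eq_appLE, Scheme.Hom.appLE_map, Scheme.Hom.appLE_comp_appLE, h]
  exact congr($h1 t)

theorem restrict_hom_ext (q : X ⟶ Z) (hs : Function.Surjective q)
    (hi : ∀ U : Z.Opens, Function.Injective (q.app U)) (U : Z.Opens) {a b : U.toScheme ⟶ T}
    (h : (q ∣_ U) ≫ a = (q ∣_ U) ≫ b) : a = b := by
  refine hom_ext_of_app_injective (q ∣_ U) ?_ ?_ h
  · rintro ⟨z, hz⟩
    obtain ⟨x, rfl⟩ := hs z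
    exact ⟨⟨x, hz⟩, Subtype.ext (morphismRestrict_base_coe q U ⟨x, hz⟩)⟩
  · intro V
    rw [morphismRestrict_app]
    have : Function.Bijective (X.presheaf.map (eqToHom (image_morphismRestrict_preimage q U V)).op) :=
      ConcreteCategory.bijective_of_isIso _
    exact this.1.comp (hi _)

theorem hom_ext_of_isOpenCover {ι : Type} {c : ι → Z.Opens} (hc : IsOpenCover c) {a b : Z ⟶ T}
    (h : ∀ i, (c i).ι ≫ a = (c i).ι ≫ b) : a = b :=
  Scheme.Cover.hom_ext (Z.openCoverOfIsOpenCover c hc) _ _ h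

theorem exists_glue {ι : Type} {c : ι → Z.Opens} (hc : IsOpenCover c)
    (m : ∀ i, (c i).toScheme ⟶ T)
    (hm : ∀ i j, Z.homOfLE (inf_le_left : c i ⊓ c j ≤ c i) ≫ m i =
      Z.homOfLE (inf_le_right : c i ⊓ c j ≤ c j) ≫ m j) :
    ∃ p : Z ⟶ T, ∀ i, (c i).ι ≫ p = m i := by
  have key : ∀ i j, Limits.pullback.fst (c i).ι (c j).ι ≫ m i =
      Limits.pullback.snd (c i).ι (c j).ι ≫ m j := by
    intro i j
    rw [← cancel_epi (isPullback_opens_inf (c i) (c j)).isoPullback.hom]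
    simpa using hm i j
  exact ⟨(Z.openCoverOfIsOpenCover c hc).glueMorphisms m key,
    fun i ↦ (Z.openCoverOfIsOpenCover c hc).ι_glueMorphisms m key i⟩

end Epi

namespace IsGeometricQuotient

variable {H : Type} [Group H] {X Z T : Scheme.{0}} {ρ : H →* Aut X} {q : X ⟶ Z}

/-- Being a geometric quotient depends only on the image of the group in `Aut X`. This allows
passing between `G` and `μ_2 ^ 5`. -/
theorem of_range {H' : Type} [Group H'] {ρ' : H' →* Aut X} (hq : IsGeometricQuotient ρ q)
    (h₁ : ∀ g, ∃ g', ρ' g' = ρ g) (h₂ : ∀ g', ∃ g, ρ g = ρ' g') : IsGeometricQuotient ρ' q where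
  invariant g' := by
    obtain ⟨g, hg⟩ := h₂ g'
    rw [← hg, hq.invariant]
  isQuotientMap := hq.isQuotientMap
  orbit x y hxy := by
    obtain ⟨g, hg⟩ := hq.orbit x y hxy
    obtain ⟨g', hg'⟩ := h₁ g
    exact ⟨g', by rw [hg', hg]⟩
  injective := hq.injective
  invariants U b hb := by
    refine hq.invariants U b fun g ↦ ?_
    obtain ⟨g', hg'⟩ := h₁ g
    have := hb g'
    simpa only [hg'] using this

theorem surjective (hq : IsGeometricQuotient ρ q) : Function.Surjective q := hq.isQuotientMap.surjective

theorem hom_ext (hq : IsGeometricQuotient ρ q) {a b : Z ⟶ T} (h : q ≫ a = q ≫ b) : a = b :=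
  hom_ext_of_app_injective q hq.surjective hq.injective h

/-- An invariant morphism is constant on orbits, which are the fibres of `q`; so `h⁻¹ W` is
saturated, and its image is open in the quotient topology. -/
theorem exists_preimage_eq (hq : IsGeometricQuotient ρ q) (h : X ⟶ T)
    (hh : ∀ g, (ρ g).hom ≫ h = h) (W : T.Opens) : ∃ U : Z.Opens, q ⁻¹ᵁ U = h ⁻¹ᵁ W := by
  have key : q ⁻¹' (q '' (h ⁻¹ᵁ W : Set X)) = (h ⁻¹ᵁ W : Set X) := by
    ext x
    constructor
    · rintro ⟨x', hx', e⟩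
      obtain ⟨g, rfl⟩ := hq.orbit _ _ e
      have : h ((ρ g).hom x') = h x' := by rw [← Scheme.Hom.comp_apply, hh]
      change h ((ρ g).hom x') ∈ W
      rw [this]
      exact hx'
    · intro hx
      exact ⟨x, hx, rfl⟩
  refine ⟨⟨q '' (h ⁻¹ᵁ W : Set X), ?_⟩, ?_⟩
  · rw [← hq.isQuotientMap.isOpen_preimage, key]
    exact (h ⁻¹ᵁ W).2
  · exact Opens.ext key

theorem exists_app_eq (hq : IsGeometricQuotient ρ q) (h : X ⟶ T)
    (hh : ∀ g, (ρ g).hom ≫ h = h) (U : Z.Opens) (W : T.Opens) (e : q ⁻¹ᵁ U ≤ h ⁻¹ᵁ W) (t : Γ(T, W)) :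
    ∃ a : Γ(Z, U), q.app U a = h.appLE W (q ⁻¹ᵁ U) e t := by
  refine hq.invariants U _ fun g ↦ ?_
  rw [← CommRingCat.comp_apply, Scheme.Hom.appLE_comp_appLE]
  simp only [hh]

theorem exists_descHom (hq : IsGeometricQuotient ρ q) (h : X ⟶ T)
    (hh : ∀ g, (ρ g).hom ≫ h = h) (U : Z.Opens) (W : T.Opens) (e : q ⁻¹ᵁ U ≤ h ⁻¹ᵁ W) :
    ∃ θ : Γ(T, W) ⟶ Γ(Z, U), θ ≫ q.app U = h.appLE W (q ⁻¹ᵁ U) e := by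
  obtain ⟨θ, hθ⟩ := exists_ringHom_comp_eq (q.app U).hom (hq.injective U)
    (h.appLE W (q ⁻¹ᵁ U) e).hom (hq.exists_app_eq h hh U W e)
  exact ⟨CommRingCat.ofHom θ, CommRingCat.hom_ext hθ⟩

theorem restrict_desc (U : Z.Opens) {W : T.Opens} (hW : IsAffineOpen W) (h : X ⟶ T)
    (e : q ⁻¹ᵁ U ≤ h ⁻¹ᵁ W) (θ : Γ(T, W) ⟶ Γ(Z, U)) (hθ : θ ≫ q.app U = h.appLE W (q ⁻¹ᵁ U) e) :
    (q ∣_ U) ≫ U.toSpecΓ ≫ Spec.map θ ≫ hW.fromSpec = (q ⁻¹ᵁ U).ι ≫ h := by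
  have h1 : (q ∣_ U) ≫ U.toSpecΓ = (q ⁻¹ᵁ U).toSpecΓ ≫ Spec.map (q.app U) := by
    simp
  rw [reassoc_of% h1, ← Spec.map_comp_assoc, hθ]
  simp

/-- A geometric quotient is a categorical quotient. -/
theorem exists_desc (hq : IsGeometricQuotient ρ q) (h : X ⟶ T)
    (hh : ∀ g, (ρ g).hom ≫ h = h) : ∃ p : Z ⟶ T, q ≫ p = h := by
  choose U hU using hq.exists_preimage_eq h hh
  let c : T.affineOpens → Z.Opens := fun W ↦ U W.1
  have hc : IsOpenCover c := by
    rw [IsOpenCover, eq_top_iff]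
    intro z _
    obtain ⟨x, rfl⟩ := hq.surjective z
    obtain ⟨_, ⟨W, hW, rfl⟩, hxW, -⟩ :=
      T.isBasis_affineOpens.exists_subset_of_mem_open (Set.mem_univ (h x)) isOpen_univ
    simp only [Opens.mem_iSup]
    refine ⟨⟨W, hW⟩, ?_⟩
    change x ∈ q ⁻¹ᵁ U W
    rw [hU]
    exact hxW
  -- Pullbacks of functions on `W` are invariant, hence come from `Z`. Since `W` is affine, the
  -- resulting ring map defines a morphism to `W`.
  choose θ hθ using fun W : T.affineOpens ↦ hq.exists_descHom h hh (c W) W.1 (hU _).le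
  let m : ∀ W : T.affineOpens, (c W).toScheme ⟶ T := fun W ↦
    (c W).toSpecΓ ≫ Spec.map (θ W) ≫ W.2.fromSpec
  have hm : ∀ W, (q ∣_ (c W)) ≫ m W = (q ⁻¹ᵁ (c W)).ι ≫ h := fun W ↦
    restrict_desc (c W) W.2 h _ _ (hθ W)
  have hle : ∀ (V : Z.Opens) (W : T.affineOpens) (hV : V ≤ c W),
      (q ∣_ V) ≫ Z.homOfLE hV ≫ m W = (q ⁻¹ᵁ V).ι ≫ h := by
    intro V W hV
    have : (q ∣_ V) ≫ Z.homOfLE hV = X.homOfLE (q.preimage_mono hV) ≫ (q ∣_ (c W)) := by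
      rw [← cancel_mono (c W).ι]
      simp
    rw [reassoc_of% this, hm]
    simp
  -- The local morphisms agree on overlaps because restrictions of `q` are epimorphisms and both
  -- composites with `q` are `h`.
  obtain ⟨p, hp⟩ := exists_glue hc m fun W W' ↦ by
    refine restrict_hom_ext q hq.surjective hq.injective _ ?_
    rw [hle, hle]
  refine ⟨p, hom_ext_of_isOpenCover (hc.comap q.base.hom) fun W ↦ ?_⟩
  change (q ⁻¹ᵁ c W).ι ≫ q ≫ _ = (q ⁻¹ᵁ c W).ι ≫ h
  rw [← hm, ← morphismRestrict_ι_assoc, hp]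

theorem exists_iso (hq : IsGeometricQuotient ρ q) {Z' : Scheme.{0}} {q' : X ⟶ Z'} (hq' : IsGeometricQuotient ρ q') :
    ∃ e : Z ≅ Z', q ≫ e.hom = q' := by
  obtain ⟨a, ha⟩ := hq.exists_desc q' hq'.invariant
  obtain ⟨b, hb⟩ := hq'.exists_desc q hq.invariant
  refine ⟨⟨a, b, ?_, ?_⟩, ha⟩
  · apply hq.hom_ext
    rw [reassoc_of% ha, hb, Category.comp_id]
  · apply hq'.hom_ext
    rw [reassoc_of% hb, ha, Category.comp_id]

end IsGeometricQuotient

end DoubleCover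

namespace DoubleCover

open TopologicalSpace

/-! ### A local criterion for geometric quotients by finite groups -/

section LocalCriterion

variable {H : Type} [Group H] {X Z : Scheme.{0}}

theorem section_ext_local {Z : Scheme.{0}} {U : Z.Opens} {a b : Γ(Z, U)}
    (h : ∀ z ∈ U, ∃ (V : Z.Opens) (hV : V ≤ U), z ∈ V ∧
      Z.presheaf.map (homOfLE hV).op a = Z.presheaf.map (homOfLE hV).op b) : a = b := by
  refine TopCat.Presheaf.section_ext Z.sheaf U a b fun z hz ↦ ?_
  obtain ⟨V, hVU, hzV, h⟩ := h z hz
  have := congr(Z.presheaf.germ V z hzV $h)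
  rwa [Z.presheaf.germ_res_apply, Z.presheaf.germ_res_apply] at this

theorem app_injective_of_basis (q : X ⟶ Z) {S : Set Z.Opens}
    (hS : ∀ (U : Z.Opens), ∀ z ∈ U, ∃ V ∈ S, z ∈ V ∧ V ≤ U)
    (hinj : ∀ V ∈ S, Function.Injective (q.app V)) (U : Z.Opens) :
    Function.Injective (q.app U) := by
  intro a b hab
  refine section_ext_local fun z hz ↦ ?_
  obtain ⟨V, hV, hzV, hVU⟩ := hS U z hz
  refine ⟨V, hVU, hzV, hinj V hV ?_⟩
  have key : ∀ c, q.app V (Z.presheaf.map (homOfLE hVU).op c) =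
      X.presheaf.map (homOfLE (q.preimage_mono hVU)).op (q.app U c) := fun c ↦
    congr($(q.naturality (homOfLE hVU).op) c)
  rw [key, key, hab]

/-- Invariance of a section over an invariant open. -/
def IsInvariantSection (ρ : H →* Aut X) (q : X ⟶ Z) (hinv : ∀ g, (ρ g).hom ≫ q = q)
    (U : Z.Opens) (b : Γ(X, q ⁻¹ᵁ U)) : Prop :=
  ∀ g : H, (ρ g).hom.appLE (q ⁻¹ᵁ U) (q ⁻¹ᵁ U)
    (by rw [← Scheme.Hom.comp_preimage, hinv g]) b = b

theorem IsInvariantSection.res {ρ : H →* Aut X} {q : X ⟶ Z} {hinv : ∀ g, (ρ g).hom ≫ q = q}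
    {U : Z.Opens} {b : Γ(X, q ⁻¹ᵁ U)} (hb : IsInvariantSection ρ q hinv U b) {V : Z.Opens}
    (hVU : V ≤ U) :
    IsInvariantSection ρ q hinv V (X.presheaf.map (homOfLE (q.preimage_mono hVU)).op b) := by
  intro g
  conv_rhs => rw [← hb g]
  simp only [← CommRingCat.comp_apply, Scheme.Hom.map_appLE, Scheme.Hom.appLE_map]

/-- Descents on the basic opens inside `U` glue: on an overlap, which need not belong to `S`, they
agree because `q` is injective on sections over every open. -/
theorem exists_app_eq_of_basis {ρ : H →* Aut X} {q : X ⟶ Z} (hinv : ∀ g, (ρ g).hom ≫ q = q)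
    {S : Set Z.Opens} (hS : ∀ (U : Z.Opens), ∀ z ∈ U, ∃ V ∈ S, z ∈ V ∧ V ≤ U)
    (hinj : ∀ V ∈ S, Function.Injective (q.app V))
    (hsurj : ∀ V ∈ S, ∀ b, IsInvariantSection ρ q hinv V b → ∃ a, q.app V a = b)
    (U : Z.Opens) (b : Γ(X, q ⁻¹ᵁ U)) (hb : IsInvariantSection ρ q hinv U b) :
    ∃ a, q.app U a = b := by
  have key : ∀ {V W : Z.Opens} (hVW : V ≤ W) c, q.app V (Z.presheaf.map (homOfLE hVW).op c) =
      X.presheaf.map (homOfLE (q.preimage_mono hVW)).op (q.app W c) := fun hVW c ↦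
    congr($(q.naturality (homOfLE hVW).op) c)
  let ι := {V : Z.Opens // V ∈ S ∧ V ≤ U}
  choose a ha using fun i : ι ↦ hsurj i.1 i.2.1 _ (hb.res i.2.2)
  have hcov : U ≤ ⨆ i : ι, i.1 := by
    intro z hz
    obtain ⟨V, hVS, hzV, hVU⟩ := hS U z hz
    exact Opens.mem_iSup.mpr ⟨⟨V, hVS, hVU⟩, hzV⟩
  obtain ⟨s, hs⟩ : ∃ s : Γ(Z, U), ∀ i : ι, Z.presheaf.map (homOfLE i.2.2).op s = a i :=
    (Z.sheaf.existsUnique_gluing' (fun i : ι ↦ i.1) U (fun i ↦ homOfLE i.2.2) hcov a (by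
      intro i j
      apply app_injective_of_basis q hS hinj
      change q.app _ (Z.presheaf.map (homOfLE inf_le_left).op (a i)) =
        q.app _ (Z.presheaf.map (homOfLE inf_le_right).op (a j))
      rw [key, key, ha, ha]
      simp only [← CommRingCat.comp_apply, ← Functor.map_comp]
      rfl)).exists
  refine ⟨s, ?_⟩
  refine section_ext_local fun x hx ↦ ?_
  obtain ⟨V, hVS, hzV, hVU⟩ := hS U (q x) hx
  refine ⟨q ⁻¹ᵁ V, q.preimage_mono hVU, hzV, ?_⟩
  rw [← key hVU, hs ⟨V, hVS, hVU⟩, ha ⟨V, hVS, hVU⟩]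

theorem appLE_congr {f g : X ⟶ Z} (h : f = g) {U : Z.Opens} {V : X.Opens} (e : V ≤ f ⁻¹ᵁ U)
    (b : Γ(Z, U)) : f.appLE U V e b = g.appLE U V (h ▸ e) b := by
  subst h
  rfl

/-- The action of the group on the sections over an invariant open. -/
abbrev sectionAction (ρ : H →* Aut X) (q : X ⟶ Z) (hinv : ∀ g, (ρ g).hom ≫ q = q) (U : Z.Opens) :
    MulSemiringAction H Γ(X, q ⁻¹ᵁ U) where
  -- Pullback of sections reverses products, so the inverse is needed to obtain a left action.
  smul g b := (ρ g⁻¹).hom.appLE (q ⁻¹ᵁ U) (q ⁻¹ᵁ U)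
    (by rw [← Scheme.Hom.comp_preimage, hinv g⁻¹]) b
  one_smul b := by
    change (ρ 1⁻¹).hom.appLE (q ⁻¹ᵁ U) (q ⁻¹ᵁ U) _ b = b
    have : (ρ 1⁻¹).hom = 𝟙 X := by
      rw [inv_one, map_one]
      rfl
    exact (appLE_congr this _ b).trans (by
      rw [Scheme.Hom.appLE, Scheme.Hom.id_app]
      exact congr($(X.presheaf.map_id _) b))
  mul_smul g h b := by
    change (ρ (g * h)⁻¹).hom.appLE (q ⁻¹ᵁ U) (q ⁻¹ᵁ U) _ b =
      (ρ g⁻¹).hom.appLE (q ⁻¹ᵁ U) (q ⁻¹ᵁ U) _ ((ρ h⁻¹).hom.appLE (q ⁻¹ᵁ U) (q ⁻¹ᵁ U) _ b)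
    have : (ρ (g * h)⁻¹).hom = (ρ g⁻¹).hom ≫ (ρ h⁻¹).hom := by
      rw [mul_inv_rev, map_mul]; rfl
    rw [← CommRingCat.comp_apply, Scheme.Hom.appLE_comp_appLE]
    exact appLE_congr this _ b
  smul_zero _ := map_zero _
  smul_add _ := map_add _
  smul_one _ := map_one _
  smul_mul _ := map_mul _

theorem isInvariant_section (ρ : H →* Aut X) (q : X ⟶ Z) (hinv : ∀ g, (ρ g).hom ≫ q = q)
    (U : Z.Opens)
    (hsurj : ∀ b, IsInvariantSection ρ q hinv U b → ∃ a, q.app U a = b) :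
    letI := (q.app U).hom.toAlgebra
    letI := sectionAction ρ q hinv U
    Algebra.IsInvariant Γ(Z, U) Γ(X, q ⁻¹ᵁ U) H := by
  let := (q.app U).hom.toAlgebra
  let := sectionAction ρ q hinv U
  refine ⟨fun b hb ↦ hsurj b fun g ↦ ?_⟩
  have := hb g⁻¹
  change (ρ (g⁻¹)⁻¹).hom.appLE (q ⁻¹ᵁ U) (q ⁻¹ᵁ U) _ b = b at this
  simpa only [inv_inv] using this

theorem smulCommClass_section (ρ : H →* Aut X) (q : X ⟶ Z) (hinv : ∀ g, (ρ g).hom ≫ q = q)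
    (U : Z.Opens) :
    letI := (q.app U).hom.toAlgebra
    letI := sectionAction ρ q hinv U
    SMulCommClass H Γ(Z, U) Γ(X, q ⁻¹ᵁ U) := by
  let := (q.app U).hom.toAlgebra
  let := sectionAction ρ q hinv U
  refine ⟨fun g a b ↦ ?_⟩
  rw [Algebra.smul_def, Algebra.smul_def, smul_mul']
  congr 1
  change (ρ g⁻¹).hom.appLE (q ⁻¹ᵁ U) (q ⁻¹ᵁ U) _ (q.app U a) = q.app U a
  rw [← CommRingCat.comp_apply, Scheme.Hom.app_eq_appLE, Scheme.Hom.appLE_comp_appLE]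
  simp only [hinv]

/-- A scheme is a T0 space, and the basic opens form a basis of an affine open. -/
theorem eq_of_mem_basicOpen_iff {V : X.Opens} (hV : IsAffineOpen V) {x y : X} (hx : x ∈ V)
    (hy : y ∈ V) (h : ∀ b : Γ(X, V), x ∈ X.basicOpen b ↔ y ∈ X.basicOpen b) : x = y := by
  by_contra hne
  obtain ⟨W, hW⟩ := exists_isOpen_xor_mem hne
  have aux : ∀ x' y' : X, x' ∈ V → x' ∈ W → y' ∉ W →
      ∃ b : Γ(X, V), x' ∈ X.basicOpen b ∧ y' ∉ X.basicOpen b := by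
    intro x' y' hx' hxW hyW
    obtain ⟨b, hb, hxb⟩ := hV.exists_basicOpen_le (V := ⟨W, hW.1⟩) ⟨x', hxW⟩ hx'
    exact ⟨b, hxb, fun hyb ↦ hyW (hb hyb)⟩
  obtain ⟨-, ⟨h1, h2⟩ | ⟨h1, h2⟩⟩ := hW
  · obtain ⟨b, hb1, hb2⟩ := aux x y hx h1 h2
    exact hb2 ((h b).mp hb1)
  · obtain ⟨b, hb1, hb2⟩ := aux y x hy h1 h2
    exact hb2 ((h b).mpr hb1)

/-- The prime ideal of sections vanishing at a point. -/
def pointIdeal {V : X.Opens} (x : X) (hx : x ∈ V) : Ideal Γ(X, V) :=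
  (IsLocalRing.maximalIdeal (X.presheaf.stalk x)).comap (X.presheaf.germ V x hx).hom

theorem mem_pointIdeal {V : X.Opens} (x : X) (hx : x ∈ V) (b : Γ(X, V)) :
    b ∈ pointIdeal x hx ↔ x ∉ X.basicOpen b := by
  rw [pointIdeal, Ideal.mem_comap, IsLocalRing.mem_maximalIdeal, mem_nonunits_iff,
    X.mem_basicOpen b x hx]

instance {V : X.Opens} (x : X) (hx : x ∈ V) : (pointIdeal x hx).IsPrime :=
  Ideal.IsPrime.comap _

/-- A finite group acts transitively on the primes lying over a given prime of the ring of
invariants. Points with the same image have ideals with the same contraction, and a point of an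
affine open is recovered from its ideal. -/
theorem exists_orbit_of_affine [Finite H] (ρ : H →* Aut X) (q : X ⟶ Z)
    (hinv : ∀ g, (ρ g).hom ≫ q = q) (U : Z.Opens) (hU : IsAffineOpen (q ⁻¹ᵁ U))
    (hsurj : ∀ b, IsInvariantSection ρ q hinv U b → ∃ a, q.app U a = b) (x y : X)
    (hx : q x ∈ U) (hxy : q x = q y) : ∃ g : H, (ρ g).hom x = y := by
  let := (q.app U).hom.toAlgebra
  let := sectionAction ρ q hinv U
  have := isInvariant_section ρ q hinv U hsurj
  have := smulCommClass_section ρ q hinv U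
  have hx' : x ∈ q ⁻¹ᵁ U := hx
  have hy' : y ∈ q ⁻¹ᵁ U := by change q y ∈ U; rwa [← hxy]
  obtain ⟨g, hg⟩ := Algebra.IsInvariant.exists_smul_of_under_eq Γ(Z, U) Γ(X, q ⁻¹ᵁ U) H
    (pointIdeal x hx') (pointIdeal y hy') (by
      ext a
      change q.app U a ∈ pointIdeal x hx' ↔ q.app U a ∈ pointIdeal y hy'
      rw [mem_pointIdeal, mem_pointIdeal, ← Scheme.preimage_basicOpen]
      change ¬ (q x ∈ Z.basicOpen a) ↔ ¬ (q y ∈ Z.basicOpen a)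
      rw [hxy])
  have hgx : (ρ g).hom x ∈ q ⁻¹ᵁ U := by
    change q ((ρ g).hom x) ∈ U
    rwa [← Scheme.Hom.comp_apply, hinv]
  refine ⟨g, eq_of_mem_basicOpen_iff hU hgx hy' fun b ↦ ?_⟩
  have h1 : b ∈ pointIdeal y hy' ↔ g⁻¹ • b ∈ pointIdeal x hx' := by
    rw [hg, Ideal.mem_pointwise_smul_iff_inv_smul_mem]
  have h2 : g⁻¹ • b = (ρ g).hom.appLE (q ⁻¹ᵁ U) (q ⁻¹ᵁ U)
      (by rw [← Scheme.Hom.comp_preimage, hinv]) b := by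
    change (ρ (g⁻¹)⁻¹).hom.appLE (q ⁻¹ᵁ U) (q ⁻¹ᵁ U) _ b = _
    simp only [inv_inv]
  rw [mem_pointIdeal, mem_pointIdeal, not_iff_not, h2] at h1
  rw [h1, Scheme.basicOpen_appLE]
  exact ⟨fun h ↦ ⟨hx', h⟩, fun h ↦ h.2⟩

theorem IsGeometricQuotient.of_basis [Finite H] (ρ : H →* Aut X) (q : X ⟶ Z)
    (hinv : ∀ g, (ρ g).hom ≫ q = q)
    {S : Set Z.Opens} (hS : ∀ (U : Z.Opens), ∀ z ∈ U, ∃ V ∈ S, z ∈ V ∧ V ≤ U)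
    (haff : ∀ V ∈ S, IsAffineOpen V) (hqaff : ∀ V ∈ S, IsAffineOpen (q ⁻¹ᵁ V))
    (hinj : ∀ V ∈ S, Function.Injective (q.app V))
    (hsurj : ∀ V ∈ S, ∀ b, IsInvariantSection ρ q hinv V b → ∃ a, q.app V a = b) :
    IsGeometricQuotient ρ q := by
  have hinj' := app_injective_of_basis q hS hinj
  have h_integral : IsIntegralHom q := by
    have hcov : ⨆ V : S, V.1 = ⊤ := by
      rw [eq_top_iff]
      intro z _
      obtain ⟨V, hVS, hzV, -⟩ := hS ⊤ z trivial
      exact Opens.mem_iSup.mpr ⟨⟨V, hVS⟩, hzV⟩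
    refine (@HasAffineProperty.iff_of_iSup_eq_top _ _ IsIntegralHom.hasAffineProperty _ _ _ _
      (fun V : S ↦ (⟨V.1, haff V.1 V.2⟩ : Z.affineOpens)) hcov).mpr fun V ↦ ⟨hqaff V.1 V.2, ?_⟩
    -- Every section is integral over the invariants of a finite group.
    have h0 : (q.app V.1).hom.IsIntegral := by
      let := (q.app V.1).hom.toAlgebra
      let := sectionAction ρ q hinv V.1
      have := isInvariant_section ρ q hinv V.1 (hsurj V.1 V.2)
      exact (Algebra.IsInvariant.isIntegral Γ(Z, V.1) Γ(X, q ⁻¹ᵁ V.1) H).isIntegral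
    have h1 : (q.app (V.1.ι ''ᵁ ⊤)).hom.IsIntegral := by
      rw [Scheme.Opens.ι_image_top]
      exact h0
    have h2 : (X.presheaf.map (eqToHom (image_morphismRestrict_preimage q V.1 ⊤)).op).hom.IsIntegral :=
      RingHom.isIntegral_of_surjective _ (ConcreteCategory.bijective_of_isIso _).2
    have h3 := h1.trans _ _ h2
    change RingHom.IsIntegral (q ∣_ V.1).appTop.hom
    rw [morphismRestrict_appTop]
    exact h3
  -- Over an open missing the image of `q` the preimage is empty and has zero ring of sections, so
  -- by injectivity the open itself has zero ring of sections. As `q` is integral, hence closed,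
  -- density will give surjectivity.
  have hdense : DenseRange q := by
    refine dense_iff_inter_open.mpr fun U hU hne ↦ ?_
    by_contra hemp
    rw [Set.not_nonempty_iff_eq_empty] at hemp
    have hbot : q ⁻¹ᵁ (⟨U, hU⟩ : Z.Opens) = ⊥ := by
      refine Opens.ext (Set.eq_empty_of_forall_notMem fun x hx ↦ ?_)
      exact (Set.eq_empty_iff_forall_notMem.mp hemp) (q x) ⟨hx, x, rfl⟩
    have h1 : Subsingleton Γ(X, q ⁻¹ᵁ (⟨U, hU⟩ : Z.Opens)) := by
      rw [hbot]
      infer_instance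
    have h2 : Subsingleton Γ(Z, ⟨U, hU⟩) := (hinj' _).subsingleton
    obtain ⟨z, hz⟩ := hne
    have : Nonempty (⟨U, hU⟩ : Z.Opens) := ⟨⟨z, hz⟩⟩
    exact not_subsingleton Γ(Z, ⟨U, hU⟩) h2
  have hcl : IsClosedMap q := q.isClosedMap
  have hsur : Function.Surjective q := by
    have := hcl.isClosed_range.closure_eq
    rw [hdense.closure_range] at this
    exact Set.range_eq_univ.mp this.symm
  exact
    { invariant := hinv
      isQuotientMap := hcl.isQuotientMap q.continuous hsur
      orbit := fun x y hxy ↦ by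
        obtain ⟨V, hVS, hzV, -⟩ := hS ⊤ (q x) trivial
        exact exists_orbit_of_affine ρ q hinv V (hqaff V hVS) (hsurj V hVS) x y hzV hxy
      injective := hinj'
      invariants := exists_app_eq_of_basis hinv hS hinj hsurj }

end LocalCriterion

end DoubleCover

namespace DoubleCover

/-- The open `V` is kept separate from `q ⁻¹ᵁ W` because on `Proj` it is given as `D₊(φ s)`, which
is only propositionally equal to the preimage of `D₊(s)`. -/
theorem IsGeometricQuotient.of_forall_exists {H : Type} [Group H] [Finite H] {X Z : Scheme.{0}}
    (ρ : H →* Aut X) (q : X ⟶ Z) (hinv : ∀ g, (ρ g).hom ≫ q = q)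
    (h : ∀ (U : Z.Opens), ∀ z ∈ U, ∃ (W : Z.Opens) (V : X.Opens) (hV : V = q ⁻¹ᵁ W),
      z ∈ W ∧ W ≤ U ∧ IsAffineOpen W ∧ IsAffineOpen V ∧ Function.Injective (q.appLE W V hV.le) ∧
      ∀ b : Γ(X, V), (∀ g, (ρ g).hom.appLE V V
        (by rw [hV, ← Scheme.Hom.comp_preimage, hinv g]) b = b) →
        ∃ a, q.appLE W V hV.le a = b) :
    IsGeometricQuotient ρ q := by
  refine IsGeometricQuotient.of_basis ρ q hinv
    (S := {W | IsAffineOpen W ∧ IsAffineOpen (q ⁻¹ᵁ W) ∧ Function.Injective (q.app W) ∧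
      ∀ b, IsInvariantSection ρ q hinv W b → ∃ a, q.app W a = b})
    ?_ (fun V hV ↦ hV.1) (fun V hV ↦ hV.2.1) (fun V hV ↦ hV.2.2.1) (fun V hV ↦ hV.2.2.2)
  intro U z hz
  obtain ⟨W, V, rfl, hzW, hWU, h1, h2, h3, h4⟩ := h U z hz
  rw [← Scheme.Hom.app_eq_appLE] at h3
  simp only [← Scheme.Hom.app_eq_appLE] at h4
  exact ⟨W, ⟨h1, h2, h3, h4⟩, hzW, hWU⟩

end DoubleCover

/-! ### Morphisms of `Proj` on standard charts, and quotients by invariants -/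

namespace ProjTools

variable {A B : Type} [CommRing A] [CommRing B] [Algebra ℂ A] [Algebra ℂ B]
  {𝒜 : ℕ → Submodule ℂ A} {ℬ : ℕ → Submodule ℂ B} [GradedAlgebra 𝒜] [GradedAlgebra ℬ]

/-- The element `u ^ n` of the monoid of powers of `u`. -/
abbrev powMk (u : B) (n : ℕ) : Submonoid.powers u := ⟨u ^ n, n, rfl⟩

section Charts

variable (φ : A →+* B) (d : ℕ) (hd : 0 < d) (hφ : ∀ n, ∀ a ∈ 𝒜 n, φ a ∈ ℬ (d * n))
    (hirr : (HomogeneousIdeal.irrelevant ℬ).toIdeal ≤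
      ((HomogeneousIdeal.irrelevant 𝒜).toIdeal.map φ).radical)

theorem awayι_projMapDeg {i : ℕ} (hi : 0 < i) {s : A} (hs : s ∈ 𝒜 i) :
    Proj.awayι ℬ (φ s) (hφ _ _ hs) (Nat.mul_pos hd hi) ≫ projMapDeg φ d hd hφ hirr =
      Spec.map (CommRingCat.ofHom (awayMapDeg φ d hφ s)) ≫ Proj.awayι 𝒜 s hs hi :=
  (coverDeg φ d hd hφ hirr).openCover.ι_glueMorphisms _ (fst_awayMapDeg φ d hd hφ)
    (⟨⟨i, hi⟩, ⟨s, hs⟩⟩ : Σ i : PNat, 𝒜 i)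

theorem exists_mem_basicOpen (hirr : (HomogeneousIdeal.irrelevant ℬ).toIdeal ≤
    ((HomogeneousIdeal.irrelevant 𝒜).toIdeal.map φ).radical) (x : Proj ℬ) :
    ∃ (i : ℕ) (_ : 0 < i) (s : A) (_ : s ∈ 𝒜 i), x ∈ Proj.basicOpen ℬ (φ s) := by
  by_contra! H
  refine x.not_irrelevant_le (hirr.trans (x.isPrime.radical_le_iff.mpr ?_))
  rw [Ideal.map_le_iff_le_comap, HomogeneousIdeal.toIdeal_irrelevant_le]
  intro i hi a ha
  by_contra hc
  exact H i hi a ha hc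

theorem projMapDeg_preimage_basicOpen {i : ℕ} (hi : 0 < i) {s : A} (hs : s ∈ 𝒜 i) :
    projMapDeg φ d hd hφ hirr ⁻¹ᵁ Proj.basicOpen 𝒜 s = Proj.basicOpen ℬ (φ s) := by
  ext x
  obtain ⟨j, hj, t, ht, hx⟩ := exists_mem_basicOpen φ hirr x
  rw [← Proj.opensRange_awayι ℬ (φ t) (hφ _ _ ht) (Nat.mul_pos hd hj)] at hx
  obtain ⟨y, rfl⟩ := hx
  change projMapDeg φ d hd hφ hirr (Proj.awayι ℬ _ _ _ y) ∈ Proj.basicOpen 𝒜 s ↔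
    y ∈ Proj.awayι ℬ _ (hφ _ _ ht) (Nat.mul_pos hd hj) ⁻¹ᵁ Proj.basicOpen ℬ (φ s)
  rw [← Scheme.Hom.comp_apply, awayι_projMapDeg φ d hd hφ hirr hj ht, Scheme.Hom.comp_apply,
    Proj.awayι_preimage_basicOpen ℬ _ _ (hφ _ _ hs) (Nat.mul_pos hd hi)]
  change Spec.map (CommRingCat.ofHom (awayMapDeg φ d hφ t)) y ∈
    Proj.awayι 𝒜 t ht hj ⁻¹ᵁ Proj.basicOpen 𝒜 s ↔ _
  rw [Proj.awayι_preimage_basicOpen 𝒜 _ _ hs hi]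
  -- The degrees upstairs are `d` times those downstairs, so the fraction `s ^ j / t ^ i` cutting
  -- out `D₊(s)` in `D₊(t)` pulls back to a fraction whose `d`-th power is the corresponding one
  -- upstairs. Both have the same nonvanishing locus since `d > 0`.
  have key : Away.isLocalizationElem (hφ _ _ ht) (hφ _ _ hs) =
      (awayMapDeg φ d hφ t (Away.isLocalizationElem ht hs)) ^ d := by
    rw [awayMapDeg_mk]
    apply HomogeneousLocalization.val_injective
    rw [HomogeneousLocalization.val_pow, Away.val_mk, Away.val_mk, Localization.mk_pow]
    congr 1
    · rw [map_pow, ← pow_mul, mul_comm]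
    · ext
      simp [← pow_mul, mul_comm]
  rw [key]
  change awayMapDeg φ d hφ t (Away.isLocalizationElem ht hs) ∉ y.asIdeal ↔ _ ∉ y.asIdeal
  rw [y.isPrime.pow_mem_iff_mem _ hd]

theorem awayToSection_appLE {i : ℕ} (hi : 0 < i) {s : A} (hs : s ∈ 𝒜 i) :
    Proj.awayToSection 𝒜 s ≫ (projMapDeg φ d hd hφ hirr).appLE (Proj.basicOpen 𝒜 s)
      (Proj.basicOpen ℬ (φ s)) (projMapDeg_preimage_basicOpen φ d hd hφ hirr hi hs).ge =
    CommRingCat.ofHom (awayMapDeg φ d hφ s) ≫ Proj.awayToSection ℬ (φ s) := by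
  set q := projMapDeg φ d hd hφ hirr
  have hle : Proj.basicOpen ℬ (φ s) ≤ q ⁻¹ᵁ Proj.basicOpen 𝒜 s :=
    (projMapDeg_preimage_basicOpen φ d hd hφ hirr hi hs).ge
  have h1 : q.resLE _ _ hle ≫ Proj.basicOpenToSpec 𝒜 s = Proj.basicOpenToSpec ℬ (φ s) ≫
      Spec.map (CommRingCat.ofHom (awayMapDeg φ d hφ s)) := by
    rw [← Proj.basicOpenIsoSpec_hom 𝒜 s hs hi,
      ← Proj.basicOpenIsoSpec_hom ℬ (φ s) (hφ _ _ hs) (Nat.mul_pos hd hi), ← Iso.eq_comp_inv,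
      ← cancel_mono (Proj.basicOpen 𝒜 s).ι, Category.assoc, Category.assoc, Scheme.Hom.resLE_comp_ι,
      Proj.basicOpenIsoSpec_inv_ι, ← awayι_projMapDeg φ d hd hφ hirr hi hs, Proj.awayι,
      Category.assoc, Iso.hom_inv_id_assoc]
  have : IsAffine (Proj.basicOpen ℬ (φ s)) :=
    Proj.isAffineOpen_basicOpen ℬ (φ s) (hφ _ _ hs) (Nat.mul_pos hd hi)
  have h2 : (Proj.basicOpen ℬ (φ s)).toSpecΓ ≫ Spec.map (q.appLE _ _ hle) =
      q.resLE _ _ hle ≫ (Proj.basicOpen 𝒜 s).toSpecΓ := by simp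
  rw [Proj.basicOpenToSpec, ← reassoc_of% h2, Proj.basicOpenToSpec, Category.assoc,
    ← Spec.map_comp, ← Spec.map_comp] at h1
  have h3 : IsIso (Proj.basicOpen ℬ (φ s)).toSpecΓ := by
    rw [← IsAffineOpen.isoSpec_hom (Proj.isAffineOpen_basicOpen ℬ (φ s) (hφ _ _ hs)
      (Nat.mul_pos hd hi))]
    infer_instance
  exact Spec.map_injective ((cancel_epi _).mp h1)

theorem projMapDeg_appLE_mk {i : ℕ} (hi : 0 < i) {s : A} (hs : s ∈ 𝒜 i) (n : ℕ) (a : A)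
    (ha : a ∈ 𝒜 (n • i)) :
    (projMapDeg φ d hd hφ hirr).appLE (Proj.basicOpen 𝒜 s)
      (Proj.basicOpen ℬ (φ s)) (projMapDeg_preimage_basicOpen φ d hd hφ hirr hi hs).ge
      (Proj.awayToSection 𝒜 s (Away.mk 𝒜 hs n a ha)) =
    Proj.awayToSection ℬ (φ s) (Away.mk ℬ (hφ i s hs) n (φ a)
      (by have := hφ _ a ha; simpa [mul_left_comm] using this)) := by
  have := congr($(awayToSection_appLE φ d hd hφ hirr hi hs) (Away.mk 𝒜 hs n a ha))
  rw [← awayMapDeg_mk φ d hφ s hs]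
  exact this

end Charts

theorem awayToSection_bijective {i : ℕ} (hi : 0 < i) {s : A} (hs : s ∈ 𝒜 i) :
    Function.Bijective (Proj.awayToSection 𝒜 s) := by
  rw [← Proj.basicOpenIsoAway_hom 𝒜 s hs hi]
  exact ConcreteCategory.bijective_of_isIso _

theorem exists_basicOpen_le {U : (Proj 𝒜).Opens} {z : Proj 𝒜} (hz : z ∈ U) :
    ∃ (i : ℕ) (_ : 0 < i) (s : A) (_ : s ∈ 𝒜 i), z ∈ Proj.basicOpen 𝒜 s ∧
      Proj.basicOpen 𝒜 s ≤ U := by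
  obtain ⟨_, ⟨a, rfl⟩, hza, haU⟩ :=
    (TopologicalSpace.Opens.isBasis_iff_nbhd.mp (Proj.isBasis_basicOpen 𝒜)) hz
  rw [Proj.basicOpen_eq_iSup_proj, TopologicalSpace.Opens.mem_iSup] at hza
  obtain ⟨i, hi⟩ := hza
  -- The chosen component of `a` may have degree `0`; multiplying it by an element of positive
  -- degree not vanishing at `z` repairs this.
  obtain ⟨j, hj, t, ht, hzt⟩ := exists_mem_basicOpen (𝒜 := 𝒜) (ℬ := 𝒜) (RingHom.id A)
    (by rw [Ideal.map_id]; exact Ideal.le_radical) z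
  refine ⟨i + j, by omega, GradedRing.proj 𝒜 i a * t,
    SetLike.mul_mem_graded (SetLike.coe_mem _) ht, ?_, ?_⟩
  · rw [Proj.basicOpen_mul]
    exact ⟨hi, hzt⟩
  · rw [Proj.basicOpen_mul]
    refine inf_le_left.trans (le_trans ?_ haU)
    rw [Proj.basicOpen_eq_iSup_proj 𝒜 a]
    exact le_iSup (fun i ↦ Proj.basicOpen 𝒜 (GradedRing.proj 𝒜 i a)) i

section Action

variable {H : Type} [CommGroup H] (ρ : H →* (ℬ →+*ᵍ ℬ))

theorem map_appLE_awayToSection (f : ℬ →+*ᵍ ℬ)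
    (hf : HomogeneousIdeal.irrelevant ℬ ≤ (HomogeneousIdeal.irrelevant ℬ).map f)
    {i : ℕ} {u : B} (hu : u ∈ ℬ i) (hfu : f u = u) 
    (e : Proj.basicOpen ℬ u ≤ Proj.map f hf ⁻¹ᵁ Proj.basicOpen ℬ u) (n : ℕ) (b : B)
    (hb : b ∈ ℬ (n • i)) :
    (Proj.map f hf).appLE _ _ e (Proj.awayToSection ℬ u (Away.mk ℬ hu n b hb)) =
      Proj.awayToSection ℬ u (Away.mk ℬ hu n (f b) (f.map_mem hb)) := by
  have key : ∀ (u' : B) (hu' : f u = u') (hm : u' ∈ ℬ i)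
      (e : Proj.basicOpen ℬ u' ≤ Proj.map f hf ⁻¹ᵁ Proj.basicOpen ℬ u),
      (Proj.map f hf).appLE _ _ e (Proj.awayToSection ℬ u (Away.mk ℬ hu n b hb)) =
      Proj.awayToSection ℬ u' (Away.mk ℬ hm n (f b) (f.map_mem hb)) := by
    rintro _ rfl hm e
    have := congr($(Proj.awayToSection_comp_appLE f hf hu) (Away.mk ℬ hu n b hb))
    refine this.trans ?_
    change Proj.awayToSection ℬ (f u) (Away.map f u _) = _
    rw [Away.map_mk]
  exact key u hfu hu e

variable (φ : A →+* B) (d : ℕ) (hd : 0 < d) (hφ : ∀ n, ∀ a ∈ 𝒜 n, φ a ∈ ℬ (d * n))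
    (hirr : (HomogeneousIdeal.irrelevant ℬ).toIdeal ≤
      ((HomogeneousIdeal.irrelevant 𝒜).toIdeal.map φ).radical)

/-- A variable `u` equal to `φ s` avoids transport between charts indexed by equal elements such as
`ρ g (φ s)` and `φ s`. -/
theorem awayι_projMapDeg_of_eq {i j : ℕ} (hi : 0 < i) {s : A} (hs : s ∈ 𝒜 i) {u : B} (hj : 0 < j)
    (hu : u ∈ ℬ j) (h : φ s = u) (hij : j = d * i) (θ : Away 𝒜 s →+* Away ℬ u)
    (hθ : ∀ n a ha, (θ (Away.mk 𝒜 hs n a ha)).val = Localization.mk (φ a) (powMk u n)) :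
    Proj.awayι ℬ u hu hj ≫ projMapDeg φ d hd hφ hirr =
      Spec.map (CommRingCat.ofHom θ) ≫ Proj.awayι 𝒜 s hs hi := by
  subst h hij
  have : θ = awayMapDeg φ d hφ s := by
    ext x
    obtain ⟨n, a, ha, rfl⟩ := Away.mk_surjective 𝒜 hs x
    rw [hθ, awayMapDeg_mk, Away.val_mk]
  rw [this]
  exact awayι_projMapDeg φ d hd hφ hirr hi hs

theorem projAction_projMapDeg (hinv : ∀ g a, ρ g (φ a) = φ a) (g : H) :
    (projAction ρ g).hom ≫ projMapDeg φ d hd hφ hirr = projMapDeg φ d hd hφ hirr := by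
  change Proj.map (ρ g) (irrelevant_le_map ρ g) ≫ _ = _
  refine (coverDeg φ d hd hφ hirr).openCover.hom_ext _ _ fun (s : Σ i : PNat, 𝒜 i) ↦ ?_
  obtain ⟨⟨i, hi⟩, s, hs⟩ := s
  replace hs : s ∈ 𝒜 i := hs
  change Proj.awayι ℬ (φ s) (hφ _ _ hs) (Nat.mul_pos hd hi) ≫ _ =
    Proj.awayι ℬ (φ s) (hφ _ _ hs) (Nat.mul_pos hd hi) ≫ _
  have key : ∀ (u : B) (hu' : ρ g (φ s) = u) (hu : u ∈ ℬ (d * i)),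
      Proj.awayι ℬ u hu (Nat.mul_pos hd hi) ≫ Proj.map (ρ g) (irrelevant_le_map ρ g) ≫
        projMapDeg φ d hd hφ hirr =
      Proj.awayι ℬ u hu (Nat.mul_pos hd hi) ≫ projMapDeg φ d hd hφ hirr := by
    rintro _ rfl hu
    rw [Proj.awayι_comp_map_assoc (ρ g) (irrelevant_le_map ρ g) (Nat.mul_pos hd hi) (φ s)
      (hφ _ _ hs), awayι_projMapDeg φ d hd hφ hirr hi hs, ← Spec.map_comp_assoc,
      ← CommRingCat.ofHom_comp]
    refine (awayι_projMapDeg_of_eq φ d hd hφ hirr hi hs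
      (Nat.mul_pos hd hi) hu (hinv g s).symm rfl _ ?_).symm
    intro n a ha
    rw [RingHom.comp_apply, awayMapDeg_mk, Away.map_mk, Away.val_mk, hinv g a]
  exact key _ (hinv g s) (hφ _ _ hs)

/-- The average of an element under a finite group of automorphisms. -/
def average [Fintype H] (b : B) : B := (Fintype.card H : ℂ)⁻¹ • ∑ g, ρ g b

theorem average_mem [Fintype H] {n : ℕ} {b : B} (hb : b ∈ ℬ n) : average ρ b ∈ ℬ n :=
  Submodule.smul_mem _ _ (Submodule.sum_mem _ fun g _ ↦ (ρ g).map_mem hb)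

theorem apply_average [Fintype H]
    (hlin : ∀ g (c : ℂ), ρ g (algebraMap ℂ B c) = algebraMap ℂ B c) (h : H) (b : B) :
    ρ h (average ρ b) = average ρ b := by
  rw [average, Algebra.smul_def, map_mul, hlin, map_sum]
  congr 1
  have : ∀ g, ρ h (ρ g b) = ρ (h * g) b := fun g ↦ by rw [map_mul]; rfl
  simp only [this]
  exact Fintype.sum_equiv (Equiv.mulLeft h) _ _ fun _ ↦ rfl

/-- The numerator of an invariant fraction is invariant only after multiplication by powers of `u`.
Every `g b / u ^ n` equals `b / u ^ n`, so replacing the numerator by its average, which is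
genuinely invariant, leaves the fraction unchanged. -/
theorem mk_average_eq [Fintype H] {i : ℕ} {u : B} (hu : u ∈ ℬ i) (n : ℕ) (b : B)
    (hb : b ∈ ℬ (n • i))
    (h : ∀ g, Away.mk ℬ hu n (ρ g b) ((ρ g).map_mem hb) = Away.mk ℬ hu n b hb) :
    Away.mk ℬ hu n (average ρ b) (average_mem ρ hb) = Away.mk ℬ hu n b hb := by
  apply HomogeneousLocalization.val_injective
  have h' : ∀ g, Localization.mk (ρ g b) (powMk u n) =
      Localization.mk b (powMk u n) := fun g ↦ congr(($(h g)).val)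
  have hmk : ∀ x : B, Localization.mk x (powMk u n) =
      algebraMap B _ x * Localization.mk 1 (powMk u n) := by
    intro x
    rw [← Localization.mk_one_eq_algebraMap, Localization.mk_mul]
    simp
  rw [Away.val_mk, Away.val_mk, hmk, average, Algebra.smul_def, map_mul, map_sum, mul_assoc,
    Finset.sum_mul]
  simp only [← hmk, h', Finset.sum_const, Finset.card_univ, nsmul_eq_mul]
  rw [← mul_assoc, ← map_natCast (algebraMap B (Localization (Submonoid.powers u))), ← map_mul,
    ← map_natCast (algebraMap ℂ B), ← map_mul, inv_mul_cancel₀, map_one, map_one, one_mul]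
  exact_mod_cast Fintype.card_ne_zero

theorem awayMapDeg_injective (hinj : Function.Injective φ) {i : ℕ} {s : A} (hs : s ∈ 𝒜 i) :
    Function.Injective (awayMapDeg φ d hφ s) := by
  rw [injective_iff_map_eq_zero]
  intro x hx
  obtain ⟨n, a, ha, rfl⟩ := Away.mk_surjective 𝒜 hs x
  rw [awayMapDeg_mk] at hx
  have h1 := congrArg HomogeneousLocalization.val hx
  rw [Away.val_mk, HomogeneousLocalization.val_zero, Localization.mk_eq_mk', IsLocalization.mk'_eq_zero_iff] at h1
  obtain ⟨⟨_, k, rfl⟩, hk⟩ := h1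
  apply HomogeneousLocalization.val_injective
  rw [Away.val_mk, HomogeneousLocalization.val_zero, Localization.mk_eq_mk',
    IsLocalization.mk'_eq_zero_iff]
  exact ⟨⟨s ^ k, k, rfl⟩, hinj (by simpa using hk)⟩

/-- Distinct degrees remain distinct after multiplication by `d > 0`, so `φ` does not mix
components. This makes relations between images of `φ` homogeneous. -/
theorem decompose_apply_of_mul (hφ : ∀ n, ∀ a ∈ 𝒜 n, φ a ∈ ℬ (d * n)) (hd : 0 < d) (a : A) (n : ℕ) :
    (DirectSum.decompose ℬ (φ a) (d * n) : B) = φ (DirectSum.decompose 𝒜 a n) := by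
  classical
  conv_lhs => rw [← DirectSum.sum_support_decompose 𝒜 a, map_sum, DirectSum.decompose_sum]
  rw [DFinsupp.finsetSum_apply, AddSubmonoidClass.coe_finsetSum]
  have : ∀ m, (DirectSum.decompose ℬ (φ (DirectSum.decompose 𝒜 a m)) (d * n) : B) =
      if m = n then φ (DirectSum.decompose 𝒜 a n) else 0 := by
    intro m
    split_ifs with h
    · subst h
      exact DirectSum.decompose_of_mem_same ℬ (hφ _ _ (SetLike.coe_mem _))
    · exact DirectSum.decompose_of_mem_ne ℬ (hφ _ _ (SetLike.coe_mem _))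
        (fun h' ↦ h (Nat.eq_of_mul_eq_mul_left hd h'))
  simp only [this]
  rw [Finset.sum_ite_eq']
  split_ifs with h
  · rfl
  · rw [DFinsupp.notMem_support_iff] at h
    simp [h]

/-- If `φ` identifies `A` with the ring of invariants of a finite group acting on `B`, then
`Proj B ⟶ Proj A` is the geometric quotient. -/
theorem isGeometricQuotient_projMapDeg [Finite H]
    (hlin : ∀ g (c : ℂ), ρ g (algebraMap ℂ B c) = algebraMap ℂ B c)
    (hinv : ∀ g a, ρ g (φ a) = φ a) (hinj : Function.Injective φ)
    (hsurj : ∀ b, (∀ g, ρ g b = b) → ∃ a, φ a = b) :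
    IsGeometricQuotient (projAction ρ) (projMapDeg φ d hd hφ hirr) := by
  have := Fintype.ofFinite H
  refine IsGeometricQuotient.of_forall_exists _ _
    (projAction_projMapDeg ρ φ d hd hφ hirr hinv) fun U z hz ↦ ?_
  obtain ⟨i, hi, s, hs, hzs, hsU⟩ : ∃ (i : ℕ) (_ : 0 < i) (s : A) (_ : s ∈ 𝒜 i),
      z ∈ Proj.basicOpen 𝒜 s ∧ Proj.basicOpen 𝒜 s ≤ U := exists_basicOpen_le hz
  refine ⟨Proj.basicOpen 𝒜 s, Proj.basicOpen ℬ (φ s),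
    (projMapDeg_preimage_basicOpen φ d hd hφ hirr hi hs).symm, hzs, hsU,
    Proj.isAffineOpen_basicOpen 𝒜 s hs hi,
    Proj.isAffineOpen_basicOpen ℬ _ (hφ _ _ hs) (Nat.mul_pos hd hi), ?_, fun b hb ↦ ?_⟩
  · intro x y hxy
    obtain ⟨x, rfl⟩ := (awayToSection_bijective hi hs).2 x
    obtain ⟨y, rfl⟩ := (awayToSection_bijective hi hs).2 y
    rw [← CommRingCat.comp_apply, ← CommRingCat.comp_apply, awayToSection_appLE φ d hd hφ hirr hi hs] at hxy
    exact congrArg _ (awayMapDeg_injective φ d hφ hinj hs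
      ((awayToSection_bijective (Nat.mul_pos hd hi) (hφ _ _ hs)).1 hxy))
  · obtain ⟨x, rfl⟩ := (awayToSection_bijective (Nat.mul_pos hd hi) (hφ _ _ hs)).2 b
    obtain ⟨n, b, hbn, rfl⟩ := Away.mk_surjective ℬ (hφ _ _ hs) x
    have h1 : ∀ g, Away.mk ℬ (hφ _ _ hs) n (ρ g b) ((ρ g).map_mem hbn) =
        Away.mk ℬ (hφ _ _ hs) n b hbn := by
      intro g
      apply (awayToSection_bijective (Nat.mul_pos hd hi) (hφ _ _ hs)).1
      rw [← map_appLE_awayToSection (ρ g) (irrelevant_le_map ρ g) (hφ _ _ hs) (hinv g s)]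
      exact hb g
    have h2 := mk_average_eq ρ (hφ _ _ hs) n b hbn h1
    obtain ⟨a, ha⟩ := hsurj _ fun g ↦ apply_average ρ hlin g b
    have hdeg : n • (d * i) = d * (n • i) := by simp only [smul_eq_mul]; ring
    -- The preimage `a` need not be homogeneous; its component of degree `n • i` has the same image,
    -- since the average is homogeneous.
    have ha' : φ (DirectSum.decompose 𝒜 a (n • i)) = average ρ b := by
      rw [← decompose_apply_of_mul φ d hφ hd, ha]
      exact DirectSum.decompose_of_mem_same ℬ (hdeg ▸ average_mem ρ hbn)
    refine ⟨Proj.awayToSection 𝒜 s (Away.mk 𝒜 hs n (DirectSum.decompose 𝒜 a (n • i))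
      (SetLike.coe_mem _)), ?_⟩
    rw [projMapDeg_appLE_mk φ d hd hφ hirr hi hs, ← h2]
    congr 1
    ext
    rw [Away.val_mk, Away.val_mk, ha']

end Action

end ProjTools

/-! ### The graded ring of invariants and existence of the quotient -/

namespace ProjTools

section InvariantRing

variable {B : Type} [CommRing B] [Algebra ℂ B] {ℬ : ℕ → Submodule ℂ B} [GradedAlgebra ℬ]
  {H : Type} [CommGroup H] (ρ : H →* (ℬ →+*ᵍ ℬ))
  (hlin : ∀ g (c : ℂ), ρ g (algebraMap ℂ B c) = algebraMap ℂ B c)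

/-- The ring of invariants of a group of automorphisms. -/
def invariantRing : Subalgebra ℂ B where
  carrier := {b | ∀ g, ρ g b = b}
  mul_mem' ha hb g := by rw [map_mul, ha g, hb g]
  add_mem' ha hb g := by rw [map_add, ha g, hb g]
  algebraMap_mem' c g := hlin g c

/-- The grading of the ring of invariants. -/
def invariantGrading (n : ℕ) : Submodule ℂ (invariantRing ρ hlin) :=
  (ℬ n).comap (invariantRing ρ hlin).val.toLinearMap

instance : SetLike.GradedMonoid (invariantGrading ρ hlin) where
  one_mem := SetLike.GradedOne.one_mem (A := ℬ)
  mul_mem _ _ _ _ ha hb := SetLike.GradedMul.mul_mem (A := ℬ) ha hb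

theorem apply_decompose (f : ℬ →+*ᵍ ℬ) (b : B) (n : ℕ) :
    f (DirectSum.decompose ℬ b n) = DirectSum.decompose ℬ (f b) n := by
  have := decompose_apply_of_mul (𝒜 := ℬ) (ℬ := ℬ) f.toRingHom 1
    (fun n a ha ↦ by rw [one_mul]; exact f.map_mem ha) one_pos b n
  rw [one_mul] at this
  exact this.symm

/-- Graded automorphisms commute with taking components, so the components of an invariant are
invariant. -/
theorem isInternal_invariantGrading : DirectSum.IsInternal (invariantGrading ρ hlin) := by
  classical
  constructor
  · let F : (DirectSum ℕ fun i ↦ invariantGrading ρ hlin i) →+ DirectSum ℕ fun i ↦ ℬ i :=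
      DirectSum.map fun i ↦ (((invariantRing ρ hlin).val.toLinearMap.restrict
        (p := invariantGrading ρ hlin i) (q := ℬ i) fun _ h ↦ h) : _ →+ _)
    have hF : Function.Injective F := by
      refine (DirectSum.map_injective _).mpr fun i x y hxy ↦ ?_
      exact Subtype.ext (Subtype.ext congr(($hxy : B)))
    have hcomp : ∀ x, ((DirectSum.coeAddMonoidHom (invariantGrading ρ hlin) x :
        invariantRing ρ hlin) : B) = DirectSum.coeAddMonoidHom ℬ (F x) := by
      intro x
      induction x using DirectSum.induction_on with
      | zero => simp
      | of i x =>
        simp only [F, DirectSum.map_of, DirectSum.coeAddMonoidHom_of]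
        rfl
      | add x y hx hy => simp [hx, hy]
    intro x y hxy
    apply hF
    apply (DirectSum.Decomposition.isInternal ℬ).injective
    rw [← hcomp, ← hcomp, hxy]
  · intro b
    have hmem : ∀ i, (DirectSum.decompose ℬ (b : B) i : B) ∈ invariantRing ρ hlin := by
      intro i g
      rw [apply_decompose, b.2 g]
    refine ⟨∑ i ∈ (DirectSum.decompose ℬ (b : B)).support,
      DirectSum.of (fun i ↦ invariantGrading ρ hlin i) i
        ⟨⟨DirectSum.decompose ℬ (b : B) i, hmem i⟩, SetLike.coe_mem (DirectSum.decompose ℬ (b : B) i)⟩, ?_⟩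
    rw [map_sum]
    apply Subtype.ext
    conv_rhs => rw [← DirectSum.sum_support_decompose ℬ (b : B)]
    rw [AddSubmonoidClass.coe_finsetSum]
    refine Finset.sum_congr rfl fun i _ ↦ ?_
    rw [DirectSum.coeAddMonoidHom_of]

instance : GradedAlgebra (invariantGrading ρ hlin) where
  toDecomposition := (isInternal_invariantGrading ρ hlin).chooseDecomposition

/-- The quotient of `Proj B` by a finite group acting on `B` exists. -/
theorem exists_isGeometricQuotient [Finite H] {A : Type} [CommRing A] [Algebra ℂ A]
    {𝒜 : ℕ → Submodule ℂ A} [GradedAlgebra 𝒜] (φ : A →+* B) (d : ℕ) (hd : 0 < d)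
    (hφ : ∀ n, ∀ a ∈ 𝒜 n, φ a ∈ ℬ (d * n))
    (hirr : (HomogeneousIdeal.irrelevant ℬ).toIdeal ≤
      ((HomogeneousIdeal.irrelevant 𝒜).toIdeal.map φ).radical)
    (hinv : ∀ g a, ρ g (φ a) = φ a)
    (hlin : ∀ g (c : ℂ), ρ g (algebraMap ℂ B c) = algebraMap ℂ B c) :
    ∃ (Z : Scheme.{0}) (q : Proj ℬ ⟶ Z), IsGeometricQuotient (projAction ρ) q ∧
      ∀ (i : ℕ) (_ : 0 < i) (s : A) (_ : s ∈ 𝒜 i), ∃ U : Z.Opens, IsAffineOpen U ∧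
        q ⁻¹ᵁ U = Proj.basicOpen ℬ (φ s) := by
  let S := invariantRing ρ hlin
  have h1 : ∀ n, ∀ b ∈ invariantGrading ρ hlin n, S.val.toRingHom b ∈ ℬ (1 * n) := by
    intro n b hb
    rw [one_mul]
    exact hb
  have h2 : (HomogeneousIdeal.irrelevant ℬ).toIdeal ≤
      ((HomogeneousIdeal.irrelevant (invariantGrading ρ hlin)).toIdeal.map
        S.val.toRingHom).radical := by
    -- The invariants contain `φ A`, so the irrelevant ideal of the invariants generates at least
    -- what that of `A` does. The auxiliary ring `A` serves to guarantee this and to supply the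
    -- charts.
    refine hirr.trans (Ideal.radical_mono ?_)
    rw [Ideal.map_le_iff_le_comap, HomogeneousIdeal.toIdeal_irrelevant_le]
    intro i hi a ha
    have hmem : (⟨φ a, fun g ↦ hinv g a⟩ : S) ∈ invariantGrading ρ hlin (d * i) := hφ i a ha
    exact Ideal.mem_map_of_mem S.val.toRingHom
      (HomogeneousIdeal.mem_irrelevant_of_mem _ (Nat.mul_pos hd hi) hmem)
  refine ⟨Proj (invariantGrading ρ hlin), projMapDeg S.val.toRingHom 1 one_pos h1 h2,
    isGeometricQuotient_projMapDeg ρ _ 1 one_pos h1 h2 hlin (fun g a ↦ a.2 g)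
      Subtype.val_injective fun b hb ↦ ⟨⟨b, hb⟩, rfl⟩, fun i hi s hs ↦ ?_⟩
  have hmem : (⟨φ s, fun g ↦ hinv g s⟩ : S) ∈ invariantGrading ρ hlin (d * i) := hφ i s hs
  exact ⟨Proj.basicOpen _ (⟨φ s, fun g ↦ hinv g s⟩ : S),
    Proj.isAffineOpen_basicOpen _ _ hmem (Nat.mul_pos hd hi),
    projMapDeg_preimage_basicOpen S.val.toRingHom 1 one_pos h1 h2 (Nat.mul_pos hd hi) hmem⟩

end InvariantRing

end ProjTools

/-! ### Equations of reduced divisors on affine charts -/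

namespace DoubleCover

theorem preimage_fromSpec_eq_zeroLocus {X : Scheme.{0}} (D : Set X)
    {U : X.Opens} (hU : IsAffineOpen U) (s : Γ(X, U))
    (h : ∀ x ∈ U, x ∈ X.basicOpen s ↔ x ∉ D) :
    hU.fromSpec ⁻¹' D = PrimeSpectrum.zeroLocus {s} := by
  ext y
  have hy : hU.fromSpec y ∈ U := by
    have : hU.fromSpec y ∈ Set.range hU.fromSpec := ⟨y, rfl⟩
    rwa [hU.range_fromSpec] at this
  have h3 : y ∈ hU.fromSpec ⁻¹ᵁ X.basicOpen s ↔ y ∈ PrimeSpectrum.basicOpen s :=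
    ⟨fun h ↦ (hU.fromSpec_preimage_basicOpen s).le h,
      fun h ↦ (hU.fromSpec_preimage_basicOpen s).ge h⟩
  have h4 : hU.fromSpec y ∉ D ↔ s ∉ y.asIdeal := (h _ hy).symm.trans h3
  exact (not_iff_not.mp h4).trans Set.singleton_subset_iff.symm

/-- On the spectrum of `Γ(X, U)` the set `D` is the zero locus of `s`, so the functions vanishing on
it form the radical of `(s)`. -/
theorem vanishingIdeal_ideal_eq_radical {X : Scheme.{0}} (D : TopologicalSpace.Closeds X)
    (U : X.affineOpens) (s : Γ(X, U.1))
    (h : ∀ x ∈ U.1, x ∈ X.basicOpen s ↔ x ∉ D) :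
    (Scheme.IdealSheafData.vanishingIdeal D).ideal U = (Ideal.span {s}).radical := by
  refine (congrArg PrimeSpectrum.vanishingIdeal
    (preimage_fromSpec_eq_zeroLocus (D : Set X) U.2 s h)).trans ?_
  exact (congrArg PrimeSpectrum.vanishingIdeal (PrimeSpectrum.zeroLocus_span _).symm).trans
    (PrimeSpectrum.vanishingIdeal_zeroLocus_eq_radical _)

theorem appLE_app_of_comp_eq {X Y Z : Scheme.{0}} {q : X ⟶ Y} {p : Y ⟶ Z} {f : X ⟶ Z}
    (h : q ≫ p = f) {U : Z.Opens} {V : X.Opens} (e : V ≤ q ⁻¹ᵁ (p ⁻¹ᵁ U)) (e' : V ≤ f ⁻¹ᵁ U)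
    (c : Γ(Z, U)) : q.appLE (p ⁻¹ᵁ U) V e (p.app U c) = f.appLE U V e' c := by
  subst h
  rw [Scheme.Hom.comp_appLE]
  rfl

theorem isRadical_span_singleton_map {R S : Type*} [CommRing R] [CommRing S] (σ : R ≃+* S) {x : R}
    (h : (Ideal.span {x}).IsRadical) : (Ideal.span {σ x}).IsRadical := by
  rintro y ⟨k, hk⟩
  obtain ⟨y, rfl⟩ := σ.surjective y
  rw [Ideal.mem_span_singleton, ← map_pow, map_dvd_iff] at hk
  rw [Ideal.mem_span_singleton, map_dvd_iff]
  exact Ideal.mem_span_singleton.mp (h ⟨k, Ideal.mem_span_singleton.mpr hk⟩)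

namespace IsGeometricQuotient

variable {H : Type} [Group H] {X Z : Scheme.{0}} {ρ : H →* Aut X} {q : X ⟶ Z}

theorem appLE_injective (hq : IsGeometricQuotient ρ q) {U : Z.Opens} {V : X.Opens}
    (hV : q ⁻¹ᵁ U = V) : Function.Injective (q.appLE U V hV.ge) := by
  subst hV
  rw [← Scheme.Hom.app_eq_appLE]
  exact hq.injective U

theorem exists_appLE_eq (hq : IsGeometricQuotient ρ q) {U : Z.Opens} {V : X.Opens}
    (hV : q ⁻¹ᵁ U = V) (b : Γ(X, V)) (hb : ∀ g, (ρ g).hom.appLE V V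
      (by rw [← hV, ← Scheme.Hom.comp_preimage, hq.invariant g]) b = b) :
    ∃ a, q.appLE U V hV.ge a = b := by
  subst hV
  rw [← Scheme.Hom.app_eq_appLE]
  exact hq.invariants U b hb

theorem appLE_appLE (hq : IsGeometricQuotient ρ q) {U : Z.Opens} {V : X.Opens}
    (hV : q ⁻¹ᵁ U = V) (a : Γ(Z, U)) (g : H) : (ρ g).hom.appLE V V
      (by rw [← hV, ← Scheme.Hom.comp_preimage, hq.invariant g]) (q.appLE U V hV.ge a) =
      q.appLE U V hV.ge a := by
  rw [← CommRingCat.comp_apply, Scheme.Hom.appLE_comp_appLE]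
  exact appLE_congr (hq.invariant g) _ a

end IsGeometricQuotient

end DoubleCover

namespace ProjTools

variable {A B : Type} [CommRing A] [CommRing B] [Algebra ℂ A] [Algebra ℂ B]
  {𝒜 : ℕ → Submodule ℂ A} {ℬ : ℕ → Submodule ℂ B} [GradedAlgebra 𝒜] [GradedAlgebra ℬ]

theorem isUnit_mapId_awayMk_iff {i : ℕ} {t : A} (ht : t ∈ 𝒜 i) (n : ℕ) (a : A)
    (ha : a ∈ 𝒜 (n • i)) (x : ProjectiveSpectrum 𝒜)
    (hx : Submonoid.powers t ≤ x.asHomogeneousIdeal.toIdeal.primeCompl) :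
    IsUnit (HomogeneousLocalization.mapId 𝒜 hx (Away.mk 𝒜 ht n a ha)) ↔ a ∉ x.asHomogeneousIdeal := by
  have h : (HomogeneousLocalization.mapId 𝒜 hx (Away.mk 𝒜 ht n a ha)).val =
      Localization.mk a ⟨t ^ n, hx ⟨n, rfl⟩⟩ := rfl
  rw [← HomogeneousLocalization.isUnit_iff_isUnit_val, h, Localization.mk_eq_mk',
    IsLocalization.AtPrime.isUnit_mk'_iff]
  rfl

theorem mem_basicOpen_awayToSection {i : ℕ} {t : A} (ht : t ∈ 𝒜 i) (n : ℕ) (a : A)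
    (ha : a ∈ 𝒜 (n • i)) (x : Proj 𝒜) (hx : x ∈ Proj.basicOpen 𝒜 t) :
    x ∈ (Proj 𝒜).basicOpen (Proj.awayToSection 𝒜 t (Away.mk 𝒜 ht n a ha)) ↔
      a ∉ x.asHomogeneousIdeal := by
  rw [Scheme.mem_basicOpen _ _ _ hx]
  have h1 := congr($(ProjectiveSpectrum.Proj.awayToSection_germ 𝒜 t x hx) (Away.mk 𝒜 ht n a ha))
  have h2 : (Proj 𝒜).presheaf.germ (Proj.basicOpen 𝒜 t) x hx
      (Proj.awayToSection 𝒜 t (Away.mk 𝒜 ht n a ha)) = _ := h1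
  rw [h2]
  exact (MulEquiv.isUnit_map (Proj.stalkIso' 𝒜 x).symm).trans
    (isUnit_mapId_awayMk_iff ht n a ha x (Submonoid.powers_le.mpr hx))

theorem awayMk_mul {i : ℕ} {t : A} (ht : t ∈ 𝒜 i) (n m : ℕ) (a b : A)
    (ha : a ∈ 𝒜 (n • i)) (hb : b ∈ 𝒜 (m • i)) :
    Away.mk 𝒜 ht n a ha * Away.mk 𝒜 ht m b hb = Away.mk 𝒜 ht (n + m) (a * b)
      (by rw [add_smul]; exact SetLike.mul_mem_graded ha hb) := by
  apply HomogeneousLocalization.val_injective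
  rw [HomogeneousLocalization.val_mul, Away.val_mk, Away.val_mk, Away.val_mk, Localization.mk_mul]
  congr 1
  ext
  simp [pow_add]

theorem awayMk_pow {i : ℕ} {t : A} (ht : t ∈ 𝒜 i) (n k : ℕ) (a : A) (ha : a ∈ 𝒜 (n • i)) :
    Away.mk 𝒜 ht n a ha ^ k = Away.mk 𝒜 ht (k * n) (a ^ k)
      (by rw [mul_smul]; exact SetLike.pow_mem_graded k ha) := by
  apply HomogeneousLocalization.val_injective
  rw [HomogeneousLocalization.val_pow, Away.val_mk, Away.val_mk, Localization.mk_pow]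
  congr 1
  ext
  simp [← pow_mul, mul_comm]

/-- The cofactor is replaced by its component of degree `n`, as only that component contributes in
degree `m + n`. Cofactors obtained from divisibility thus become numerators of degree-zero
fractions. -/
theorem exists_mul_eq_of_mem {m n : ℕ} {P c : A} (hP : P ∈ 𝒜 m) (h : P * c ∈ 𝒜 (m + n)) :
    ∃ c' ∈ 𝒜 n, P * c' = P * c := by
  refine ⟨DirectSum.decompose 𝒜 c n, SetLike.coe_mem _, ?_⟩
  rw [← DirectSum.coe_decompose_mul_add_of_left_mem 𝒜 hP, DirectSum.decompose_of_mem_same 𝒜 h]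

theorem isDomain_away [IsDomain A] {t : A} (h0 : t ≠ 0) : IsDomain (Away 𝒜 t) := by
  have := IsLocalization.isDomain_localization (powers_le_nonZeroDivisors_of_noZeroDivisors h0)
  exact (HomogeneousLocalization.val_injective (𝒜 := 𝒜) (Submonoid.powers t)).isDomain
    (algebraMap (Away 𝒜 t) (Localization (Submonoid.powers t)))

theorem awayMk_eq_iff [IsDomain A] {i : ℕ} {t : A} (ht : t ∈ 𝒜 i) (h0 : t ≠ 0) (n m : ℕ) (a b : A)
    (ha : a ∈ 𝒜 (n • i)) (hb : b ∈ 𝒜 (m • i)) :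
    Away.mk 𝒜 ht n a ha = Away.mk 𝒜 ht m b hb ↔ a * t ^ m = b * t ^ n := by
  rw [← (HomogeneousLocalization.val_injective _).eq_iff, Away.val_mk, Away.val_mk,
    Localization.mk_eq_mk_iff, Localization.r_iff_exists]
  constructor
  · rintro ⟨⟨_, k, rfl⟩, hk⟩
    have := mul_left_cancel₀ (pow_ne_zero k h0) hk
    rw [mul_comm a, this, mul_comm]
  · intro h
    refine ⟨1, ?_⟩
    simp only [Submonoid.coe_one, one_mul]
    rw [mul_comm, h, mul_comm]

/-- If a power of `a / t ^ n` is a multiple of `P / t ^ m`, then `P` divides a power of `a t`, hence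
`a t` itself because `P` is squarefree. -/
theorem isRadical_span_awayMk [IsDomain A] [UniqueFactorizationMonoid A] {i : ℕ} {t : A} (ht : t ∈ 𝒜 i) (h0 : t ≠ 0) (m : ℕ) {P : A}
    (hP : P ∈ 𝒜 (m • i)) (hsq : Squarefree P) :
    (Ideal.span {Away.mk 𝒜 ht m P hP}).IsRadical := by
  rintro x ⟨k, hk⟩
  rw [Ideal.mem_span_singleton] at hk ⊢
  obtain ⟨n, a, ha, rfl⟩ := Away.mk_surjective 𝒜 ht x
  obtain ⟨y, hy⟩ := hk
  obtain ⟨l, b, hb, rfl⟩ := Away.mk_surjective 𝒜 ht y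
  rw [awayMk_pow, awayMk_mul, awayMk_eq_iff ht h0] at hy
  -- Already `P ∣ a * t`; the extra factor `t ^ m` makes the cofactor have the nonnegative degree
  -- `(n + 1) • i`.
  have hdvd : P ∣ a * t ^ (m + 1) := by
    have h1 : P ∣ (a * t) ^ (k + (m + l) + 1) := by
      have : P ∣ a ^ k * t ^ (m + l) := hy ▸ (Dvd.intro _ rfl : P ∣ P * b).mul_right _
      exact this.trans ⟨a ^ (m + l + 1) * t ^ (k + 1), by ring⟩
    refine (hsq.isRadical _ _ h1).trans ⟨t ^ m, by ring⟩
  obtain ⟨c, hc⟩ := hdvd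
  obtain ⟨c', hc', hcc⟩ := exists_mul_eq_of_mem (n := (n + 1) • i) hP (c := c) (by
    rw [← hc]
    have := SetLike.mul_mem_graded ha (SetLike.pow_mem_graded (m + 1) ht)
    convert this using 2
    simp only [smul_eq_mul]; ring)
  refine ⟨Away.mk 𝒜 ht (n + 1) c' hc', ?_⟩
  rw [awayMk_mul, awayMk_eq_iff ht h0, hcc, ← hc]
  ring

end ProjTools

/-! ### Invariants of the form `A ⊕ A W` and the double cover they define -/

namespace ProjTools

variable {A B : Type} [CommRing A] [CommRing B] [Algebra ℂ A] [Algebra ℂ B]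
  {𝒜 : ℕ → Submodule ℂ A} {ℬ : ℕ → Submodule ℂ B} [GradedAlgebra 𝒜] [GradedAlgebra ℬ]

section Split

variable (φ : A →+* B) (d : ℕ) (hφ : ∀ n, ∀ a ∈ 𝒜 n, φ a ∈ ℬ (d * n)) {W : B}

theorem eq_zero_of_awayMapDeg_add_mul [IsDomain A]
    (hind : ∀ a c, φ a + φ c * W = 0 → a = 0 ∧ c = 0)
    {i : ℕ} {t : A} (ht : t ∈ 𝒜 i) (h0 : t ≠ 0) (hW : W ∈ ℬ (1 • (d * i))) (x y : Away 𝒜 t)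
    (h : awayMapDeg φ d hφ t x + awayMapDeg φ d hφ t y * Away.mk ℬ (hφ _ _ ht) 1 W hW = 0) :
    x = 0 ∧ y = 0 := by
  obtain ⟨n, a, ha, rfl⟩ := Away.mk_surjective 𝒜 ht x
  obtain ⟨m, c, hc, rfl⟩ := Away.mk_surjective 𝒜 ht y
  rw [awayMapDeg_mk, awayMapDeg_mk, awayMk_mul] at h
  have h1 := congrArg HomogeneousLocalization.val h
  rw [HomogeneousLocalization.val_add, Away.val_mk, Away.val_mk, HomogeneousLocalization.val_zero,
    Localization.add_mk, Localization.mk_eq_mk', IsLocalization.mk'_eq_zero_iff] at h1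
  obtain ⟨⟨_, k, rfl⟩, hk⟩ := h1
  obtain ⟨h2, h3⟩ := hind (a * t ^ (m + 1) * t ^ k) (c * t ^ n * t ^ k) (by
    rw [← hk]
    simp only [map_mul, map_pow]
    ring)
  have h4 : a = 0 := by simpa [h0] using h2
  have h5 : c = 0 := by simpa [h0] using h3
  subst h4 h5
  constructor <;>
  · apply HomogeneousLocalization.val_injective
    rw [Away.val_mk, HomogeneousLocalization.val_zero, Localization.mk_zero]

/-- The numerator is first multiplied by `φ t`: the coefficient of `W` then has degree `n • i`,
whereas without the factor its degree would be negative for `n = 0`. The given relation is made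
homogeneous by taking components. -/
theorem exists_awayMapDeg_add_mul (hd : 0 < d) {i : ℕ} {t : A} (ht : t ∈ 𝒜 i) (hW : W ∈ ℬ (1 • (d * i)))
    (n : ℕ) (b : B) (hb : b ∈ ℬ (n • (d * i))) (a c : A) (h : φ t * b = φ a + φ c * W) :
    ∃ x y : Away 𝒜 t, Away.mk ℬ (hφ _ _ ht) n b hb =
      awayMapDeg φ d hφ t x + awayMapDeg φ d hφ t y * Away.mk ℬ (hφ _ _ ht) 1 W hW := by
  have hb' : φ t * b ∈ ℬ (d * ((n + 1) • i)) := by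
    have := SetLike.mul_mem_graded (hφ _ _ ht) hb
    convert this using 2
    simp only [smul_eq_mul]; ring
  have h1 : φ t * b = φ (DirectSum.decompose 𝒜 a ((n + 1) • i)) +
      φ (DirectSum.decompose 𝒜 c (n • i)) * W := by
    have hdeg : d * ((n + 1) • i) = d * (n • i) + 1 • (d * i) := by
      simp only [smul_eq_mul]; ring
    rw [← decompose_apply_of_mul φ d hφ hd, ← decompose_apply_of_mul φ d hφ hd,
      ← DirectSum.coe_decompose_mul_add_of_right_mem ℬ hW, ← hdeg,
      ← Submodule.coe_add, ← DirectSum.add_apply, ← DirectSum.decompose_add, ← h,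
      DirectSum.decompose_of_mem_same ℬ hb']
  refine ⟨Away.mk 𝒜 ht (n + 1) _ (SetLike.coe_mem (DirectSum.decompose 𝒜 a ((n + 1) • i))),
    Away.mk 𝒜 ht n _ (SetLike.coe_mem (DirectSum.decompose 𝒜 c (n • i))), ?_⟩
  rw [awayMapDeg_mk, awayMapDeg_mk, awayMk_mul]
  apply HomogeneousLocalization.val_injective
  rw [HomogeneousLocalization.val_add, Away.val_mk, Away.val_mk, Away.val_mk, Localization.add_mk,
    Localization.mk_eq_mk_iff, Localization.r_iff_exists]
  refine ⟨1, ?_⟩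
  simp only [Submonoid.coe_one, one_mul, Submonoid.coe_mul]
  calc _ = φ t ^ (n + 1) * φ t ^ n * (φ t * b) := by ring
    _ = _ := by rw [h1]; ring

end Split

end ProjTools

namespace DoubleCover

open TopologicalSpace ProjTools

variable {A B : Type} [CommRing A] [CommRing B] [Algebra ℂ A] [Algebra ℂ B]
  {𝒜 : ℕ → Submodule ℂ A} {ℬ : ℕ → Submodule ℂ B} [GradedAlgebra 𝒜] [GradedAlgebra ℬ]
  {H : Type} [CommGroup H] [Finite H] (ρ : H →* (ℬ →+*ᵍ ℬ))
  (φ : A →+* B) (d : ℕ) (hd : 0 < d) (hφ : ∀ n, ∀ a ∈ 𝒜 n, φ a ∈ ℬ (d * n))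
  (hirr : (HomogeneousIdeal.irrelevant ℬ).toIdeal ≤
    ((HomogeneousIdeal.irrelevant 𝒜).toIdeal.map φ).radical)

/-- This holds for the model `Proj` of the ring of invariants, and uniqueness of geometric quotients
transfers it to an arbitrary one. -/
theorem IsGeometricQuotient.exists_isAffineOpen_preimage_eq (hd : 0 < d)
    (hφ : ∀ n, ∀ a ∈ 𝒜 n, φ a ∈ ℬ (d * n))
    (hirr : (HomogeneousIdeal.irrelevant ℬ).toIdeal ≤
      ((HomogeneousIdeal.irrelevant 𝒜).toIdeal.map φ).radical)
    (hlin : ∀ g (c : ℂ), ρ g (algebraMap ℂ B c) = algebraMap ℂ B c)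
    (hinv : ∀ g a, ρ g (φ a) = φ a) {Z : Scheme.{0}} {q : Proj ℬ ⟶ Z}
    (hq : IsGeometricQuotient (projAction ρ) q) {i : ℕ} (hi : 0 < i) {t : A} (ht : t ∈ 𝒜 i) :
    ∃ U : Z.Opens, IsAffineOpen U ∧ q ⁻¹ᵁ U = Proj.basicOpen ℬ (φ t) := by
  obtain ⟨Z', q', hq', h⟩ := exists_isGeometricQuotient ρ φ d hd hφ hirr hinv hlin
  obtain ⟨e, he⟩ := hq.exists_iso hq'
  obtain ⟨U, hU, hqU⟩ := h i hi t ht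
  refine ⟨e.hom ⁻¹ᵁ U, hU.preimage_of_isIso e.hom, ?_⟩
  rw [← Scheme.Hom.comp_preimage, he, hqU]

theorem eq_of_preimage_eq {X Z : Scheme.{0}} {q : X ⟶ Z} (hq : Function.Surjective q)
    {U V : Z.Opens} (h : q ⁻¹ᵁ U = q ⁻¹ᵁ V) : U = V := by
  ext z
  obtain ⟨x, rfl⟩ := hq z
  exact (congrArg (x ∈ ·) h).to_iff

/-- The quotient of `Proj B` by a finite group whose ring of invariants is `A ⊕ A W`, with `W²` a
squarefree element `P` of `A`, is a double cover of `Proj A` branched along `{P = 0}`. -/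
theorem IsGeometricQuotient.isDoubleCover [IsDomain A] [UniqueFactorizationMonoid A]
    (hlin : ∀ g (c : ℂ), ρ g (algebraMap ℂ B c) = algebraMap ℂ B c)
    (hinv : ∀ g a, ρ g (φ a) = φ a) {W : B} {P : A} {i : ℕ} (hi : 0 < i)
    (hW : W ∈ ℬ (1 • (d * i))) (hP : P ∈ 𝒜 (2 • i)) (hsq : Squarefree P) (hWP : W ^ 2 = φ P)
    (hWinv : ∀ g, ρ g W = W) (hind : ∀ a c, φ a + φ c * W = 0 → a = 0 ∧ c = 0)
    (hspan : ∀ b, (∀ g, ρ g b = b) → ∃ a c, b = φ a + φ c * W)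
    (hcov : ∀ x : Proj 𝒜, ∃ t ∈ 𝒜 i, x ∈ Proj.basicOpen 𝒜 t)
    {D : Closeds (Proj 𝒜)} (hD : ∀ x : Proj 𝒜, x ∈ D ↔ P ∈ x.asHomogeneousIdeal)
    {Z : Scheme.{0}} {q : Proj ℬ ⟶ Z} (hq : IsGeometricQuotient (projAction ρ) q)
    {p : Z ⟶ Proj 𝒜} (hp : q ≫ p = projMapDeg φ d hd hφ hirr) : IsDoubleCover p D := by
  have hpre : ∀ t ∈ 𝒜 i, q ⁻¹ᵁ (p ⁻¹ᵁ Proj.basicOpen 𝒜 t) = Proj.basicOpen ℬ (φ t) := by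
    intro t ht
    rw [← Scheme.Hom.comp_preimage, hp]
    exact projMapDeg_preimage_basicOpen φ d hd hφ hirr hi ht
  constructor
  · refine isAffineHom_of_forall_exists_isAffineOpen _ fun x ↦ ?_
    obtain ⟨t, ht, hx⟩ := hcov x
    refine ⟨Proj.basicOpen 𝒜 t, hx, Proj.isAffineOpen_basicOpen 𝒜 t ht hi, ?_⟩
    obtain ⟨U, hU, hqU⟩ := hq.exists_isAffineOpen_preimage_eq ρ φ d hd hφ hirr hlin hinv hi ht
    rwa [eq_of_preimage_eq hq.surjective ((hpre t ht).trans hqU.symm)]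
  · intro x
    obtain ⟨t, ht, hx⟩ := hcov x
    have h0 : t ≠ 0 := by
      rintro rfl
      exact hx (zero_mem x.asHomogeneousIdeal.toIdeal)
    have hdi := Nat.mul_pos hd hi
    have hbij := awayToSection_bijective (𝒜 := 𝒜) hi ht
    have hbij' := awayToSection_bijective (𝒜 := ℬ) hdi (hφ _ _ ht)
    have hmap : ∀ (y : Away 𝒜 t), q.appLE _ _ (hpre t ht).ge
        (p.app _ (Proj.awayToSection 𝒜 t y)) =
          Proj.awayToSection ℬ (φ t) (awayMapDeg φ d hφ t y) := by
      intro y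
      have h1 := congr($(awayToSection_appLE φ d hd hφ hirr hi ht) y)
      exact (appLE_app_of_comp_eq hp _ _ _).trans h1
    -- The fraction `W / φ t` is invariant, hence descends to the quotient; it has square `P / t ^
    -- 2`, which explains the degrees `d * i` of `W` and `2 • i` of `P`.
    obtain ⟨w, hw⟩ := hq.exists_appLE_eq (hpre t ht)
      (Proj.awayToSection ℬ (φ t) (Away.mk ℬ (hφ _ _ ht) 1 W hW)) (by
        intro g
        refine (map_appLE_awayToSection (ρ g) (irrelevant_le_map ρ g) (hφ _ _ ht) (hinv g t)
          _ 1 W hW).trans ?_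
        congr 1
        ext
        rw [Away.val_mk, Away.val_mk, hWinv])
    refine ⟨⟨Proj.basicOpen 𝒜 t, Proj.isAffineOpen_basicOpen 𝒜 t ht hi⟩, hx,
      Proj.awayToSection 𝒜 t (Away.mk 𝒜 ht 2 P hP), w, ?_, ?_, ?_, ?_⟩
    · have := isDomain_away (𝒜 := 𝒜) h0
      have hnz : Away.mk 𝒜 ht 2 P hP ≠ 0 := by
        intro h
        have h1 := congrArg HomogeneousLocalization.val h
        rw [Away.val_mk, HomogeneousLocalization.val_zero, Localization.mk_eq_mk',
          IsLocalization.mk'_eq_zero_iff] at h1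
        obtain ⟨⟨_, k, rfl⟩, hk⟩ := h1
        exact mul_ne_zero (pow_ne_zero k h0) hsq.ne_zero hk
      let σ := RingEquiv.ofBijective (Proj.awayToSection 𝒜 t).hom hbij
      have := σ.symm.toMulEquiv.isDomain
      exact mem_nonZeroDivisors_of_ne_zero ((map_ne_zero_iff σ σ.injective).mpr hnz)
    · rw [vanishingIdeal_ideal_eq_radical D _ (Proj.awayToSection 𝒜 t (Away.mk 𝒜 ht 2 P hP))]
      · exact (isRadical_span_singleton_map (RingEquiv.ofBijective
          (Proj.awayToSection 𝒜 t).hom hbij) (isRadical_span_awayMk ht h0 2 hP hsq)).radical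
      · intro x hx
        rw [hD]
        exact mem_basicOpen_awayToSection ht 2 P hP x hx
    · apply hq.appLE_injective (hpre t ht)
      rw [map_pow, hw]
      refine Eq.trans ?_ (hmap _).symm
      rw [← map_pow, awayMk_pow, awayMapDeg_mk]
      congr 1
      ext
      rw [Away.val_mk, Away.val_mk, hWP]
    · intro b
      have hex : ∃ x y : Away 𝒜 t, q.appLE _ _ (hpre t ht).ge b =
          Proj.awayToSection ℬ (φ t) (awayMapDeg φ d hφ t x + awayMapDeg φ d hφ t y *
            Away.mk ℬ (hφ _ _ ht) 1 W hW) := by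
        have := Fintype.ofFinite H
        obtain ⟨x, hx⟩ := hbij'.2 (q.appLE _ _ (hpre t ht).ge b)
        obtain ⟨n, b', hbn, rfl⟩ := Away.mk_surjective ℬ (hφ _ _ ht) x
        have h1 : ∀ g, Away.mk ℬ (hφ _ _ ht) n (ρ g b') ((ρ g).map_mem hbn) =
            Away.mk ℬ (hφ _ _ ht) n b' hbn := by
          intro g
          apply hbij'.1
          rw [← map_appLE_awayToSection (ρ g) (irrelevant_le_map ρ g) (hφ _ _ ht) (hinv g t), hx]
          · exact hq.appLE_appLE (hpre t ht) b g
          · exact hbn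
        have h2 := mk_average_eq ρ (hφ _ _ ht) n b' hbn h1
        -- The splitting of invariants is applied to `φ t` times the averaged numerator, as the
        -- degree count for fractions requires.
        obtain ⟨a, c, hac⟩ := hspan (φ t * average ρ b') fun g ↦ by
          rw [map_mul, hinv, apply_average ρ hlin]
        obtain ⟨x, y, hxy⟩ := exists_awayMapDeg_add_mul φ d hφ hd ht hW n _ (average_mem ρ hbn)
          a c hac
        exact ⟨x, y, by rw [← hx, ← h2, hxy]⟩
      have hval : ∀ x y : Away 𝒜 t, q.appLE _ _ (hpre t ht).ge
          (p.app _ (Proj.awayToSection 𝒜 t x) + p.app _ (Proj.awayToSection 𝒜 t y) * w) =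
          Proj.awayToSection ℬ (φ t) (awayMapDeg φ d hφ t x + awayMapDeg φ d hφ t y *
            Away.mk ℬ (hφ _ _ ht) 1 W hW) := by
        intro x y
        rw [map_add, map_mul, hmap, hmap, hw, map_add, map_mul]
      obtain ⟨x, y, hxy⟩ := hex
      refine ⟨(Proj.awayToSection 𝒜 t x, Proj.awayToSection 𝒜 t y),
        hq.appLE_injective (hpre t ht) (hxy.trans (hval x y).symm), ?_⟩
      rintro ⟨x', y'⟩ hxy'
      obtain ⟨x', rfl⟩ := hbij.2 x'
      obtain ⟨y', rfl⟩ := hbij.2 y'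
      have h3 := hbij'.1 ((hval x' y').symm.trans ((congrArg _ hxy'.symm).trans hxy))
      obtain ⟨h4, h5⟩ := eq_zero_of_awayMapDeg_add_mul φ d hφ hind ht h0 hW (x' - x) (y' - y) (by
        rw [map_sub, map_sub]
        linear_combination h3)
      rw [sub_eq_zero.mp h4, sub_eq_zero.mp h5]

end DoubleCover

/-! ### Quadratic extensions, integral closure and normalization -/

namespace DoubleCover

/-- `B = A ⊕ A w` with `w² = s ∈ A`. -/
structure IsQuadratic {A B : Type*} [CommRing A] [CommRing B] (φ : A →+* B) (s : A) (w : B) :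
    Prop where
  sq : w ^ 2 = φ s
  existsUnique : ∀ b : B, ∃! c : A × A, b = φ c.1 + φ c.2 * w

namespace IsQuadratic

variable {A B R : Type*} [CommRing A] [CommRing B] [CommRing R] {φ : A →+* B} {s : A} {w : B}

theorem exists_eq (h : IsQuadratic φ s w) (b : B) : ∃ a c, b = φ a + φ c * w := by
  obtain ⟨c, hc, -⟩ := h.existsUnique b
  exact ⟨c.1, c.2, hc⟩

theorem eq_and_eq (h : IsQuadratic φ s w) {a c a' c' : A}
    (he : φ a + φ c * w = φ a' + φ c' * w) : a = a' ∧ c = c' := by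
  have := (h.existsUnique (φ a + φ c * w)).unique (y₁ := (a, c)) (y₂ := (a', c')) rfl he
  exact ⟨congrArg Prod.fst this, congrArg Prod.snd this⟩

theorem exists_ringHom (h : IsQuadratic φ s w) (α : A →+* R) (v : R) (hv : v ^ 2 = α s) :
    ∃ θ : B →+* R, (∀ a, θ (φ a) = α a) ∧ θ w = v := by
  choose a c hac using h.exists_eq
  have key : ∀ b x y, b = φ x + φ y * w → a b = x ∧ c b = y := fun b x y hb ↦
    h.eq_and_eq ((hac b).symm.trans hb)
  have hmul : ∀ x y x' y' : A, (φ x + φ y * w) * (φ x' + φ y' * w) =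
      φ (x * x' + s * y * y') + φ (x * y' + y * x') * w := by
    intro x y x' y'
    simp only [map_add, map_mul, ← h.sq]
    ring
  refine ⟨{ toFun := fun b ↦ α (a b) + α (c b) * v
            map_one' := ?_, map_zero' := ?_, map_add' := ?_, map_mul' := ?_ }, ?_, ?_⟩
  · obtain ⟨h1, h2⟩ := key 1 1 0 (by simp)
    simp [h1, h2]
  · intro x y
    obtain ⟨h1, h2⟩ := key (x * y) _ _ (by
      conv_lhs => rw [hac x, hac y]
      exact hmul _ _ _ _)
    rw [h1, h2]
    simp only [map_add, map_mul, ← hv]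
    ring
  · obtain ⟨h1, h2⟩ := key 0 0 0 (by simp)
    simp [h1, h2]
  · intro x y
    obtain ⟨h1, h2⟩ := key (x + y) (a x + a y) (c x + c y) (by
      conv_lhs => rw [hac x, hac y]
      simp only [map_add]
      ring)
    simp only [h1, h2, map_add]
    ring
  · intro x
    obtain ⟨h1, h2⟩ := key (φ x) x 0 (by simp)
    simp [h1, h2]
  · obtain ⟨h1, h2⟩ := key w 0 1 (by simp)
    simp [h1, h2]

end IsQuadratic

section IntegralClosure

variable {A K : Type*} [CommRing A] [IsDomain A] [IsIntegrallyClosed A] [Field K] [Algebra A K]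
  [IsFractionRing A K]

/-- Let `e = x + y √h` be integral. Its trace `2 x` is integral over `A`, so `x ∈ A`; then `y ^ 2
h`, the square of `e - x`, lies in `A` too. As `s = h r ^ 2`, the element `δ = s y / r` satisfies `δ
^ 2 = s (y ^ 2 h)`, so `δ` lies in `A` by normality and in `(s)` because `(s)` is radical. Hence `y
/ r ∈ A`. The algebra need not be a field: `h` may be a square. -/
theorem exists_eq_of_isIntegral_quadraticAlgebra (h2 : IsUnit (2 : A)) {s : A} (hs0 : s ≠ 0)
    (hs : (Ideal.span {s}).IsRadical) {h r : K} (hr : algebraMap A K s = h * r ^ 2)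
    {e : QuadraticAlgebra K h 0} (he : IsIntegral A e) :
    ∃ a c : A, e = ⟨algebraMap A K a, algebraMap A K c * r⟩ := by
  have hr0 : r ≠ 0 := by
    rintro rfl
    exact hs0 ((FaithfulSMul.algebraMap_injective A K) (by simp [hr]))
  have hh0 : h ≠ 0 := by
    rintro rfl
    exact hs0 ((FaithfulSMul.algebraMap_injective A K) (by simp [hr]))
  have hinj : Function.Injective (algebraMap K (QuadraticAlgebra K h 0)) :=
    FaithfulSMul.algebraMap_injective _ _
  have he' : IsIntegral A (star e) := by
    let σ : QuadraticAlgebra K h 0 →ₐ[A] QuadraticAlgebra K h 0 :=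
      { toRingHom := (starRingEnd (QuadraticAlgebra K h 0))
        commutes' := fun a ↦ by
          rw [IsScalarTower.algebraMap_apply A K (QuadraticAlgebra K h 0)]
          ext <;> simp [starRingEnd_apply] }
    exact he.map σ
  obtain ⟨u, hu⟩ := h2
  have htr : IsIntegral A (2 * e.re) := by
    rw [← isIntegral_algebraMap_iff (B := QuadraticAlgebra K h 0) hinj]
    convert he.add he' using 1
    ext <;> simp [two_mul]
  obtain ⟨a, ha⟩ := IsIntegrallyClosed.isIntegral_iff.mp htr
  have ha' : algebraMap A K (↑u⁻¹ * a) = e.re := by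
    rw [map_mul, ha, ← mul_assoc]
    have : algebraMap A K ↑u⁻¹ * 2 = 1 := by
      rw [← map_ofNat (algebraMap A K) 2, ← hu, ← map_mul, Units.inv_mul, map_one]
    rw [this, one_mul]
  have him : IsIntegral A (e.im ^ 2 * h) := by
    rw [← isIntegral_algebraMap_iff (B := QuadraticAlgebra K h 0) hinj]
    have h3 : IsIntegral A (e - algebraMap A _ (↑u⁻¹ * a)) := he.sub isIntegral_algebraMap
    convert h3.pow 2 using 1
    rw [IsScalarTower.algebraMap_apply A K (QuadraticAlgebra K h 0), ha']
    ext <;> simp [pow_two]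
    ring
  obtain ⟨b, hb⟩ := IsIntegrallyClosed.isIntegral_iff.mp him
  have hδ : (e.im / r * algebraMap A K s) ^ 2 = algebraMap A K (s * b) := by
    rw [map_mul, hb, hr]
    field_simp
  obtain ⟨δ, hδ'⟩ := IsIntegrallyClosed.isIntegral_iff.mp
    (IsIntegral.of_pow (R := A) (n := 2) two_pos (hδ ▸ isIntegral_algebraMap))
  have hmem : δ ∈ Ideal.span {s} := hs ⟨2, by
    have : δ ^ 2 = s * b := FaithfulSMul.algebraMap_injective A K (by
      rw [map_pow, hδ', hδ])
    rw [this]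
    exact Ideal.mul_mem_right _ _ (Ideal.mem_span_singleton_self s)⟩
  obtain ⟨c, rfl⟩ := Ideal.mem_span_singleton.mp hmem
  refine ⟨↑u⁻¹ * a, c, ?_⟩
  have hs0' : algebraMap A K s ≠ 0 := by simpa using hs0
  have hc : e.im / r = algebraMap A K c := by
    rw [map_mul] at hδ'
    exact mul_left_cancel₀ hs0' (by rw [hδ']; ring)
  ext
  · simp [ha']
  · simp [← hc, hr0]

variable {B : Type*} [CommRing B] {φ : A →+* B} {s : A} {w : B}

/-- The image `A + A r √h` contains every integral element by the preceding computation, and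
consists of integral elements because `w ^ 2 = s`. -/
theorem IsQuadratic.injective_and_range (hB : IsQuadratic φ s w) (h2 : IsUnit (2 : A))
    (hs0 : s ≠ 0) (hs : (Ideal.span {s}).IsRadical) {h r : K} (ψ : B →+* QuadraticAlgebra K h 0)
    (hψ : ∀ a, ψ (φ a) = algebraMap K _ (algebraMap A K a)) (hw : ψ w = ⟨0, r⟩) :
    Function.Injective ψ ∧ ∀ e, (ψ.comp φ).IsIntegralElem e ↔ e ∈ Set.range ψ := by
  have hinj := FaithfulSMul.algebraMap_injective A K
  have hr : algebraMap A K s = h * r ^ 2 := by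
    have h1 := congrArg ψ hB.sq
    rw [map_pow, hw, hψ] at h1
    have := congrArg QuadraticAlgebra.re h1
    simp [pow_two] at this
    rw [← this]; ring
  have hr0 : r ≠ 0 := by
    rintro rfl
    exact hs0 (hinj (by simp [hr]))
  have hval : ∀ a c, ψ (φ a + φ c * w) = ⟨algebraMap A K a, algebraMap A K c * r⟩ := by
    intro a c
    rw [map_add, map_mul, hψ, hψ, hw]
    ext <;> simp
  have hcomp : ψ.comp φ = algebraMap A (QuadraticAlgebra K h 0) := by
    ext1 a
    rw [RingHom.comp_apply, hψ, ← IsScalarTower.algebraMap_apply A K (QuadraticAlgebra K h 0)]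
  refine ⟨?_, fun e ↦ ⟨fun he ↦ ?_, ?_⟩⟩
  · rw [injective_iff_map_eq_zero]
    intro b hb
    obtain ⟨a, c, rfl⟩ := hB.exists_eq b
    rw [hval] at hb
    have h1 : a = 0 := hinj (by simpa using congrArg QuadraticAlgebra.re hb)
    have h3 : c = 0 := hinj (by simpa [hr0] using congrArg QuadraticAlgebra.im hb)
    simp [h1, h3]
  · rw [hcomp] at he
    obtain ⟨a, c, rfl⟩ := exists_eq_of_isIntegral_quadraticAlgebra h2 hs0 hs hr he
    exact ⟨_, hval a c⟩
  · rintro ⟨b, rfl⟩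
    obtain ⟨a, c, rfl⟩ := hB.exists_eq b
    have hwi : (ψ.comp φ).IsIntegralElem (ψ w) := by
      rw [hcomp]
      refine IsIntegral.of_pow (R := A) (n := 2) two_pos ?_
      rw [← map_pow, hB.sq]
      exact (RingHom.congr_fun hcomp s) ▸ isIntegral_algebraMap
    have hci : ∀ x, (ψ.comp φ).IsIntegralElem (ψ (φ x)) := fun x ↦
      RingHom.isIntegralElem_map (ψ.comp φ)
    rw [map_add, map_mul]
    exact RingHom.IsIntegralElem.add _ (hci a) (RingHom.IsIntegralElem.mul _ (hci c) hwi)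

end IntegralClosure

theorem toNormalization_appLE_injective_and_isIntegralElem {S X : Scheme.{0}} (j : S ⟶ X)
    [QuasiCompact j] [QuasiSeparated j] {U : X.Opens} (hU : IsAffineOpen U)
    {V : j.normalization.Opens} (hV : j.fromNormalization ⁻¹ᵁ U = V)
    (e : j ⁻¹ᵁ U ≤ j.toNormalization ⁻¹ᵁ V) :
    Function.Injective (j.toNormalization.appLE V (j ⁻¹ᵁ U) e) ∧
      ∀ y, (j.app U).hom.IsIntegralElem (j.toNormalization.appLE V (j ⁻¹ᵁ U) e y) := by
  subst hV
  let := (j.app U).hom.toAlgebra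
  rw [← j.normalizationObjIso_hom_val hU]
  refine ⟨?_, fun y ↦ ?_⟩
  · intro a b hab
    exact (ConcreteCategory.bijective_of_isIso (j.normalizationObjIso hU).hom).1
      (Subtype.ext hab)
  · exact ((j.normalizationObjIso hU).hom y).2

theorem isIntegral_appLE {X T : Scheme.{0}} {p : T ⟶ X} {U : X.Opens}
    (h : (p.app U).hom.IsIntegral) {U' : X.Opens} {V : T.Opens} (hU : U = U') (hV : p ⁻¹ᵁ U = V)
    (e : V ≤ p ⁻¹ᵁ U') : (p.appLE U' V e).hom.IsIntegral := by
  subst hU hV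
  rwa [← Scheme.Hom.app_eq_appLE]

/-- The hypothesis makes `p` integral, so the universal property of the normalization gives a
morphism to `T`. Over each `U` both sides have as functions the integral closure of `Γ(X, U)` in
`Γ(S, j⁻¹ U)`, so it is an isomorphism. -/
theorem exists_iso_normalization {S X T : Scheme.{0}} (j : S ⟶ X) [QuasiCompact j]
    [QuasiSeparated j] (g : S ⟶ T) (p : T ⟶ X) [IsAffineHom p] (hj : j = g ≫ p)
    (h : ∀ x : X, ∃ U : X.Opens, x ∈ U ∧ IsAffineOpen U ∧
      Function.Injective (g.appLE (p ⁻¹ᵁ U) (j ⁻¹ᵁ U) (by rw [hj]; rfl)) ∧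
      ∀ e, (j.app U).hom.IsIntegralElem e ↔
        e ∈ Set.range (g.appLE (p ⁻¹ᵁ U) (j ⁻¹ᵁ U) (by rw [hj]; rfl))) :
    ∃ e : j.normalization ≅ T, e.hom ≫ p = j.fromNormalization := by
  choose U hxU hU hinj h_integral using h
  have hcomp : ∀ x, (j.app (U x)).hom = (g.appLE (p ⁻¹ᵁ U x) (j ⁻¹ᵁ U x) (by rw [hj]; rfl)).hom.comp
      (p.app (U x)).hom := by
    intro x
    ext c
    exact ((appLE_app_of_comp_eq hj.symm (by rw [hj]; rfl) le_rfl c).trans (by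
      rw [Scheme.Hom.app_eq_appLE])).symm
  have : IsIntegralHom p := by
    refine (@HasAffineProperty.iff_of_iSup_eq_top _ _ IsIntegralHom.hasAffineProperty _ _ p _
      (fun x ↦ ⟨U x, hU x⟩) ?_).mpr ?_
    · exact top_le_iff.mp (fun x _ ↦ by simpa using ⟨x, hxU x⟩)
    · intro x
      refine ⟨(hU x).preimage p, ?_⟩
      have h_integral' : (p.app (U x)).hom.IsIntegral := by
        intro b
        -- An integral equation for the image of `b` on `S` is already one for `b`, by injectivity.
        obtain ⟨P, hP, hP'⟩ := (h_integral x _).mpr ⟨b, rfl⟩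
        refine ⟨P, hP, hinj x ?_⟩
        rw [hcomp, ← Polynomial.hom_eval₂] at hP'
        exact hP'.trans (map_zero _).symm
      have key : (p ∣_ U x).app ⊤ = _ := morphismRestrict_app' p (U x) ⊤
      change ((p ∣_ U x).app ⊤).hom.IsIntegral
      rw [key]
      exact isIntegral_appLE h_integral' (by simp) (by simp) _
  have hiso : IsIso (j.normalizationDesc g p hj) := by
    refine (IsZariskiLocalAtTarget.iff_of_iSup_eq_top (P := .isomorphisms _)
      (fun x ↦ p ⁻¹ᵁ U x) ?_).mpr fun x ↦ ?_
    · exact top_le_iff.mp (fun t _ ↦ by simpa using ⟨p t, hxU (p t)⟩)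
    change IsIso _
    rw [isIso_morphismRestrict_iff_isIso_app _ ((hU x).preimage p)]
    set n := j.normalizationDesc g p hj with hn
    have hV : j.fromNormalization ⁻¹ᵁ U x = n ⁻¹ᵁ (p ⁻¹ᵁ U x) := by
      rw [← j.normalizationDesc_comp g p hj]; rfl
    have hle : j ⁻¹ᵁ U x ≤ j.toNormalization ⁻¹ᵁ (n ⁻¹ᵁ (p ⁻¹ᵁ U x)) := by
      rw [← hV, ← Scheme.Hom.comp_preimage, j.toNormalization_fromNormalization]
    obtain ⟨h1, h2⟩ := toNormalization_appLE_injective_and_isIntegralElem j (hU x) hV hle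
    have h3 : ∀ b, j.toNormalization.appLE _ _ hle (n.app (p ⁻¹ᵁ U x) b) =
        g.appLE (p ⁻¹ᵁ U x) (j ⁻¹ᵁ U x) (by rw [hj]; rfl) b := fun b ↦
      appLE_app_of_comp_eq (j.toNormalization_normalizationDesc g p hj) _ _ b
    rw [ConcreteCategory.isIso_iff_bijective]
    refine ⟨fun a b hab ↦ hinj x ?_, fun y ↦ ?_⟩
    · rw [← h3, ← h3, hab]
    · obtain ⟨b, hb⟩ := (h_integral x _).mp (h2 y)
      exact ⟨b, h1 ((h3 b).trans hb)⟩
  exact ⟨asIso (j.normalizationDesc g p hj), j.normalizationDesc_comp g p hj⟩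

end DoubleCover

/-! ### Double covers over the generic point -/

namespace DoubleCover

open TopologicalSpace

variable {X T : Scheme.{0}}

theorem exists_pow_mul_res_eq {O : X.Opens} (hO : IsAffineOpen O) (f : Γ(X, O)) {V : X.Opens}
    (hV : V = X.basicOpen f) (hVO : V ≤ O) (y : Γ(X, V)) :
    ∃ (n : ℕ) (x : Γ(X, O)), X.presheaf.map (homOfLE hVO).op x =
      X.presheaf.map (homOfLE hVO).op f ^ n * y := by
  let := (X.presheaf.map (homOfLE hVO).op).hom.toAlgebra
  have := hO.isLocalization_of_eq_basicOpen f (homOfLE hVO) hV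
  obtain ⟨⟨x, _, n, rfl⟩, hx⟩ := IsLocalization.surj (Submonoid.powers f) y
  refine ⟨n, x, ?_⟩
  rw [mul_comm, ← map_pow]
  exact hx.symm

theorem exists_pow_mul_eq_zero {O : X.Opens} (hO : IsAffineOpen O) (f : Γ(X, O)) {V : X.Opens}
    (hV : V = X.basicOpen f) (hVO : V ≤ O) (x : Γ(X, O))
    (hx : X.presheaf.map (homOfLE hVO).op x = 0) : ∃ n : ℕ, f ^ n * x = 0 := by
  let := (X.presheaf.map (homOfLE hVO).op).hom.toAlgebra
  have := hO.isLocalization_of_eq_basicOpen f (homOfLE hVO) hV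
  obtain ⟨⟨_, n, rfl⟩, hn⟩ := (IsLocalization.map_eq_zero_iff (Submonoid.powers f) Γ(X, V) x).mp hx
  exact ⟨n, hn⟩

theorem germToFunctionField_map [IsIntegral X] {U V : X.Opens} [Nonempty U] [Nonempty V]
    (h : V ≤ U) (a : Γ(X, U)) :
    X.germToFunctionField V (X.presheaf.map (homOfLE h).op a) = X.germToFunctionField U a :=
  X.presheaf.germ_res_apply _ _ _ _

theorem SpecMap_fromSpec_appLE {O : T.Opens} (hO : IsAffineOpen O) {R : CommRingCat.{0}}
    (θ : Γ(T, O) ⟶ R) (e : ⊤ ≤ (Spec.map θ ≫ hO.fromSpec) ⁻¹ᵁ O) :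
    (Spec.map θ ≫ hO.fromSpec).appLE O ⊤ e = θ ≫ (Scheme.ΓSpecIso R).inv := by
  have e' : ⊤ ≤ Spec.map θ ⁻¹ᵁ (hO.fromSpec ⁻¹ᵁ O) := e
  have h1 : (Spec.map θ ≫ hO.fromSpec).appLE O ⊤ e = hO.fromSpec.app O ≫
    (Spec.map θ).appLE _ ⊤ e' := Scheme.Hom.comp_appLE _ _ _ _ _
  rw [h1, hO.fromSpec_app_self, Category.assoc, Scheme.Hom.map_appLE,
    Scheme.ΓSpecIso_inv_naturality, Scheme.Hom.appTop, Scheme.Hom.app_eq_appLE]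
  rfl

/-- The quadratic extension `K(√h)` of the function field of `X`. -/
abbrev quadExt (X : Scheme.{0}) [IsIntegral X] (h : X.functionField) : CommRingCat.{0} :=
  .of (QuadraticAlgebra X.functionField h 0)

/-- The morphism `Spec K(√h) ⟶ X` above the generic point of `X`. -/
def quadHom (X : Scheme.{0}) [IsIntegral X] (h : X.functionField) : Spec (quadExt X h) ⟶ X :=
  Spec.map (CommRingCat.ofHom (algebraMap X.functionField (quadExt X h))) ≫
    X.fromSpecStalk (genericPoint X)

variable [IsIntegral X] (h : X.functionField)

/-- The image consists of generizations of the generic point, and these lie in every nonempty open.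
-/
theorem quadHom_preimage (U : X.Opens) [hU : Nonempty U] : quadHom X h ⁻¹ᵁ U = ⊤ := by
  rw [eq_top_iff]
  intro y _
  have hy : quadHom X h y ∈ Set.range (X.fromSpecStalk (genericPoint X)) :=
    ⟨Spec.map (CommRingCat.ofHom (algebraMap X.functionField (quadExt X h))) y, rfl⟩
  rw [Scheme.range_fromSpecStalk] at hy
  exact hy.mem_open U.2 (((genericPoint_spec X).mem_open_set_iff U.isOpen).mpr (by simpa using hU))

theorem quadHom_eq {U : X.Opens} (hU : IsAffineOpen U) [Nonempty U] :
    quadHom X h = Spec.map (X.germToFunctionField U ≫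
      CommRingCat.ofHom (algebraMap X.functionField (quadExt X h))) ≫ hU.fromSpec := by
  have hηU : genericPoint X ∈ U :=
    ((genericPoint_spec X).mem_open_set_iff U.isOpen).mpr (by simpa using ‹Nonempty U›)
  rw [quadHom, ← hU.fromSpecStalk_eq_fromSpecStalk hηU, IsAffineOpen.fromSpecStalk,
    ← Spec.map_comp_assoc]
  rfl

theorem quadHom_appLE {U : X.Opens} (hU : IsAffineOpen U) [Nonempty U] (a : Γ(X, U)) :
    (quadHom X h).appLE U ⊤ (quadHom_preimage h U).ge a =
      (Scheme.ΓSpecIso (quadExt X h)).inv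
        (algebraMap X.functionField (quadExt X h) (X.germToFunctionField U a)) := by
  rw [appLE_congr (quadHom_eq h hU), SpecMap_fromSpec_appLE]
  rfl

section Eval

variable {h} {p : T ⟶ X} {g : Spec (quadExt X h) ⟶ T} (hg : quadHom X h = g ≫ p)

theorem top_le_preimage (hg : quadHom X h = g ≫ p) (U : X.Opens) [Nonempty U] :
    ⊤ ≤ g ⁻¹ᵁ (p ⁻¹ᵁ U) := by
  rw [← Scheme.Hom.comp_preimage, ← hg, quadHom_preimage]

/-- Evaluation of functions on `p⁻¹ U` at a `K(√h)`-point of `T`. -/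
def evalHom (U : X.Opens) [Nonempty U] : Γ(T, p ⁻¹ᵁ U) →+* quadExt X h :=
  (g.appLE (p ⁻¹ᵁ U) ⊤ (top_le_preimage hg U) ≫ (Scheme.ΓSpecIso (quadExt X h)).hom).hom

theorem evalHom_app {U : X.Opens} (hU : IsAffineOpen U) [Nonempty U] (a : Γ(X, U)) :
    evalHom hg U (p.app U a) =
      algebraMap X.functionField (quadExt X h) (X.germToFunctionField U a) := by
  have h1 := appLE_app_of_comp_eq hg.symm (top_le_preimage hg U) (quadHom_preimage h U).ge a
  refine (congrArg (Scheme.ΓSpecIso (quadExt X h)).hom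
    (h1.trans (quadHom_appLE h hU a))).trans ?_
  exact congr($((Scheme.ΓSpecIso (quadExt X h)).inv_hom_id) _)

theorem evalHom_map {U V : X.Opens} [Nonempty U] [Nonempty V] (hVU : V ≤ U)
    (b : Γ(T, p ⁻¹ᵁ U)) :
    evalHom hg V (T.presheaf.map (homOfLE (p.preimage_mono hVU)).op b) = evalHom hg U b := by
  refine congrArg (Scheme.ΓSpecIso (quadExt X h)).hom ?_
  exact congr($(Scheme.Hom.map_appLE g (top_le_preimage hg V)
    (homOfLE (p.preimage_mono hVU)).op) b)

end Eval

theorem exists_hom_of_ringHom (p : T ⟶ X) [IsAffineHom p] {U : X.Opens} (hU : IsAffineOpen U)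
    [Nonempty U] (θ : Γ(T, p ⁻¹ᵁ U) →+* quadExt X h)
    (hθ : ∀ a, θ (p.app U a) =
      algebraMap X.functionField (quadExt X h) (X.germToFunctionField U a)) :
    ∃ (g : Spec (quadExt X h) ⟶ T) (hg : quadHom X h = g ≫ p), evalHom hg U = θ := by
  have hg : quadHom X h = (Spec.map (CommRingCat.ofHom θ) ≫ (hU.preimage p).fromSpec) ≫ p := by
    rw [Category.assoc, ← IsAffineOpen.SpecMap_appLE_fromSpec p hU (hU.preimage p) le_rfl,
      quadHom_eq h hU, ← Spec.map_comp_assoc, ← Scheme.Hom.app_eq_appLE]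
    congr 2
    refine CommRingCat.hom_ext (RingHom.ext fun a ↦ (hθ a).symm)
  refine ⟨_, hg, RingHom.ext fun b ↦ ?_⟩
  refine (congrArg (Scheme.ΓSpecIso (quadExt X h)).hom congr($(SpecMap_fromSpec_appLE
    (hU.preimage p) (CommRingCat.ofHom θ) (top_le_preimage hg U)) b)).trans ?_
  exact congr($((Scheme.ΓSpecIso (quadExt X h)).inv_hom_id) _)

theorem isIntegralElem_comp_iff {R S S' : Type*} [CommRing R] [CommRing S] [CommRing S']
    (f : R →+* S) {σ : S →+* S'} (hσ : Function.Injective σ) (y : S) :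
    (σ.comp f).IsIntegralElem (σ y) ↔ f.IsIntegralElem y := by
  constructor
  · rintro ⟨P, hP, hP'⟩
    rw [← Polynomial.hom_eval₂] at hP'
    exact ⟨P, hP, hσ (hP'.trans (map_zero σ).symm)⟩
  · rintro ⟨P, hP, hP'⟩
    exact ⟨P, hP, by rw [← Polynomial.hom_eval₂, hP', map_zero]⟩

theorem injective_and_range_appLE {S : Scheme.{0}} {j : S ⟶ X} {g : S ⟶ T} {p : T ⟶ X} (hj : j = g ≫ p)
    {U : X.Opens} {V : S.Opens} (hV : j ⁻¹ᵁ U = V) {R : Type*} [CommRing R] (σ : Γ(S, V) ≃+* R)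
    (e : V ≤ g ⁻¹ᵁ (p ⁻¹ᵁ U)) {ψ : Γ(T, p ⁻¹ᵁ U) →+* R}
    (hψ : ∀ b, ψ b = σ (g.appLE (p ⁻¹ᵁ U) V e b))
    (h : Function.Injective ψ ∧ ∀ y, (ψ.comp (p.app U).hom).IsIntegralElem y ↔ y ∈ Set.range ψ) :
    Function.Injective (g.appLE (p ⁻¹ᵁ U) (j ⁻¹ᵁ U) (by rw [hj]; rfl)) ∧
      ∀ e, (j.app U).hom.IsIntegralElem e ↔
        e ∈ Set.range (g.appLE (p ⁻¹ᵁ U) (j ⁻¹ᵁ U) (by rw [hj]; rfl)) := by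
  subst hV
  have hcomp : ψ.comp (p.app U).hom = (σ : Γ(S, j ⁻¹ᵁ U) →+* R).comp (j.app U).hom := by
    ext c
    refine (hψ _).trans (congrArg σ ?_)
    exact (appLE_app_of_comp_eq hj.symm e le_rfl c).trans (by rw [Scheme.Hom.app_eq_appLE])
  refine ⟨fun a b hab ↦ h.1 (by rw [hψ, hψ, hab]), fun y ↦ ?_⟩
  have h1 := h.2 (σ y)
  rw [hcomp] at h1
  refine (isIntegralElem_comp_iff (j.app U).hom (σ := (σ : Γ(S, j ⁻¹ᵁ U) →+* R))
    σ.injective y).symm.trans (h1.trans ?_)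
  constructor
  · rintro ⟨b, hb⟩
    exact ⟨b, σ.injective ((hψ b).symm.trans hb)⟩
  · rintro ⟨b, rfl⟩
    exact ⟨b, hψ b⟩

/-- The generators of a double cover over two affine opens are proportional at the generic
point. -/
theorem evalHom_eq_of_isQuadratic {h : X.functionField} {p : T ⟶ X} [IsAffineHom p]
    {g : Spec (quadExt X h) ⟶ T} (hg : quadHom X h = g ≫ p)
    {U U₀ : X.Opens} (hU : IsAffineOpen U) (hU₀ : IsAffineOpen U₀) [Nonempty U] [Nonempty U₀]
    {s : Γ(X, U)} {w : Γ(T, p ⁻¹ᵁ U)} (hw : IsQuadratic (p.app U).hom s w)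
    {s₀ : Γ(X, U₀)} {w₀ : Γ(T, p ⁻¹ᵁ U₀)} (hw₀ : IsQuadratic (p.app U₀).hom s₀ w₀)
    (h2 : (2 : X.functionField) ≠ 0) {r₀ : X.functionField} (hr₀ : r₀ ≠ 0)
    (hψ₀ : evalHom hg U₀ w₀ = ⟨0, r₀⟩) : ∃ r, evalHom hg U w = ⟨0, r⟩ := by
  have hη : ∀ (U : X.Opens) [Nonempty U], genericPoint X ∈ U := fun U _ ↦
    ((genericPoint_spec X).mem_open_set_iff U.isOpen).mpr (by simpa using ‹Nonempty U›)
  obtain ⟨f, f₀, hff₀, hηf⟩ := exists_basicOpen_le_affine_inter hU hU₀ (genericPoint X)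
    ⟨hη U, hη U₀⟩
  set V := X.basicOpen f with hV
  have : Nonempty V := ⟨⟨_, hηf⟩⟩
  have hVU : V ≤ U := X.basicOpen_le f
  have hVU₀ : V ≤ U₀ := hff₀.trans_le (X.basicOpen_le f₀)
  have hVa : IsAffineOpen V := hU.basicOpen f
  have hpV : p ⁻¹ᵁ V = T.basicOpen (p.app U f) := Scheme.preimage_basicOpen p f
  have hpV₀ : p ⁻¹ᵁ V = T.basicOpen (p.app U₀ f₀) := by
    rw [hff₀]; exact Scheme.preimage_basicOpen p f₀
  have hne : ∀ {O : X.Opens} [Nonempty O] (y : Γ(X, O)), genericPoint X ∈ X.basicOpen y →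
      X.germToFunctionField O y ≠ 0 := fun y hy ↦
    ((Scheme.mem_basicOpen _ _ _ (X.basicOpen_le _ hy)).mp hy).ne_zero
  have hf := hne f hηf
  have hf₀ := hne f₀ (hff₀ ▸ hηf)
  -- Functions over `V` are a localization at `f₀` of those over `U₀`, so `f₀ ^ n w = a₀ + c₀ w₀`
  -- over `V`.
  obtain ⟨n, b₀, hb₀⟩ := exists_pow_mul_res_eq (hU₀.preimage p) (p.app U₀ f₀) hpV₀
    (p.preimage_mono hVU₀) (T.presheaf.map (homOfLE (p.preimage_mono hVU)).op w)
  obtain ⟨a₀, c₀, rfl⟩ := hw₀.exists_eq b₀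
  have h1 := congrArg (evalHom hg V) hb₀
  rw [evalHom_map hg hVU₀, map_mul, map_pow, evalHom_map hg hVU₀, evalHom_map hg hVU, map_add,
    map_mul, hψ₀] at h1
  have h1' : algebraMap X.functionField (quadExt X h) (X.germToFunctionField U₀ a₀) +
      algebraMap X.functionField (quadExt X h) (X.germToFunctionField U₀ c₀) * ⟨0, r₀⟩ =
      algebraMap X.functionField (quadExt X h) (X.germToFunctionField U₀ f₀) ^ n *
        evalHom hg U w := by
    rw [← evalHom_app hg hU₀, ← evalHom_app hg hU₀, ← evalHom_app hg hU₀]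
    exact h1
  rw [← map_pow] at h1'
  have hsq : evalHom hg U w ^ 2 =
      algebraMap X.functionField (quadExt X h) (X.germToFunctionField U s) := by
    rw [← evalHom_app hg hU, ← map_pow, hw.sq]
  generalize hE : evalHom hg U w = E at h1' hsq ⊢
  -- The value of `w` has its square in `K`, so the product of its two coordinates vanishes.
  have him := congrArg QuadraticAlgebra.im hsq
  have him' : E.re = 0 ∨ E.im = 0 := by
    simp [pow_two] at him
    have : 2 * (E.re * E.im) = 0 := by linear_combination him
    simpa [h2] using this
  obtain h3 | h3 := him'
  · exact ⟨E.im, QuadraticAlgebra.ext h3 rfl⟩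
  -- If the value of `w` lay in `K`, then `c₀ = 0`, and `f₀ ^ n w` would be a function pulled back
  -- from `V`. Clearing denominators by powers of `f` gives a relation between `1` and `w` over `U`
  -- with nonzero coefficient of `w`, against the uniqueness of coordinates.
  exfalso
  have h4 := congrArg QuadraticAlgebra.im h1'
  simp [h3, hr₀, -map_pow] at h4
  have hc₀ : c₀ = 0 := X.germToFunctionField_injective U₀ (h4.trans (map_zero _).symm)
  subst hc₀
  obtain ⟨m, x, hx⟩ := exists_pow_mul_res_eq hU f hV hVU (X.presheaf.map (homOfLE hVU₀).op a₀)
  obtain ⟨m', y, hy⟩ := exists_pow_mul_res_eq hU f hV hVU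
    (X.presheaf.map (homOfLE hVU₀).op f₀ ^ n)
  have hres : ∀ a, T.presheaf.map (homOfLE (p.preimage_mono hVU)).op (p.app U a) =
      p.app V (X.presheaf.map (homOfLE hVU).op a) := fun a ↦
    congr($(p.naturality (homOfLE hVU).op) a).symm
  have hres₀ : ∀ a, T.presheaf.map (homOfLE (p.preimage_mono hVU₀)).op (p.app U₀ a) =
      p.app V (X.presheaf.map (homOfLE hVU₀).op a) := fun a ↦
    congr($(p.naturality (homOfLE hVU₀).op) a).symm
  have hb₁ : p.app V (X.presheaf.map (homOfLE hVU₀).op a₀) =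
      p.app V (X.presheaf.map (homOfLE hVU₀).op f₀) ^ n *
        T.presheaf.map (homOfLE (p.preimage_mono hVU)).op w := by
    rw [← hres₀, ← hres₀, ← hb₀]
    congr 1
    simp
  obtain ⟨k, hk⟩ := exists_pow_mul_eq_zero (hU.preimage p) (p.app U f) hpV
    (p.preimage_mono hVU) (p.app U (f ^ m' * x) - p.app U (f ^ m * y) * w) (by
      simp only [map_sub, map_mul, map_pow, hres, hx, hy]
      linear_combination (p.app V (X.presheaf.map (homOfLE hVU).op f)) ^ (m + m') * hb₁)
  have h5 := (hw.eq_and_eq (a := f ^ k * (f ^ m' * x)) (c := 0) (a' := 0)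
    (c' := f ^ k * (f ^ m * y)) (by
      simp only [map_mul, map_zero, zero_mul, add_zero, zero_add, map_pow] at hk ⊢
      linear_combination hk)).2
  have h6 := congrArg (X.germToFunctionField U) h5
  have h7 : X.germToFunctionField U y =
      X.germToFunctionField U f ^ m' * X.germToFunctionField U₀ f₀ ^ n := by
    rw [← germToFunctionField_map hVU, hy, map_mul, map_pow, map_pow, germToFunctionField_map hVU,
      germToFunctionField_map hVU₀]
  rw [map_zero, map_mul, map_mul, map_pow, map_pow, h7] at h6
  exact mul_ne_zero (pow_ne_zero _ hf) (mul_ne_zero (pow_ne_zero _ hf)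
    (mul_ne_zero (pow_ne_zero _ hf) (pow_ne_zero _ hf₀))) h6.symm

end DoubleCover

/-! ### Uniqueness of double covers of a normal integral scheme -/

namespace DoubleCover

open TopologicalSpace

variable {X T : Scheme.{0}} [IsIntegral X] {D : Closeds X}

/-- `s` is an equation of `D` on the affine open `U`, and `T = U[√s]` over `U`. -/
structure IsChart (p : T ⟶ X) (D : Closeds X) (U : X.affineOpens) (s : Γ(X, U.1))
    (w : Γ(T, p ⁻¹ᵁ U.1)) : Prop where
  ne_zero : s ≠ 0
  ideal_eq : (Scheme.IdealSheafData.vanishingIdeal D).ideal U = Ideal.span {s}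
  isQuadratic : IsQuadratic (p.app U.1).hom s w

theorem IsDoubleCover.exists_isChart {p : T ⟶ X} (hp : IsDoubleCover p D) (x : X) :
    ∃ (U : X.affineOpens) (s : Γ(X, U.1)) (w : Γ(T, p ⁻¹ᵁ U.1)), x ∈ U.1 ∧ IsChart p D U s w := by
  obtain ⟨U, hx, s, w, h1, h2, h3, h4⟩ := hp.local_equation x
  have : Nonempty U.1 := ⟨⟨x, hx⟩⟩
  exact ⟨U, s, w, hx, nonZeroDivisors.ne_zero h1, h2, h3, h4⟩

namespace IsChart

variable {p : T ⟶ X} [IsAffineHom p] {U U₀ : X.affineOpens} {s : Γ(X, U.1)} {w : Γ(T, p ⁻¹ᵁ U.1)}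
  {s₀ : Γ(X, U₀.1)} {w₀ : Γ(T, p ⁻¹ᵁ U₀.1)} [Nonempty U.1] [Nonempty U₀.1]

theorem isRadical (h : IsChart p D U s w) : (Ideal.span {s}).IsRadical := by
  rw [← h.ideal_eq]
  exact PrimeSpectrum.isRadical_vanishingIdeal _

theorem germ_ne_zero (h : IsChart p D U s w) : X.germToFunctionField U.1 s ≠ 0 :=
  (map_ne_zero_iff (X.germToFunctionField U.1).hom
    (X.germToFunctionField_injective U.1)).mpr h.ne_zero

/-- Since `(r₀ √h) ^ 2 = s₀`, sending `w₀` to `r₀ √h` defines a ring homomorphism, that is, a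
`K(√h)`-point of `T` over the generic point of `X`. -/
theorem exists_point (h₀ : IsChart p D U₀ s₀ w₀) {h r₀ : X.functionField}
    (hr : X.germToFunctionField U₀.1 s₀ = h * r₀ ^ 2) :
    ∃ (g : Spec (quadExt X h) ⟶ T) (hg : quadHom X h = g ≫ p), evalHom hg U₀.1 w₀ = ⟨0, r₀⟩ := by
  obtain ⟨θ, hθ, hθw⟩ := h₀.isQuadratic.exists_ringHom
    ((algebraMap X.functionField (quadExt X h)).comp (X.germToFunctionField U₀.1).hom)
    (⟨0, r₀⟩ : QuadraticAlgebra X.functionField h 0) (by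
      rw [RingHom.comp_apply]
      refine Eq.trans ?_ (congrArg (algebraMap X.functionField (quadExt X h)) hr.symm)
      ext <;> simp [pow_two, -map_pow, -map_mul]
      ring)
  obtain ⟨g, hg, hgθ⟩ := exists_hom_of_ringHom h p U₀.2 θ hθ
  exact ⟨g, hg, by rw [hgθ, hθw]⟩

/-- At a point with values in `K(√s₀)` the generator `w` takes a value `r √s₀`; comparing squares
gives the claim. -/
theorem exists_germ_eq (h : IsChart p D U s w) (h₀ : IsChart p D U₀ s₀ w₀)
    (h2 : (2 : X.functionField) ≠ 0) :
    ∃ r ≠ 0, X.germToFunctionField U.1 s = X.germToFunctionField U₀.1 s₀ * r ^ 2 := by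
  obtain ⟨g, hg, hgw⟩ := h₀.exists_point (h := X.germToFunctionField U₀.1 s₀) (r₀ := 1) (by simp)
  obtain ⟨r, hr⟩ := evalHom_eq_of_isQuadratic hg U.2 U₀.2 h.isQuadratic h₀.isQuadratic h2
    one_ne_zero hgw
  have h1 : evalHom hg U.1 w ^ 2 =
      algebraMap X.functionField (quadExt X _) (X.germToFunctionField U.1 s) := by
    rw [← evalHom_app hg U.2, ← map_pow, h.isQuadratic.sq]
  rw [hr] at h1
  have h3 := congrArg QuadraticAlgebra.re h1
  simp [pow_two] at h3
  refine ⟨r, ?_, by rw [← h3]; ring⟩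
  rintro rfl
  exact h.germ_ne_zero (by rw [← h3]; ring)

end IsChart

/-- On every chart the generator maps to a multiple `r √h`, so the functions on `T` there form the
integral closure of those on `X` in `K(√h)`. The result depends only on `h`, not on the cover. -/
theorem IsDoubleCover.exists_iso_normalization
    (hX : ∀ (U : X.Opens) [Nonempty U], IsAffineOpen U → IsIntegrallyClosed Γ(X, U))
    (h2 : ∀ U : X.Opens, IsUnit (2 : Γ(X, U))) {p : T ⟶ X} (hp : IsDoubleCover p D)
    {U₀ : X.affineOpens} [Nonempty U₀.1] {s₀ : Γ(X, U₀.1)} {w₀ : Γ(T, p ⁻¹ᵁ U₀.1)}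
    (h₀ : IsChart p D U₀ s₀ w₀) {h r₀ : X.functionField}
    (hr : X.germToFunctionField U₀.1 s₀ = h * r₀ ^ 2) [QuasiCompact (quadHom X h)]
    [QuasiSeparated (quadHom X h)] :
    ∃ e : (quadHom X h).normalization ≅ T, e.hom ≫ p = (quadHom X h).fromNormalization := by
  have := hp.isAffineHom
  have hr₀ : r₀ ≠ 0 := by
    rintro rfl
    exact h₀.germ_ne_zero (by rw [hr]; ring)
  have h2' : (2 : X.functionField) ≠ 0 := by
    have := ((h2 U₀.1).map (X.germToFunctionField U₀.1).hom).ne_zero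
    rwa [map_ofNat] at this
  obtain ⟨g, hg, hgw⟩ := h₀.exists_point hr
  refine DoubleCover.exists_iso_normalization (quadHom X h) g p hg fun x ↦ ?_
  obtain ⟨U, s, w, hx, hU⟩ := hp.exists_isChart x
  have : Nonempty U.1 := ⟨⟨x, hx⟩⟩
  refine ⟨U.1, hx, U.2, ?_⟩
  obtain ⟨r, hrw⟩ := evalHom_eq_of_isQuadratic hg U.2 U₀.2 hU.isQuadratic h₀.isQuadratic h2'
    hr₀ hgw
  have := functionField_isFractionRing_of_isAffineOpen X U.1 U.2
  have := hX U.1 U.2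
  exact injective_and_range_appLE hg (quadHom_preimage h U.1)
    (Scheme.ΓSpecIso (quadExt X h)).commRingCatIsoToRingEquiv (top_le_preimage hg U.1)
    (ψ := evalHom hg U.1) (fun b ↦ rfl)
    (hU.isQuadratic.injective_and_range (K := X.functionField) (h2 U.1) hU.ne_zero hU.isRadical
      (evalHom hg U.1) (fun a ↦ evalHom_app hg U.2 a) hrw)

/-- Double covers of a normal integral scheme with a given branch divisor are isomorphic, when
every rational function which is locally the product of a unit and a square is a square. -/
theorem IsDoubleCover.exists_iso [X.IsSeparated]
    (hX : ∀ (U : X.Opens) [Nonempty U], IsAffineOpen U → IsIntegrallyClosed Γ(X, U))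
    (h2 : ∀ U : X.Opens, IsUnit (2 : Γ(X, U)))
    (hK : ∀ κ : X.functionField, κ ≠ 0 → (∀ x : X, ∃ (v : X.presheaf.stalk x)
      (r : X.functionField), IsUnit v ∧ r ≠ 0 ∧
        κ = algebraMap (X.presheaf.stalk x) X.functionField v * r ^ 2) → ∃ r, κ = r ^ 2)
    {Y Q : Scheme.{0}} {π : Y ⟶ X} {p : Q ⟶ X} (hπ : IsDoubleCover π D) (hp : IsDoubleCover p D) :
    ∃ e : Y ≅ Q, e.hom ≫ p = π := by
  have := hπ.isAffineHom
  have := hp.isAffineHom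
  obtain ⟨U₀, s₀, w₀, hη, h₀⟩ := hπ.exists_isChart (genericPoint X)
  obtain ⟨U₁, s₁, w₁, hη', h₁⟩ := hp.exists_isChart (genericPoint X)
  have : Nonempty U₀.1 := ⟨⟨_, hη⟩⟩
  have : Nonempty U₁.1 := ⟨⟨_, hη'⟩⟩
  have h2' : (2 : X.functionField) ≠ 0 := by
    have := ((h2 U₀.1).map (X.germToFunctionField U₀.1).hom).ne_zero
    rwa [map_ofNat] at this
  set h := X.germToFunctionField U₀.1 s₀ with hh
  set h' := X.germToFunctionField U₁.1 s₁ with hh'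
  have h0 : h ≠ 0 := h₀.germ_ne_zero
  have h0' : h' ≠ 0 := h₁.germ_ne_zero
  obtain ⟨r, hr⟩ := hK (h' / h) (div_ne_zero h0' h0) (by
    intro x
    obtain ⟨U, s, w, hx, hU⟩ := hπ.exists_isChart x
    obtain ⟨U', s', w', hx', hU'⟩ := hp.exists_isChart x
    have : Nonempty U.1 := ⟨⟨_, hx⟩⟩
    have : Nonempty U'.1 := ⟨⟨_, hx'⟩⟩
    obtain ⟨r, hr, hrs⟩ := hU.exists_germ_eq h₀ h2'
    obtain ⟨r', hr', hrs'⟩ := hU'.exists_germ_eq h₁ h2'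
    obtain ⟨f, f', hff', hxf⟩ := exists_basicOpen_le_affine_inter U.2 U'.2 x ⟨hx, hx'⟩
    let V : X.affineOpens := ⟨X.basicOpen f, U.2.basicOpen f⟩
    have : Nonempty V.1 := ⟨⟨x, hxf⟩⟩
    have hVU : V ≤ U := X.basicOpen_le f
    have hVU' : V ≤ U' := hff'.trans_le (X.basicOpen_le f')
    have e1 := (Scheme.IdealSheafData.vanishingIdeal D).map_ideal hVU
    have e2 := (Scheme.IdealSheafData.vanishingIdeal D).map_ideal hVU'
    rw [hU.ideal_eq, Ideal.map_span, Set.image_singleton] at e1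
    rw [hU'.ideal_eq, Ideal.map_span, Set.image_singleton] at e2
    -- Near `x` both equations generate the ideal of `D`, so `s' = u s` with `u` a unit. With `s = h
    -- r ^ 2` and `s' = h' r' ^ 2` this gives `h' / h = u (r / r') ^ 2`.
    obtain ⟨u, hu⟩ := Ideal.span_singleton_eq_span_singleton.mp (e1.trans e2.symm)
    refine ⟨X.presheaf.germ V.1 x hxf u, r / r', u.isUnit.map _, div_ne_zero hr hr', ?_⟩
    rw [X.algebraMap_germ_eq_germToFunctionField]
    have hu' := congrArg (X.germToFunctionField V.1) hu
    rw [map_mul] at hu'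
    have hu'' : X.germToFunctionField U.1 s * X.germToFunctionField V.1 u =
        X.germToFunctionField U'.1 s' := by
      rw [← germToFunctionField_map hVU, ← germToFunctionField_map hVU']
      exact hu'
    rw [hrs, hrs', ← hh, ← hh'] at hu''
    field_simp
    linear_combination -hu'')
  have : IsAffineHom (quadHom X h) :=
    MorphismProperty.of_postcomp (W := @IsAffineHom) (W' := @IsSeparated) _
      (Limits.terminal.from X) inferInstance inferInstance
  -- As `h' = h r ^ 2`, both covers are the normalization of `X` in the same `Spec K(√h)`.
  obtain ⟨e, he⟩ := hπ.exists_iso_normalization hX h2 h₀ (h := h) (r₀ := 1) (by simp [hh])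
  obtain ⟨e', he'⟩ := hp.exists_iso_normalization hX h2 h₁ (h := h) (r₀ := r) (by
    rw [← hr, ← hh']
    field_simp)
  exact ⟨e.symm ≪≫ e', by simp [he', ← he]⟩

end DoubleCover

/-! ### Integrality and normality of `Proj` -/

namespace ProjTools

variable {A : Type} [CommRing A] [Algebra ℂ A] {𝒜 : ℕ → Submodule ℂ A} [GradedAlgebra 𝒜]

theorem isReduced_proj [IsDomain A] : IsReduced (Proj 𝒜) := by
  have (x : Proj 𝒜) : _root_.IsReduced ((Proj 𝒜).presheaf.stalk x) := by
    have := x.isPrime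
    have := IsLocalization.isDomain_localization (M := x.asHomogeneousIdeal.toIdeal.primeCompl)
      (Ideal.primeCompl_le_nonZeroDivisors _)
    have h := (HomogeneousLocalization.val_injective (𝒜 := 𝒜)
      x.asHomogeneousIdeal.toIdeal.primeCompl).isDomain (algebraMap (HomogeneousLocalization 𝒜 _) (Localization
        x.asHomogeneousIdeal.toIdeal.primeCompl))
    have : IsDomain ((Proj 𝒜).presheaf.stalk x) :=
      (Proj.stalkIso' 𝒜 x).injective.isDomain (Proj.stalkIso' 𝒜 x).toRingHom
    infer_instance
  exact isReduced_of_isReduced_stalk _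

/-- The nonzero `t` of positive degree makes the zero ideal a point of `Proj`, and this point is
generic. -/
theorem isIntegral_proj [IsDomain A] {i : ℕ} (hi : 0 < i) {t : A} (ht : t ∈ 𝒜 i) (h0 : t ≠ 0) :
    IsIntegral (Proj 𝒜) := by
  have := isReduced_proj (𝒜 := 𝒜)
  let η : Proj 𝒜 := ⟨⊥, Ideal.isPrime_bot, fun h ↦
    h0 (h (HomogeneousIdeal.mem_irrelevant_of_mem 𝒜 hi ht))⟩
  have hη : IsGenericPoint η Set.univ := by
    refine Set.eq_univ_of_forall fun x ↦ ?_
    refine (ProjectiveSpectrum.le_iff_mem_closure 𝒜 η x).mp ?_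
    exact (ProjectiveSpectrum.as_ideal_le_as_ideal 𝒜 η x).mp bot_le
  have : IrreducibleSpace (Proj 𝒜) := (irreducibleSpace_def _).mpr hη.isIrreducible
  exact isIntegral_of_irreducibleSpace_of_isReduced _

theorem isUnit_two_proj (U : (Proj 𝒜).Opens) : IsUnit (2 : Γ(Proj 𝒜, U)) := by
  have h : IsUnit (2 : ℂ) := isUnit_iff_ne_zero.mpr two_ne_zero
  have h' := ((((h.map (algebraMap ℂ (𝒜 0))).map (Scheme.ΓSpecIso (.of (𝒜 0))).inv.hom).map
    (Proj.toSpecZero 𝒜).appTop.hom).map ((Proj 𝒜).presheaf.map (homOfLE le_top).op).hom :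
      IsUnit (M := Γ(Proj 𝒜, U)) _)
  simpa only [map_ofNat] using h'

/-- A fraction integral over the degree-zero part lies in the full localization `A_t`, which is
normal. Taking a homogeneous component of the numerator there shows that it already has degree zero.
-/
theorem isIntegrallyClosed_away [IsDomain A] [IsIntegrallyClosed A] {i : ℕ} {t : A}
    (ht : t ∈ 𝒜 i) (h0 : t ≠ 0) : IsIntegrallyClosed (Away 𝒜 t) := by
  have := isDomain_away (𝒜 := 𝒜) h0
  have hM := powers_le_nonZeroDivisors_of_noZeroDivisors h0
  have := IsLocalization.isDomain_localization hM
  have : IsIntegrallyClosed (Localization (Submonoid.powers t)) :=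
    isIntegrallyClosed_of_isLocalization _ (Submonoid.powers t) hM
  have hinj := HomogeneousLocalization.val_injective (𝒜 := 𝒜) (Submonoid.powers t)
  set L := Localization (Submonoid.powers t)
  let j : FractionRing (Away 𝒜 t) →+* FractionRing L :=
    IsFractionRing.map (A := Away 𝒜 t) (B := L) (j := algebraMap (Away 𝒜 t) L) hinj
  have hj (a : Away 𝒜 t) : j (algebraMap _ _ a) = algebraMap L _ a.val :=
    IsLocalization.map_eq _ a
  refine (isIntegrallyClosed_iff (FractionRing (Away 𝒜 t))).mpr fun {x} hx ↦ ?_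
  obtain ⟨a, b, hb, rfl⟩ := IsFractionRing.div_surjective (A := Away 𝒜 t) x
  have hb0 := nonZeroDivisors.ne_zero hb
  have h_integral : IsIntegral L (j (algebraMap _ _ a / algebraMap _ _ b)) := by
    obtain ⟨p, hp, he⟩ := hx
    refine ⟨p.map (algebraMap (Away 𝒜 t) L), hp.map _, ?_⟩
    have hcomp : (algebraMap L (FractionRing L)).comp (algebraMap (Away 𝒜 t) L) =
      j.comp (algebraMap _ _) := RingHom.ext fun a ↦ (hj a).symm
    rw [Polynomial.eval₂_map, hcomp, ← Polynomial.hom_eval₂, he, map_zero]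
  obtain ⟨c, hc⟩ := IsIntegrallyClosed.isIntegral_iff.mp h_integral
  have hbv : b.val ≠ 0 := fun h ↦ hb0 (hinj (by rw [h, HomogeneousLocalization.val_zero]))
  rw [map_div₀, hj, hj, eq_div_iff (by
    rwa [Ne, IsFractionRing.to_map_eq_zero_iff]), ← map_mul] at hc
  replace hc := IsFractionRing.injective L (FractionRing L) hc
  obtain ⟨n, a, ha, rfl⟩ := Away.mk_surjective 𝒜 ht a
  obtain ⟨m, b, hb', rfl⟩ := Away.mk_surjective 𝒜 ht b
  obtain ⟨⟨c, ⟨_, k, rfl⟩⟩, rfl⟩ := Localization.mkHom_surjective c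
  rw [Localization.mkHom_apply, Away.val_mk, Away.val_mk, Localization.mk_mul,
    Localization.mk_eq_mk_iff, Localization.r_iff_exists] at hc
  obtain ⟨⟨_, l, rfl⟩, hc⟩ := hc
  have hc' := mul_left_cancel₀ (pow_ne_zero l h0) hc
  simp only [Submonoid.coe_mul] at hc'
  obtain ⟨c', hcm, hcc⟩ := exists_mul_eq_of_mem (𝒜 := 𝒜) (m := (m + n) • i) (n := k • i)
    (P := b * t ^ n) (c := c) (by
      rw [add_smul]; exact SetLike.mul_mem_graded hb' (SetLike.pow_mem_graded n ht)) (by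
      have h := SetLike.mul_mem_graded ha (SetLike.pow_mem_graded (m + k) ht)
      convert h using 1
      · simp only [smul_eq_mul]; ring_nf
      · rw [pow_add]; linear_combination hc')
  refine ⟨Away.mk 𝒜 ht k c' hcm, ?_⟩
  rw [eq_div_iff (by rwa [Ne, IsFractionRing.to_map_eq_zero_iff]), ← map_mul]
  congr 1
  rw [awayMk_mul, awayMk_eq_iff ht h0]
  linear_combination hcc + hc'

theorem exists_pos_mem_basicOpen (x : Proj 𝒜) :
    ∃ (i : ℕ) (_ : 0 < i) (t : A) (_ : t ∈ 𝒜 i), x ∈ Proj.basicOpen 𝒜 t :=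
  exists_mem_basicOpen (𝒜 := 𝒜) (RingHom.id A) (by
    rw [Ideal.map_id]; exact Ideal.le_radical) x

theorem ne_zero_of_mem_basicOpen {x : Proj 𝒜} {t : A} (h : x ∈ Proj.basicOpen 𝒜 t) : t ≠ 0 := by
  rintro rfl
  exact h (zero_mem x.asHomogeneousIdeal)

theorem isIntegrallyClosed_stalk [IsDomain A] [IsIntegrallyClosed A] (x : Proj 𝒜) :
    IsIntegrallyClosed ((Proj 𝒜).presheaf.stalk x) := by
  obtain ⟨i, hi, t, ht, hx⟩ := exists_pos_mem_basicOpen x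
  have h0 := ne_zero_of_mem_basicOpen hx
  have := isIntegral_proj hi ht h0
  have h1 := isIntegrallyClosed_away ht h0
  have hU : IsAffineOpen (Proj.basicOpen 𝒜 t) := Proj.isAffineOpen_basicOpen 𝒜 t ht hi
  have hne : Nonempty (Proj.basicOpen 𝒜 t) := ⟨⟨x, hx⟩⟩
  have h2 : IsIntegrallyClosed Γ(Proj 𝒜, Proj.basicOpen 𝒜 t) :=
    .of_equiv (RingEquiv.ofBijective (Proj.awayToSection 𝒜 t).hom (awayToSection_bijective hi ht))
  let x' : Proj.basicOpen 𝒜 t := ⟨x, hx⟩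
  let := TopCat.Presheaf.algebra_section_stalk (Proj 𝒜).presheaf x'
  have h3 : IsLocalization.AtPrime ((Proj 𝒜).presheaf.stalk x) (hU.primeIdealOf x').asIdeal :=
    hU.isLocalization_stalk x'
  exact isIntegrallyClosed_of_isLocalization _ (hU.primeIdealOf x').asIdeal.primeCompl
    (Ideal.primeCompl_le_nonZeroDivisors (hU.primeIdealOf x').asIdeal)

end ProjTools

namespace DoubleCover

theorem isIntegrallyClosed_of_isAffineOpen {X : Scheme.{0}} [IsIntegral X]
    (h : ∀ x : X, IsIntegrallyClosed (X.presheaf.stalk x)) (U : X.Opens) [Nonempty U]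
    (hU : IsAffineOpen U) : IsIntegrallyClosed Γ(X, U) := by
  refine .of_localization_maximal fun P _ hP ↦ ?_
  have hy : hU.fromSpec ⟨P, hP.isPrime⟩ ∈ U := (hU.isoSpec.inv _).2
  let := TopCat.Presheaf.algebra_section_stalk X.presheaf
    (⟨hU.fromSpec ⟨P, hP.isPrime⟩, hy⟩ : U)
  have : IsLocalization.AtPrime (X.presheaf.stalk (hU.fromSpec ⟨P, hP.isPrime⟩)) P :=
    hU.isLocalization_stalk' ⟨P, hP.isPrime⟩ hy
  have := h (hU.fromSpec ⟨P, hP.isPrime⟩)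
  exact .of_equiv (IsLocalization.algEquiv P.primeCompl
    (X.presheaf.stalk (hU.fromSpec ⟨P, hP.isPrime⟩)) (Localization.AtPrime P)).toRingEquiv

end DoubleCover

/-! ### Rational functions on `Proj` of a factorial ring that are locally units times squares -/

namespace ProjTools

theorem exists_eq_sq_mul_squarefree {A : Type*} [CommRing A] [IsDomain A]
    [UniqueFactorizationMonoid A] (x : A) (hx : x ≠ 0) : ∃ k m, x = k ^ 2 * m ∧ Squarefree m := by
  induction x using (IsWellFounded.wf (r := DvdNotUnit (α := A))).induction with
  | _ x ih =>
    by_cases hsq : Squarefree x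
    · exact ⟨1, x, by simp, hsq⟩
    · simp only [Squarefree, not_forall] at hsq
      obtain ⟨y, ⟨c, hc⟩, hy⟩ := hsq
      have hc0 : c ≠ 0 := by rintro rfl; exact hx (by simpa using hc)
      obtain ⟨k, m, rfl, hm⟩ := ih c ⟨hc0, y * y, fun h ↦ hy (isUnit_of_mul_isUnit_left h),
        by rw [hc, mul_comm]⟩ hc0
      exact ⟨y * k, m, by rw [hc]; ring, hm⟩

/-- The multiplicity of `q` is odd on the left and even, or infinite if `y = 0`, on the right. -/
theorem mul_sq_ne_mul_sq {A : Type*} [CommRing A] [IsDomain A] [UniqueFactorizationMonoid A]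
    {q c u x y : A} (hq : Prime q) (hc : ¬ q ∣ c) (hu : ¬ q ∣ u) (hx : x ≠ 0) :
    q * c * x ^ 2 ≠ u * y ^ 2 := by
  intro h
  have hy : y ≠ 0 := by
    rintro rfl
    have hc0 : c ≠ 0 := by rintro rfl; exact hc (dvd_zero q)
    simp [hq.ne_zero, hc0, hx] at h
  have h' := congrArg (emultiplicity q) h
  rw [emultiplicity_mul hq, emultiplicity_mul hq, emultiplicity_mul hq, emultiplicity_pow hq,
    emultiplicity_pow hq, emultiplicity_eq_zero.mpr hc, emultiplicity_eq_zero.mpr hu,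
    (FiniteMultiplicity.of_not_isUnit hq.not_isUnit hq.ne_zero).emultiplicity_self,
    (FiniteMultiplicity.of_not_isUnit hq.not_isUnit hx).emultiplicity_eq_multiplicity,
    (FiniteMultiplicity.of_not_isUnit hq.not_isUnit hy).emultiplicity_eq_multiplicity] at h'
  norm_cast at h'
  omega

variable {A : Type} [CommRing A] [Algebra ℂ A] {𝒜 : ℕ → Submodule ℂ A} [GradedAlgebra 𝒜]

instance isPrime_asHomogeneousIdeal (x : Proj 𝒜) : x.asHomogeneousIdeal.toIdeal.IsPrime :=
  x.isPrime

theorem isUnit_algebraMap_of_notMem [IsDomain A] (x : Proj 𝒜)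
    (y : x.asHomogeneousIdeal.toIdeal.primeCompl) :
    IsUnit (algebraMap A (FractionRing A) y) := by
  rw [isUnit_iff_ne_zero, Ne, IsFractionRing.to_map_eq_zero_iff]
  intro h
  exact y.2 (h ▸ zero_mem x.asHomogeneousIdeal)

/-- The embedding of the function field of `Proj A` into the fraction field of `A`. -/
def toFractionRing [IsDomain A] [IsIntegral (Proj 𝒜)] :
    (Proj 𝒜).functionField →+* FractionRing A :=
  (IsLocalization.lift (S := Localization
    (genericPoint (Proj 𝒜)).asHomogeneousIdeal.toIdeal.primeCompl)
    (isUnit_algebraMap_of_notMem (genericPoint (Proj 𝒜)))).comp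
    ((algebraMap (HomogeneousLocalization 𝒜
      (genericPoint (Proj 𝒜)).asHomogeneousIdeal.toIdeal.primeCompl) _).comp
      (Proj.stalkIso' 𝒜 (genericPoint (Proj 𝒜))).toRingHom)

variable [IsDomain A] [IsIntegral (Proj 𝒜)]

theorem toFractionRing_germ {i : ℕ} {t : A} (ht : t ∈ 𝒜 i) [Nonempty (Proj.basicOpen 𝒜 t)]
    (n : ℕ) (a : A) (ha : a ∈ 𝒜 (n • i)) :
    toFractionRing ((Proj 𝒜).germToFunctionField (Proj.basicOpen 𝒜 t)
      (Proj.awayToSection 𝒜 t (Away.mk 𝒜 ht n a ha))) =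
      algebraMap A (FractionRing A) a / algebraMap A (FractionRing A) t ^ n := by
  have hx : genericPoint (Proj 𝒜) ∈ Proj.basicOpen 𝒜 t :=
    ((genericPoint_spec (Proj 𝒜)).mem_open_set_iff (Proj.basicOpen 𝒜 t).isOpen).mpr
      (by simpa using Set.nonempty_coe_sort.mp ‹Nonempty (Proj.basicOpen 𝒜 t)›)
  have h1 := congr($(ProjectiveSpectrum.Proj.awayToSection_germ 𝒜 t _ hx) (Away.mk 𝒜 ht n a ha))
  have h2 : (Proj 𝒜).germToFunctionField (Proj.basicOpen 𝒜 t)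
      (Proj.awayToSection 𝒜 t (Away.mk 𝒜 ht n a ha)) =
      (Proj.stalkIso' 𝒜 (genericPoint (Proj 𝒜))).symm
        (HomogeneousLocalization.mapId 𝒜 (Submonoid.powers_le.mpr hx) (Away.mk 𝒜 ht n a ha)) := h1
  have h3 : toFractionRing ((Proj 𝒜).germToFunctionField (Proj.basicOpen 𝒜 t)
      (Proj.awayToSection 𝒜 t (Away.mk 𝒜 ht n a ha))) =
      IsLocalization.lift (S := Localization
        (genericPoint (Proj 𝒜)).asHomogeneousIdeal.toIdeal.primeCompl)
        (isUnit_algebraMap_of_notMem (genericPoint (Proj 𝒜)))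
        (Localization.mk a ⟨t ^ n, Submonoid.powers_le.mpr hx ⟨n, rfl⟩⟩) := by
    have h4 := congrArg toFractionRing h2
    refine h4.trans ?_
    refine congrArg (IsLocalization.lift (S := Localization
        (genericPoint (Proj 𝒜)).asHomogeneousIdeal.toIdeal.primeCompl)
        (isUnit_algebraMap_of_notMem (genericPoint (Proj 𝒜)))) ?_
    exact congrArg HomogeneousLocalization.val (RingEquiv.apply_symm_apply _ _)
  rw [h3, Localization.mk_eq_mk', IsLocalization.lift_mk'_spec]
  have ht0 : algebraMap A (FractionRing A) t ≠ 0 := by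
    rw [Ne, IsFractionRing.to_map_eq_zero_iff]
    exact ne_zero_of_mem_basicOpen hx
  simp only [map_pow]
  field_simp

theorem exists_awayMk_eq {i : ℕ} (hi : 0 < i) {t : A} (ht : t ∈ 𝒜 i)
    (s : Γ(Proj 𝒜, Proj.basicOpen 𝒜 t)) :
    ∃ n a, ∃ ha : a ∈ 𝒜 (n • i), s = Proj.awayToSection 𝒜 t (Away.mk 𝒜 ht n a ha) := by
  obtain ⟨z, rfl⟩ := (awayToSection_bijective hi ht).2 s
  obtain ⟨n, a, ha, rfl⟩ := Away.mk_surjective 𝒜 ht z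
  exact ⟨n, a, ha, rfl⟩

theorem exists_toFractionRing_eq {i : ℕ} (hi : 0 < i) {t : A} (ht : t ∈ 𝒜 i)
    [Nonempty (Proj.basicOpen 𝒜 t)] (κ : (Proj 𝒜).functionField) :
    ∃ (k : ℕ) (a b : A), a ∈ 𝒜 (k • i) ∧ b ∈ 𝒜 (k • i) ∧ b ≠ 0 ∧
      toFractionRing κ = algebraMap A (FractionRing A) a / algebraMap A (FractionRing A) b := by
  obtain ⟨x, hx⟩ := ‹Nonempty (Proj.basicOpen 𝒜 t)›
  have h0 := ne_zero_of_mem_basicOpen hx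
  have hne : Nonempty (Proj.basicOpen 𝒜 t) := ⟨⟨x, hx⟩⟩
  have := functionField_isFractionRing_of_isAffineOpen (Proj 𝒜) (Proj.basicOpen 𝒜 t)
    (Proj.isAffineOpen_basicOpen 𝒜 t ht hi)
  obtain ⟨α, β, hβ, rfl⟩ := IsFractionRing.div_surjective (A := Γ(Proj 𝒜, Proj.basicOpen 𝒜 t)) κ
  have hβ0 : toFractionRing ((Proj 𝒜).germToFunctionField (Proj.basicOpen 𝒜 t) β) ≠ 0 := by
    rw [Ne, map_eq_zero]
    exact (IsFractionRing.to_map_eq_zero_iff (K := (Proj 𝒜).functionField)).not.mpr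
      (nonZeroDivisors.ne_zero hβ)
  have hκ : toFractionRing (algebraMap Γ(Proj 𝒜, Proj.basicOpen 𝒜 t) (Proj 𝒜).functionField α /
      algebraMap _ _ β) = toFractionRing ((Proj 𝒜).germToFunctionField (Proj.basicOpen 𝒜 t) α) /
      toFractionRing ((Proj 𝒜).germToFunctionField (Proj.basicOpen 𝒜 t) β) := map_div₀ _ _ _
  rw [hκ]
  obtain ⟨n, a, ha, rfl⟩ := exists_awayMk_eq hi ht α
  obtain ⟨m, b, hb, rfl⟩ := exists_awayMk_eq hi ht β
  rw [toFractionRing_germ] at hβ0 ⊢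
  rw [toFractionRing_germ]
  have hb0 : b ≠ 0 := by rintro rfl; simp at hβ0
  refine ⟨n + m, a * t ^ m, b * t ^ n, ?_, ?_, mul_ne_zero hb0 (pow_ne_zero _ h0), ?_⟩
  · rw [add_smul]; exact SetLike.mul_mem_graded ha (SetLike.pow_mem_graded m ht)
  · rw [add_comm, add_smul]; exact SetLike.mul_mem_graded hb (SetLike.pow_mem_graded n ht)
  · rw [map_mul, map_mul, map_pow, map_pow]
    have h0' : algebraMap A (FractionRing A) t ≠ 0 := by
      rwa [Ne, IsFractionRing.to_map_eq_zero_iff]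
    have hb0' : algebraMap A (FractionRing A) b ≠ 0 := by
      rwa [Ne, IsFractionRing.to_map_eq_zero_iff]
    field_simp

theorem exists_eq_toFractionRing {i : ℕ} {t : A} (ht : t ∈ 𝒜 i)
    [Nonempty (Proj.basicOpen 𝒜 t)] {k : ℕ} {a b : A} (ha : a ∈ 𝒜 (k • i)) (hb : b ∈ 𝒜 (k • i)) :
    ∃ κ : (Proj 𝒜).functionField, toFractionRing κ =
      algebraMap A (FractionRing A) a / algebraMap A (FractionRing A) b := by
  obtain ⟨x, hx⟩ := ‹Nonempty (Proj.basicOpen 𝒜 t)›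
  have h0 := ne_zero_of_mem_basicOpen hx
  have hne : Nonempty (Proj.basicOpen 𝒜 t) := ⟨⟨x, hx⟩⟩
  refine ⟨(Proj 𝒜).germToFunctionField (Proj.basicOpen 𝒜 t)
    (Proj.awayToSection 𝒜 t (Away.mk 𝒜 ht k a ha)) /
    (Proj 𝒜).germToFunctionField (Proj.basicOpen 𝒜 t)
    (Proj.awayToSection 𝒜 t (Away.mk 𝒜 ht k b hb)), ?_⟩
  have h0' : algebraMap A (FractionRing A) t ≠ 0 := by
    rwa [Ne, IsFractionRing.to_map_eq_zero_iff]
  rw [map_div₀, toFractionRing_germ, toFractionRing_germ]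
  field_simp

theorem exists_toFractionRing_stalk_eq (x : Proj 𝒜) (v : (Proj 𝒜).presheaf.stalk x)
    (hv : IsUnit v) : ∃ u u', u ∉ x.asHomogeneousIdeal ∧ u' ∉ x.asHomogeneousIdeal ∧
      toFractionRing (algebraMap ((Proj 𝒜).presheaf.stalk x) (Proj 𝒜).functionField v) =
        algebraMap A (FractionRing A) u / algebraMap A (FractionRing A) u' := by
  obtain ⟨i, hi, t, ht, hx⟩ := exists_pos_mem_basicOpen x
  have hU : IsAffineOpen (Proj.basicOpen 𝒜 t) := Proj.isAffineOpen_basicOpen 𝒜 t ht hi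
  have hne : Nonempty (Proj.basicOpen 𝒜 t) := ⟨⟨x, hx⟩⟩
  let x' : Proj.basicOpen 𝒜 t := ⟨x, hx⟩
  let := TopCat.Presheaf.algebra_section_stalk (Proj 𝒜).presheaf x'
  have h3 : IsLocalization.AtPrime ((Proj 𝒜).presheaf.stalk x) (hU.primeIdealOf x').asIdeal :=
    hU.isLocalization_stalk x'
  obtain ⟨⟨α, β⟩, hαβ⟩ := IsLocalization.surj (hU.primeIdealOf x').asIdeal.primeCompl v
  have hβ : IsUnit ((Proj 𝒜).presheaf.germ (Proj.basicOpen 𝒜 t) x hx β.1) :=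
    IsLocalization.map_units _ β
  have hαβ' : v * (Proj 𝒜).presheaf.germ (Proj.basicOpen 𝒜 t) x hx β.1 =
    (Proj 𝒜).presheaf.germ (Proj.basicOpen 𝒜 t) x hx α := hαβ
  have hα : IsUnit ((Proj 𝒜).presheaf.germ (Proj.basicOpen 𝒜 t) x hx α) := hαβ' ▸ hv.mul hβ
  have h4 := congrArg (algebraMap ((Proj 𝒜).presheaf.stalk x) (Proj 𝒜).functionField) hαβ'
  rw [map_mul, Scheme.algebraMap_germ_eq_germToFunctionField,
    Scheme.algebraMap_germ_eq_germToFunctionField] at h4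
  replace h4 := congrArg toFractionRing h4
  obtain ⟨n, a, ha, rfl⟩ := exists_awayMk_eq hi ht α
  obtain ⟨m, b, hb, hbβ⟩ := exists_awayMk_eq hi ht β.1
  rw [hbβ] at h4 hβ
  rw [map_mul, toFractionRing_germ, toFractionRing_germ] at h4
  have ha' : a ∉ x.asHomogeneousIdeal := (mem_basicOpen_awayToSection ht n a ha x hx).mp
    ((Scheme.mem_basicOpen _ _ _ hx).mpr hα)
  have hb' : b ∉ x.asHomogeneousIdeal := (mem_basicOpen_awayToSection ht m b hb x hx).mp
    ((Scheme.mem_basicOpen _ _ _ hx).mpr hβ)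
  have htx : ∀ k, t ^ k ∉ x.asHomogeneousIdeal := fun k hk ↦ hx (x.isPrime.mem_of_pow_mem k hk)
  refine ⟨a * t ^ m, b * t ^ n, fun h ↦ (x.isPrime.mem_or_mem h).elim ha' (htx m),
    fun h ↦ (x.isPrime.mem_or_mem h).elim hb' (htx n), ?_⟩
  have h0' : algebraMap A (FractionRing A) t ≠ 0 := by
    rw [Ne, IsFractionRing.to_map_eq_zero_iff]
    exact ne_zero_of_mem_basicOpen hx
  have hb0' : algebraMap A (FractionRing A) b ≠ 0 := by
    rw [Ne, IsFractionRing.to_map_eq_zero_iff]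
    rintro rfl
    exact hb' (zero_mem _)
  rw [map_mul, map_mul, map_pow, map_pow, eq_div_iff (by positivity)]
  field_simp at h4
  linear_combination h4

/-- The prime ideal generated by a prime divisor of a homogeneous element, as a point. -/
theorem exists_point_of_prime_dvd [UniqueFactorizationMonoid A] {q g : A} (hq : Prime q)
    {n : ℕ} (hg : g ∈ 𝒜 n) (hg0 : g ≠ 0) (hqg : q ∣ g) {j : ℕ} (hj : 0 < j) {s : A} (hs : s ∈ 𝒜 j)
    (hqs : ¬ q ∣ s) : ∃ x : Proj 𝒜, ∀ a, a ∈ x.asHomogeneousIdeal ↔ q ∣ a := by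
  have hP : (Ideal.span {q}).IsPrime := (Ideal.span_singleton_prime hq.ne_zero).mpr hq
  have hle := Ideal.toIdeal_homogeneousCore_le 𝒜 (Ideal.span {q})
  have hcore : ((Ideal.span {q}).homogeneousCore 𝒜).toIdeal.IsPrime := hP.homogeneousCore
  have hgm : g ∈ (Ideal.span {q}).homogeneousCore 𝒜 :=
    Ideal.mem_homogeneousCore_of_homogeneous_of_mem ⟨n, hg⟩ (Ideal.mem_span_singleton.mpr hqg)
  -- The homogeneous core of `(q)` is a nonzero prime ideal, hence contains a prime element `q'`.
  -- Being divisible by `q`, it is associated to `q`, so the core is all of `(q)`.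
  obtain ⟨q', hq', hpr⟩ := hcore.exists_mem_prime_of_ne_bot (fun h ↦ hg0 (by
    have : g ∈ ((Ideal.span {q}).homogeneousCore 𝒜).toIdeal := hgm
    rwa [h] at this))
  have hass : Associated q q' := hq.associated_of_dvd hpr (Ideal.mem_span_singleton.mp (hle hq'))
  refine ⟨⟨(Ideal.span {q}).homogeneousCore 𝒜, hcore, fun h ↦ hqs (Ideal.mem_span_singleton.mp
    (hle (h (HomogeneousIdeal.mem_irrelevant_of_mem 𝒜 hj hs))))⟩, fun a ↦
    ⟨fun h ↦ Ideal.mem_span_singleton.mp (hle h), fun h ↦ ?_⟩⟩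
  exact Ideal.mem_of_dvd _ (hass.symm.dvd.trans h) hq'

/-- Write `κ = a / b = a b / b ^ 2` and `a b = k ^ 2 m` with `m` squarefree. A prime factor `q` of
`m` defines a point of `Proj` (`hprime` keeps `(q)` from containing the irrelevant ideal), where `κ`
would have odd valuation. So `m` is a unit, hence a square by `hunit`, and `hroot` makes the square
root of `a b` homogeneous of the degree of `b`. -/
theorem exists_eq_sq_of_stalk [UniqueFactorizationMonoid A] {i : ℕ} (hi : 0 < i) {t : A}
    (ht : t ∈ 𝒜 i) [Nonempty (Proj.basicOpen 𝒜 t)]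
    (hprime : ∀ q : A, Prime q → ∃ j, 0 < j ∧ ∃ s ∈ 𝒜 j, ¬ q ∣ s)
    (hunit : ∀ u : A, IsUnit u → ∃ c, u = c ^ 2)
    (hroot : ∀ (k : A) (e : ℕ), k ^ 2 ∈ 𝒜 (2 * e) → k ∈ 𝒜 e)
    (κ : (Proj 𝒜).functionField) (hκ : κ ≠ 0)
    (h : ∀ x : Proj 𝒜, ∃ (v : (Proj 𝒜).presheaf.stalk x) (r : (Proj 𝒜).functionField),
      IsUnit v ∧ r ≠ 0 ∧
        κ = algebraMap ((Proj 𝒜).presheaf.stalk x) (Proj 𝒜).functionField v * r ^ 2) :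
    ∃ r, κ = r ^ 2 := by
  have hF : ∀ a : A, a ≠ 0 → algebraMap A (FractionRing A) a ≠ 0 := fun a ha ↦ by
    rwa [Ne, IsFractionRing.to_map_eq_zero_iff]
  obtain ⟨e, a, b, ha, hb, hb0, hab⟩ := exists_toFractionRing_eq hi ht κ
  have ha0 : a ≠ 0 := by
    rintro rfl
    rw [map_zero, zero_div, map_eq_zero] at hab
    exact hκ hab
  have hG : a * b ∈ 𝒜 (2 * (e • i)) := by rw [two_mul]; exact SetLike.mul_mem_graded ha hb
  obtain ⟨k, m, hkm, hm⟩ := exists_eq_sq_mul_squarefree (a * b) (mul_ne_zero ha0 hb0)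
  have hk0 : k ≠ 0 := by rintro rfl; simp [ha0, hb0] at hkm
  have hmu : IsUnit m := by
    by_contra hmu
    obtain ⟨q, hq, c, rfl⟩ := WfDvdMonoid.exists_irreducible_factor hmu hm.ne_zero
    have hqp := hq.prime
    obtain ⟨j, hj, s, hs, hqs⟩ := hprime q hqp
    obtain ⟨x, hx⟩ := exists_point_of_prime_dvd hqp hG (mul_ne_zero ha0 hb0)
      (hkm ▸ ⟨k ^ 2 * c, by ring⟩) hj hs hqs
    obtain ⟨v, r, hv, hr, hvr⟩ := h x
    obtain ⟨u, u', hu, hu', huv⟩ := exists_toFractionRing_stalk_eq x v hv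
    obtain ⟨l, r₁, r₂, -, -, hr₂, hrr⟩ := exists_toFractionRing_eq hi ht r
    rw [hx] at hu hu'
    have hqc : ¬ q ∣ c := fun ⟨d, hd⟩ ↦ hq.not_isUnit (hm q ⟨d, by rw [hd]; ring⟩)
    have hu0 : u' ≠ 0 := by rintro rfl; exact hu' (dvd_zero q)
    have h5 := congrArg toFractionRing hvr
    rw [map_mul, map_pow, huv, hrr, hab] at h5
    -- This is `a / b = (u / u') (r₁ / r₂) ^ 2` with denominators cleared and multiplied by `b`, so
    -- that `a b = k ^ 2 q c` can be substituted.
    have h6 : a * b * u' * r₂ ^ 2 = u * (r₁ * b) ^ 2 := by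
      apply IsFractionRing.injective A (FractionRing A)
      have := hF b hb0
      have := hF u' hu0
      have := hF r₂ hr₂
      simp only [map_mul, map_pow]
      field_simp at h5
      linear_combination (algebraMap A (FractionRing A) b) * h5
    refine mul_sq_ne_mul_sq (c := c * u') (u := u) (x := k * r₂) (y := r₁ * b) hqp
      (fun hd ↦ (hqp.dvd_or_dvd hd).elim hqc hu') hu (mul_ne_zero hk0 hr₂) ?_
    rw [← h6, hkm]
    ring
  obtain ⟨c, rfl⟩ := hunit m hmu
  have hk : k * c ∈ 𝒜 (e • i) := hroot _ _ (by rw [mul_pow, ← hkm]; exact hG)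
  obtain ⟨r, hr⟩ := exists_eq_toFractionRing ht hk hb
  refine ⟨r, toFractionRing.injective ?_⟩
  have := hF b hb0
  rw [map_pow, hr, hab]
  have h7 := congrArg (algebraMap A (FractionRing A)) hkm
  simp only [map_mul, map_pow] at h7 ⊢
  field_simp
  linear_combination h7

end ProjTools

/-! ### Homogeneous square roots and the case of `P^3` -/

namespace DoubleCover

open MvPolynomial ProjTools

/-- The homomorphism `x_i ↦ x_i T`. -/
def scaleHom (n : ℕ) : MvPolynomial (Fin n) ℂ →ₐ[ℂ] Polynomial (MvPolynomial (Fin n) ℂ) :=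
  aeval fun i ↦ Polynomial.C (X i) * Polynomial.X

theorem scaleHom_monomial {n : ℕ} (e : Fin n →₀ ℕ) (c : ℂ) :
    scaleHom n (monomial e c) =
      Polynomial.C (monomial e c) * Polynomial.X ^ Finsupp.weight (1 : Fin n → ℕ) e := by
  rw [scaleHom, aeval_monomial, Finsupp.prod_fintype _ _ (by simp), Finsupp.weight_apply,
    Finsupp.sum_fintype _ _ (by simp), monomial_eq, Finsupp.prod_fintype _ _ (by simp)]
  simp only [mul_pow, Finset.prod_mul_distrib, Pi.one_apply, smul_eq_mul, mul_one,
    Finset.prod_pow_eq_pow_sum, map_mul, map_prod, map_pow, mul_assoc]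
  rfl

theorem scaleHom_of_mem {n d : ℕ} {p : MvPolynomial (Fin n) ℂ}
    (hp : p ∈ weightedHomogeneousSubmodule ℂ (1 : Fin n → ℕ) d) :
    scaleHom n p = Polynomial.C p * Polynomial.X ^ d := by
  conv_lhs => rw [p.as_sum]
  conv_rhs => rw [p.as_sum]
  rw [map_sum, map_sum, Finset.sum_mul]
  refine Finset.sum_congr rfl fun e he ↦ ?_
  rw [scaleHom_monomial, (mem_weightedHomogeneousSubmodule ℂ _ d p).mp hp (mem_support_iff.mp he)]

theorem coeff_scaleHom {n : ℕ} (p : MvPolynomial (Fin n) ℂ) (d : ℕ) :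
    (scaleHom n p).coeff d =
      (DirectSum.decompose (weightedHomogeneousSubmodule ℂ (1 : Fin n → ℕ)) p d : _) := by
  classical
  conv_lhs => rw [← DirectSum.sum_support_decompose
    (weightedHomogeneousSubmodule ℂ (1 : Fin n → ℕ)) p]
  rw [map_sum, Polynomial.finsetSum_coeff]
  rw [Finset.sum_eq_single d]
  · rw [scaleHom_of_mem (SetLike.coe_mem _), Polynomial.coeff_C_mul, Polynomial.coeff_X_pow_self,
      mul_one]
  · intro i _ hi
    rw [scaleHom_of_mem (SetLike.coe_mem _), Polynomial.coeff_C_mul, Polynomial.coeff_X_pow,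
      if_neg hi.symm, mul_zero]
  · intro h
    rw [DFinsupp.notMem_support_iff.mp h, ZeroMemClass.coe_zero, map_zero, Polynomial.coeff_zero]

/-- Scaling the variables by `T` gives `k(xT) ^ 2 = (k T ^ e) ^ 2`, so `k(xT) = ± k T ^ e`. The
coefficient of `T ^ e` on the left is the component of `k` of degree `e`. -/
theorem mem_of_sq_mem {n : ℕ} (k : MvPolynomial (Fin n) ℂ) (e : ℕ)
    (h : k ^ 2 ∈ weightedHomogeneousSubmodule ℂ (1 : Fin n → ℕ) (2 * e)) :
    k ∈ weightedHomogeneousSubmodule ℂ (1 : Fin n → ℕ) e := by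
  have h1 := scaleHom_of_mem h
  have h2 : scaleHom n k ^ 2 = (Polynomial.C k * Polynomial.X ^ e) ^ 2 := by
    rw [← map_pow, h1, map_pow, mul_pow, ← pow_mul, mul_comm 2]
  have h3 := coeff_scaleHom k e
  rcases sq_eq_sq_iff_eq_or_eq_neg.mp h2 with h4 | h4
  · rw [h4, Polynomial.coeff_C_mul, Polynomial.coeff_X_pow_self, mul_one] at h3
    rw [h3]
    exact SetLike.coe_mem _
  · rw [h4, Polynomial.coeff_neg, Polynomial.coeff_C_mul, Polynomial.coeff_X_pow_self, mul_one,
      neg_eq_iff_eq_neg] at h3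
    rw [h3]
    exact neg_mem (SetLike.coe_mem _)

theorem exists_eq_sq_of_isUnit {n : ℕ} (u : MvPolynomial (Fin n) ℂ) (hu : IsUnit u) :
    ∃ c, u = c ^ 2 := by
  obtain ⟨r, -, rfl⟩ := MvPolynomial.isUnit_iff_eq_C_of_isReduced.mp hu
  obtain ⟨z, hz⟩ := IsAlgClosed.exists_pow_nat_eq r two_pos
  exact ⟨C z, by rw [← C_pow, hz]⟩

theorem not_X_dvd_X {n : ℕ} {i j : Fin n} (h : i ≠ j) :
    ¬ (X i : MvPolynomial (Fin n) ℂ) ∣ X j := by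
  classical
  rintro ⟨c, hc⟩
  have := congrArg (MvPolynomial.eval (Pi.single j (1 : ℂ))) hc
  simp [h] at this

instance isIntegral_P3 : IsIntegral P3 :=
  isIntegral_proj one_pos (X_mem (1 : Fin 4 → ℕ) 0) (X_ne_zero 0)

theorem exists_mem_basicOpen_X {n : ℕ} {w : Fin n → ℕ} (x : WP w) :
    ∃ i, x ∈ Proj.basicOpen (weightedHomogeneousSubmodule ℂ w) (X i) := by
  by_contra! H
  refine x.not_irrelevant_le ?_
  rw [HomogeneousIdeal.irrelevant_le]
  intro n hn a ha
  refine (Ideal.span_le.mpr ?_ : Ideal.span (Set.range X) ≤ x.asHomogeneousIdeal.toIdeal)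
    (irrelevant_le_span_X w hn ha)
  rintro _ ⟨i, rfl⟩
  by_contra hc
  exact H i hc

theorem nonempty_basicOpen {A : Type} [CommRing A] [IsDomain A] [Algebra ℂ A]
    {𝒜 : ℕ → Submodule ℂ A} [GradedAlgebra 𝒜] {i : ℕ} (hi : 0 < i) {t : A} (ht : t ∈ 𝒜 i)
    (h0 : t ≠ 0) : Nonempty (Proj.basicOpen 𝒜 t) :=
  ⟨⟨⟨⊥, Ideal.isPrime_bot, fun h ↦ h0 (h (HomogeneousIdeal.mem_irrelevant_of_mem 𝒜 hi ht))⟩, h0⟩⟩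

/-- Double covers of `P^3` with the same branch locus are isomorphic. -/
theorem IsDoubleCover.exists_iso_P3 {Y Q : Scheme.{0}} {D : TopologicalSpace.Closeds P3}
    {π : Y ⟶ P3} {p : Q ⟶ P3} (hπ : IsDoubleCover π D) (hp : IsDoubleCover p D) :
    ∃ e : Y ≅ Q, e.hom ≫ p = π := by
  have hne : Nonempty (Proj.basicOpen (weightedHomogeneousSubmodule ℂ (1 : Fin 4 → ℕ)) (X 0)) :=
    nonempty_basicOpen one_pos (X_mem (1 : Fin 4 → ℕ) 0) (X_ne_zero 0)
  refine IsDoubleCover.exists_iso (fun U _ hU ↦ isIntegrallyClosed_of_isAffineOpen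
    isIntegrallyClosed_stalk U hU) isUnit_two_proj (fun κ hκ h ↦
    exists_eq_sq_of_stalk one_pos (X_mem (1 : Fin 4 → ℕ) 0) ?_ exists_eq_sq_of_isUnit
      mem_of_sq_mem κ hκ h) hπ hp
  intro q hq
  -- A prime cannot divide two distinct variables, so one of the first two supplies an element of
  -- degree `1` outside `(q)`.
  by_cases h : q ∣ X 0
  · refine ⟨1, one_pos, X 1, X_mem (1 : Fin 4 → ℕ) 1, fun h1 ↦ not_X_dvd_X (n := 4) (i := 0) (j := 1)
      (by decide) ?_⟩
    exact (hq.irreducible.associated_of_dvd (MvPolynomial.X_prime (i := (0 : Fin 4))).irreducible h).symm.dvd.trans h1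
  · exact ⟨1, one_pos, X 0, X_mem (1 : Fin 4 → ℕ) 0, h⟩

end DoubleCover

namespace DoubleCover

open MvPolynomial ProjTools

/-! ### Invariant polynomials -/

/-- The sign by which `g` acts on the monomial with exponent `e`. -/
def sign (g : Mu) (e : Fin 5 →₀ ℕ) : ℤˣ := ∏ i, g i ^ e i

theorem signHom_monomial (g : Mu) (e : Fin 5 →₀ ℕ) (c : ℂ) :
    signHom g (monomial e c) = monomial e (((sign g e : ℤˣ) : ℤ) * c) := by
  rw [signHom, aeval_monomial, Finsupp.prod_fintype _ _ (by simp), monomial_eq,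
    Finsupp.prod_fintype _ _ (by simp), sign, algebraMap_eq, C_mul]
  simp only [mul_pow, Finset.prod_mul_distrib, Units.coe_prod, Units.val_pow_eq_pow_val,
    Int.cast_prod, Int.cast_pow, map_prod, map_pow]
  ring

theorem coeff_signHom (g : Mu) (e : Fin 5 →₀ ℕ) (b : MvPolynomial (Fin 5) ℂ) :
    coeff e (signHom g b) = ((sign g e : ℤˣ) : ℤ) * coeff e b := by
  classical
  induction b using MvPolynomial.induction_on' with
  | monomial d c =>
    rw [signHom_monomial, coeff_monomial, coeff_monomial]
    split_ifs with h
    · rw [h]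
    · rw [mul_zero]
  | add p q hp hq => rw [map_add, coeff_add, coeff_add, hp, hq, mul_add]

theorem sign_mulSingle (i : Fin 5) (e : Fin 5 →₀ ℕ) :
    sign (Pi.mulSingle i (-1)) e = (-1) ^ e i := by
  rw [sign, Finset.prod_eq_single i]
  · rw [Pi.mulSingle_eq_same]
  · intro j _ hj
    rw [Pi.mulSingle_eq_of_ne hj, one_pow]
  · simp

theorem sign_mul (g h : Mu) (e : Fin 5 →₀ ℕ) : sign (g * h) e = sign g e * sign h e := by
  simp only [sign, Pi.mul_apply, mul_pow, Finset.prod_mul_distrib]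

theorem coeff_eq_zero_of_sign {g : Mu} {e : Fin 5 →₀ ℕ} {b : MvPolynomial (Fin 5) ℂ}
    (hb : signHom g b = b) (hg : sign g e = -1) : coeff e b = 0 := by
  have h := coeff_signHom g e b
  rw [hb, hg] at h
  push_cast at h
  linear_combination h / 2

theorem squareHom_monomial (e : Fin 5 →₀ ℕ) (c : ℂ) :
    squareHom (monomial e c) = monomial (2 • e) c := by
  rw [squareHom, aeval_monomial, monomial_eq, Finsupp.prod_fintype _ _ (by simp),
    Finsupp.prod_fintype _ _ (by simp), algebraMap_eq]
  simp only [← pow_mul, Finsupp.smul_apply, smul_eq_mul]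

theorem exists_squareHom_eq_of_even {b : MvPolynomial (Fin 5) ℂ}
    (hb : ∀ e ∈ b.support, ∀ i, Even (e i)) : ∃ a, squareHom a = b := by
  choose! h hh using hb
  refine ⟨∑ e ∈ b.support, monomial (Finsupp.equivFunOnFinite.symm (h e)) (coeff e b), ?_⟩
  conv_rhs => rw [b.as_sum]
  rw [map_sum]
  refine Finset.sum_congr rfl fun e he ↦ ?_
  rw [squareHom_monomial]
  congr 2
  refine Finsupp.ext fun i ↦ ?_
  rw [hh e he i, ← two_mul]
  rfl

theorem squareHom_monomial_mul_prod_X {d e : Fin 5 →₀ ℕ} (h : ∀ i, e i = 2 * d i + 1) (c : ℂ) :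
    squareHom (monomial d c) * ∏ i, X i = monomial e c := by
  rw [squareHom_monomial, monomial_eq (s := e), Finsupp.prod_fintype _ _ (by simp), monomial_eq,
    Finsupp.prod_fintype _ _ (by simp), mul_assoc, ← Finset.prod_mul_distrib]
  refine congrArg (C c * ·) (Finset.prod_congr rfl fun i _ ↦ ?_)
  rw [h i, pow_succ, Finsupp.smul_apply, smul_eq_mul]

theorem exists_squareHom_mul_eq_of_odd {b : MvPolynomial (Fin 5) ℂ}
    (hb : ∀ e ∈ b.support, ∀ i, Odd (e i)) : ∃ a, squareHom a * ∏ i, X i = b := by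
  choose! h hh using hb
  refine ⟨∑ e ∈ b.support, monomial (Finsupp.equivFunOnFinite.symm (h e)) (coeff e b), ?_⟩
  conv_rhs => rw [b.as_sum]
  rw [map_sum, Finset.sum_mul]
  exact Finset.sum_congr rfl fun e he ↦ squareHom_monomial_mul_prod_X (fun i ↦ hh e he i) _

/-- Changing the sign of one variable negates the monomials of odd exponent in it, so these do not
occur. -/
theorem exists_squareHom_eq {b : MvPolynomial (Fin 5) ℂ} (hb : ∀ g : Mu, signHom g b = b) :
    ∃ a, squareHom a = b := by
  refine exists_squareHom_eq_of_even fun e he i ↦ ?_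
  by_contra hodd
  refine mem_support_iff.mp he (coeff_eq_zero_of_sign (hb (Pi.mulSingle i (-1))) ?_)
  rw [sign_mulSingle, (Nat.not_even_iff_odd.mp hodd).neg_one_pow]

/-- The subgroup of `μ_2 ^ 5` of the elements with product `1`. -/
def MuPrime : Subgroup Mu := (prodHom.comp (QuotientGroup.mk' K)).ker

theorem mem_MuPrime {g : Mu} : g ∈ MuPrime ↔ ∏ i, g i = 1 := Iff.rfl

/-- Changing two signs at once preserves the product `1`, and negates any monomial whose exponents
at the two places have different parity. Hence each monomial occurring is a square or a square times
the product of all variables; the exponent of `X 0` decides which. -/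
theorem exists_squareHom_add_mul_eq {b : MvPolynomial (Fin 5) ℂ}
    (hb : ∀ g ∈ MuPrime, signHom g b = b) :
    ∃ a c, b = squareHom a + squareHom c * ∏ i, X i := by
  classical
  have hpar : ∀ e ∈ b.support, ∀ i j, Odd (e i) → Odd (e j) := by
    intro e he i j hi
    by_contra hj
    have hij : i ≠ j := by rintro rfl; exact hj hi
    refine mem_support_iff.mp he (coeff_eq_zero_of_sign
      (hb (Pi.mulSingle i (-1) * Pi.mulSingle j (-1)) ?_) ?_)
    · rw [mem_MuPrime]
      simp [Finset.prod_mul_distrib]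
    · rw [sign_mul, sign_mulSingle, sign_mulSingle, hi.neg_one_pow,
        (Nat.not_odd_iff_even.mp hj).neg_one_pow, mul_one]
  obtain ⟨a, ha⟩ := exists_squareHom_eq_of_even
    (b := ∑ e ∈ b.support.filter (fun e ↦ Even (e 0)), monomial e (coeff e b)) (by
      intro e he i
      obtain ⟨d, hd, hed⟩ := Finset.mem_biUnion.mp (support_sum he)
      rw [Finset.mem_filter] at hd
      obtain rfl := Finset.mem_singleton.mp (support_monomial_subset hed)
      exact Nat.not_odd_iff_even.mp fun h ↦ Nat.not_even_iff_odd.mpr (hpar _ hd.1 i 0 h) hd.2)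
  obtain ⟨c, hc⟩ := exists_squareHom_mul_eq_of_odd
    (b := ∑ e ∈ b.support.filter (fun e ↦ ¬ Even (e 0)), monomial e (coeff e b)) (by
      intro e he i
      obtain ⟨d, hd, hed⟩ := Finset.mem_biUnion.mp (support_sum he)
      rw [Finset.mem_filter] at hd
      obtain rfl := Finset.mem_singleton.mp (support_monomial_subset hed)
      exact hpar _ hd.1 0 i (Nat.not_even_iff_odd.mp hd.2))
  refine ⟨a, c, ?_⟩
  rw [ha, hc, Finset.sum_filter_add_sum_filter_not]
  exact b.as_sum

/-! ### The squaring map -/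

theorem signHom_X_sq (g : Mu) (i : Fin 5) : signHom g (X i ^ 2) = X i ^ 2 := by
  rw [map_pow, signHom, aeval_X, mul_pow, ← C_pow]
  norm_cast
  simp

theorem signHom_squareHom (g : Mu) (a : MvPolynomial (Fin 5) ℂ) :
    signHom g (squareHom a) = squareHom a := by
  have : (signHom g).comp squareHom = squareHom :=
    MvPolynomial.algHom_ext fun i ↦ by
      rw [AlgHom.comp_apply, squareHom, aeval_X, signHom_X_sq]
  exact AlgHom.congr_fun this a

/-- Every complex point has coordinatewise square roots, so a polynomial in the kernel vanishes at
all points. -/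
theorem squareHom_injective : Function.Injective squareHom := by
  rw [injective_iff_map_eq_zero]
  intro a ha
  refine MvPolynomial.funext fun z ↦ ?_
  choose y hy using fun i ↦ IsAlgClosed.exists_pow_nat_eq (z i) two_pos
  have h := congrArg (MvPolynomial.aeval y) ha
  rw [squareHom, ← AlgHom.comp_apply, comp_aeval] at h
  simpa [hy, aeval_eq_eval] using h

theorem signHom_prod_X (g : Mu) :
    signHom g (∏ i, X i) = C ((((∏ i, g i : ℤˣ)) : ℤ) : ℂ) * ∏ i, X i := by
  simp only [map_prod, signHom, aeval_X, Finset.prod_mul_distrib, Units.coe_prod, Int.cast_prod]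

theorem squarefree_prod_X (n : ℕ) : Squarefree (∏ i, X i : MvPolynomial (Fin n) ℂ) := by
  suffices h : ∀ s : Finset (Fin n), Squarefree (∏ i ∈ s, X i : MvPolynomial (Fin n) ℂ) from h _
  intro s
  induction s using Finset.cons_induction with
  | empty => simp
  | cons a s ha ih =>
    rw [Finset.prod_cons, squarefree_mul_iff]
    refine ⟨IsRelPrime.prod_right fun j hj ↦ ?_, X_prime.squarefree, ih⟩
    exact X_prime.irreducible.isRelPrime_iff_not_dvd.mpr
      (not_X_dvd_X fun h ↦ ha (h ▸ hj))

theorem prod_X_mem : (∏ i, X i : MvPolynomial (Fin 5) ℂ) ∈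
    weightedHomogeneousSubmodule ℂ wt 8 := by
  have h := SetLike.prod_mem_graded (weightedHomogeneousSubmodule ℂ wt) wt
    (fun i ↦ (X i : MvPolynomial (Fin 5) ℂ)) (F := Finset.univ) fun i _ ↦ X_mem wt i
  simpa [Fin.sum_univ_five] using h

theorem mem_sup_zeros {n : ℕ} (w : Fin n → ℕ) (x : WP w) :
    x ∈ Finset.univ.sup (fun i ↦ zeros w (X i)) ↔ ∏ i, X i ∈ x.asHomogeneousIdeal := by
  rw [← SetLike.mem_coe, TopologicalSpace.Closeds.coe_finset_sup, Finset.sup_univ_eq_iSup,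
    Set.iSup_eq_iUnion, Set.mem_iUnion]
  refine Iff.trans ?_ (x.isPrime.prod_mem_iff (s := Finset.univ)).symm
  simp only [Finset.mem_univ, true_and]
  exact exists_congr fun i ↦ Set.singleton_subset_iff

/-! ### Group actions -/

/-- `K` acts trivially and `G'` is the image of `MuPrime`, so both groups give the same
automorphisms. Unlike `G'`, `MuPrime` acts on the graded ring itself. -/
theorem projAction_comp_subtype {B : Type} [CommRing B] [Algebra ℂ B] {ℬ : ℕ → Submodule ℂ B}
    [GradedAlgebra ℬ] (ρ : Mu →* (ℬ →+*ᵍ ℬ)) (h : K ≤ (projAction ρ).ker) {Z : Scheme.{0}}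
    (q : Proj ℬ ⟶ Z) :
    IsGeometricQuotient ((QuotientGroup.lift K (projAction ρ) h).comp Gprime.subtype) q ↔
      IsGeometricQuotient (projAction (ρ.comp MuPrime.subtype)) q := by
  have h₁ : ∀ g : MuPrime, ∃ g' : Gprime,
      (QuotientGroup.lift K (projAction ρ) h).comp Gprime.subtype g' =
        projAction (ρ.comp MuPrime.subtype) g :=
    fun g ↦ ⟨⟨(g : Mu), g.2⟩, rfl⟩
  have h₂ : ∀ g' : Gprime, ∃ g : MuPrime, projAction (ρ.comp MuPrime.subtype) g =
      (QuotientGroup.lift K (projAction ρ) h).comp Gprime.subtype g' := by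
    rintro ⟨g', hg⟩
    obtain ⟨g, rfl⟩ := QuotientGroup.mk_surjective g'
    exact ⟨⟨g, hg⟩, rfl⟩
  exact ⟨fun hq ↦ hq.of_range h₂ h₁, fun hq ↦ hq.of_range h₁ h₂⟩

end DoubleCover

namespace DoubleCover

open MvPolynomial ProjTools

/-- The map `τ` changes the sign of the second term, so adding the two relations kills it and gives
`a = 0`. Multiplying the rest by `W` gives `c P = 0`. -/
theorem eq_zero_of_add_mul_eq_zero {A B : Type} [CommRing A] [IsDomain A] [CommRing B] [Algebra ℂ B]
    {φ : A →+* B} (hφ : Function.Injective φ) (τ : B →+* B) (hτ : ∀ a, τ (φ a) = φ a) {W : B}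
    (hW : τ W = -W) {P : A} (hP : P ≠ 0) (hWP : W ^ 2 = φ P) (a c : A)
    (h : φ a + φ c * W = 0) : a = 0 ∧ c = 0 := by
  have h1 := congrArg τ h
  rw [map_add, map_mul, hτ, hτ, hW, map_zero] at h1
  have h2 : (2 : ℂ) • φ a = 0 := by
    rw [two_smul]
    linear_combination h + h1
  have ha : a = 0 := hφ (by
    rw [map_zero]
    exact (smul_eq_zero_iff_right (two_ne_zero' ℂ)).mp h2)
  refine ⟨ha, ?_⟩
  rw [ha, map_zero, zero_add] at h
  have h3 : φ (c * P) = 0 := by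
    rw [map_mul, ← hWP]
    linear_combination W * h
  exact (mul_eq_zero.mp (hφ (h3.trans (map_zero φ).symm))).resolve_right hP

/-! ### The quotients of `P(1,1,1,1,4)` -/

theorem isGeometricQuotient_Phi : IsGeometricQuotient actionG Phi := by
  refine IsGeometricQuotient.of_range (ρ := projAction signAction) ?_ (fun g ↦ ⟨g, rfl⟩)
    (fun g' ↦ ?_)
  · exact isGeometricQuotient_projMapDeg signAction squareHom.toRingHom 2 two_pos squareHom_mem
      squareHom_irrelevant (fun g c ↦ (signHom g).commutes c) signHom_squareHom
      squareHom_injective fun b hb ↦ exists_squareHom_eq hb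
  · obtain ⟨g, rfl⟩ := QuotientGroup.mk_surjective g'
    exact ⟨g, rfl⟩

theorem isGeometricQuotient_actionG_iff {Z : Scheme.{0}} (q : P11114 ⟶ Z) :
    IsGeometricQuotient (actionG.comp Gprime.subtype) q ↔
      IsGeometricQuotient (projAction (signAction.comp MuPrime.subtype)) q :=
  projAction_comp_subtype signAction _ q

theorem exists_isGeometricQuotient_P11114 : ∃ (Z : Scheme.{0}) (q : P11114 ⟶ Z),
    IsGeometricQuotient (actionG.comp Gprime.subtype) q := by
  obtain ⟨Z, q, hq, -⟩ := exists_isGeometricQuotient (signAction.comp MuPrime.subtype)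
    squareHom.toRingHom 2 two_pos squareHom_mem squareHom_irrelevant
    (fun g ↦ signHom_squareHom g) (fun g c ↦ (signHom g).commutes c)
  exact ⟨Z, q, (isGeometricQuotient_actionG_iff q).mpr hq⟩

/-- The element `(1, 1, 1, 1, -1)`. -/
abbrev lastSign : Mu := Pi.mulSingle 4 (-1)

theorem signHom_lastSign_prod_X : signHom lastSign (∏ i, X i) = -∏ i, X i := by
  rw [signHom_prod_X]
  simp [lastSign]

theorem signHom_prod_X_of_mem {g : Mu} (hg : g ∈ MuPrime) : signHom g (∏ i, X i) = ∏ i, X i := by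
  rw [signHom_prod_X, mem_MuPrime.mp hg]
  simp

theorem exists_mem_basicOpen_of_degree_four (x : P11114) :
    ∃ t ∈ weightedHomogeneousSubmodule ℂ wt 4,
      x ∈ Proj.basicOpen (weightedHomogeneousSubmodule ℂ wt) t := by
  obtain ⟨i, hi⟩ := exists_mem_basicOpen_X x
  -- Each weight divides `4`: the fourth power is taken for the variables of weight `1`, and the
  -- last variable itself.
  refine ⟨X i ^ (4 / wt i), ?_, fun h ↦ hi (x.isPrime.mem_of_pow_mem _ h)⟩
  have h := SetLike.pow_mem_graded (4 / wt i) (X_mem wt i)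
  have h4 : (4 / wt i) • wt i = 4 := by fin_cases i <;> rfl
  rwa [h4] at h

theorem prod_X_sq : (∏ i, X i : MvPolynomial (Fin 5) ℂ) ^ 2 = squareHom (∏ i, X i) := by
  rw [← Finset.prod_pow, map_prod]
  refine Finset.prod_congr rfl fun i _ ↦ ?_
  rw [squareHom, aeval_X]

theorem isDoubleCover_toricBoundary {Z : Scheme.{0}} {q : P11114 ⟶ Z} {p : Z ⟶ P11114}
    (hq : IsGeometricQuotient (actionG.comp Gprime.subtype) q) (hp : q ≫ p = Phi) :
    IsDoubleCover p toricBoundary := by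
  -- The product of the variables has weighted degree `8`. As `W` this is `2 * 4`, with `2` the
  -- degree of `squareHom`, and as `P` it is twice `4`; hence charts of degree `4`.
  refine IsGeometricQuotient.isDoubleCover (signAction.comp MuPrime.subtype)
    squareHom.toRingHom 2 two_pos squareHom_mem squareHom_irrelevant
    (fun g c ↦ (signHom g).commutes c) (fun g ↦ signHom_squareHom g) (i := 4) (by norm_num)
    (W := ∏ i, X i) (P := ∏ i, X i) prod_X_mem prod_X_mem (squarefree_prod_X 5) prod_X_sq
    (fun g ↦ signHom_prod_X_of_mem g.2) ?_ ?_ exists_mem_basicOpen_of_degree_four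
    (mem_sup_zeros wt) ((isGeometricQuotient_actionG_iff q).mp hq) hp
  · exact eq_zero_of_add_mul_eq_zero squareHom_injective (signHom lastSign).toRingHom
      (signHom_squareHom lastSign) signHom_lastSign_prod_X (squarefree_prod_X 5).ne_zero prod_X_sq
  · exact fun b hb ↦ exists_squareHom_add_mul_eq fun g hg ↦ hb ⟨g, hg⟩

/-! ### The quotient of `Y'` -/

section Hypersurface

variable (f : MvPolynomial (Fin 4) ℂ) (hf : f.IsHomogeneous 4)

/-- The action of `μ_2 ^ 5` on the homogeneous coordinate ring of `Y'`. -/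
def signActionQuot : Mu →* (quotGrading (hypersurfaceIdeal f hf) →+*ᵍ
    quotGrading (hypersurfaceIdeal f hf)) :=
  quotAction signAction (hypersurfaceIdeal f hf) (signAction_hypersurface f hf)

theorem signActionQuot_mk (g : Mu) (b : MvPolynomial (Fin 5) ℂ) :
    signActionQuot f hf g (Ideal.Quotient.mk _ b) =
      Ideal.Quotient.mk (hypersurfaceIdeal f hf).toIdeal (signHom g b) :=
  rfl

theorem signActionQuot_algebraMap (g : Mu) (c : ℂ) :
    signActionQuot f hf g (algebraMap ℂ _ c) = algebraMap ℂ _ c :=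
  (signActionQuot_mk f hf g (C c)).trans
    (congrArg (Ideal.Quotient.mk _) ((signHom g).commutes c))

theorem signActionQuot_coverHom (g : Mu) (a : MvPolynomial (Fin 4) ℂ) :
    signActionQuot f hf g (coverHom f hf a) = coverHom f hf a := by
  have h : (signHom g).comp
      (aeval (R := ℂ) (fun i : Fin 4 ↦ (X i.castSucc ^ 2 : MvPolynomial (Fin 5) ℂ))) =
      aeval (R := ℂ) (fun i : Fin 4 ↦ (X i.castSucc ^ 2 : MvPolynomial (Fin 5) ℂ)) :=
    MvPolynomial.algHom_ext fun i ↦ by rw [AlgHom.comp_apply, aeval_X, signHom_X_sq]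
  exact congrArg (Ideal.Quotient.mk _) (AlgHom.congr_fun h a)

theorem isGeometricQuotient_actionYprime_iff {Q : Scheme.{0}} (q : Yprime f hf ⟶ Q) :
    IsGeometricQuotient ((actionYprime f hf).comp Gprime.subtype) q ↔
      IsGeometricQuotient (projAction ((signActionQuot f hf).comp MuPrime.subtype)) q :=
  projAction_comp_subtype (signActionQuot f hf) _ q

theorem exists_isGeometricQuotient_Yprime : ∃ (Q : Scheme.{0}) (q : Yprime f hf ⟶ Q),
    IsGeometricQuotient ((actionYprime f hf).comp Gprime.subtype) q := by
  obtain ⟨Z, q, hq, -⟩ := exists_isGeometricQuotient ((signActionQuot f hf).comp MuPrime.subtype)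
    (coverHom f hf).toRingHom 2 two_pos (coverHom_mem f hf) (coverHom_irrelevant f hf)
    (fun g ↦ signActionQuot_coverHom f hf g) (fun g ↦ signActionQuot_algebraMap f hf g)
  exact ⟨Z, q, (isGeometricQuotient_actionYprime_iff f hf q).mpr hq⟩

/-- Every point `z` of affine four-space lifts to the cone over `Y'`: take square roots of the `z_i`
and of `f z`. Evaluating there kills the equation of `Y'` and returns the value of the polynomial at
`z`. -/
theorem coverHom_injective : Function.Injective (coverHom f hf) := by
  rw [injective_iff_map_eq_zero]
  intro a ha
  refine MvPolynomial.funext fun z ↦ ?_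
  choose y hy using fun i ↦ IsAlgClosed.exists_pow_nat_eq (z i) two_pos
  obtain ⟨y₅, hy₅⟩ := IsAlgClosed.exists_pow_nat_eq (MvPolynomial.eval z f) two_pos
  have hev : ∀ b : MvPolynomial (Fin 4) ℂ, aeval (Fin.snoc y y₅ : Fin 5 → ℂ)
      (aeval (R := ℂ) (fun i : Fin 4 ↦ (X i.castSucc ^ 2 : MvPolynomial (Fin 5) ℂ)) b) =
      MvPolynomial.eval z b := by
    intro b
    rw [← AlgHom.comp_apply, comp_aeval]
    simp [hy, aeval_eq_eval]
  obtain ⟨c, hc⟩ := Ideal.mem_span_singleton.mp (Ideal.Quotient.eq_zero_iff_mem.mp ha :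
    aeval (R := ℂ) (fun i : Fin 4 ↦ (X i.castSucc ^ 2 : MvPolynomial (Fin 5) ℂ)) a ∈
      Ideal.span {hypersurfacePoly f})
  have h := congrArg (aeval (Fin.snoc y y₅ : Fin 5 → ℂ)) hc
  have h4 : (Fin.snoc y y₅ : Fin 5 → ℂ) 4 = y₅ := Fin.snoc_last (α := fun _ ↦ ℂ) y₅ y
  rw [map_mul, hypersurfacePoly, map_sub, hev, hev, map_pow, aeval_X, h4, hy₅, sub_self,
    zero_mul] at h
  rw [h, map_zero]

/-- On `Y'` the last square `y_5 ^ 2` equals `f (y_1 ^ 2, …, y_4 ^ 2)`, so polynomials in the five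
squares reduce to polynomials in the first four. -/
theorem mk_squareHom (a : MvPolynomial (Fin 5) ℂ) :
    Ideal.Quotient.mk (hypersurfaceIdeal f hf).toIdeal (squareHom a) =
      coverHom f hf (aeval (Fin.snoc X f : Fin 5 → MvPolynomial (Fin 4) ℂ) a) := by
  have h : (Ideal.Quotient.mkₐ ℂ (hypersurfaceIdeal f hf).toIdeal).comp squareHom =
      (coverHom f hf).comp (aeval (Fin.snoc X f : Fin 5 → MvPolynomial (Fin 4) ℂ)) := by
    refine MvPolynomial.algHom_ext fun i ↦ ?_
    rw [AlgHom.comp_apply, AlgHom.comp_apply, squareHom, aeval_X, aeval_X]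
    induction i using Fin.lastCases with
    | last =>
      rw [Fin.snoc_last]
      exact Ideal.Quotient.eq.mpr (Ideal.mem_span_singleton_self (hypersurfacePoly f))
    | cast i =>
      rw [Fin.snoc_castSucc]
      exact congrArg (Ideal.Quotient.mk (hypersurfaceIdeal f hf).toIdeal)
        (aeval_X (fun i : Fin 4 ↦ (X i.castSucc ^ 2 : MvPolynomial (Fin 5) ℂ)) i).symm
  exact AlgHom.congr_fun h a

theorem mk_prod_X_sq : Ideal.Quotient.mk (hypersurfaceIdeal f hf).toIdeal (∏ i, X i) ^ 2 =
    coverHom f hf ((∏ i, X i) * f) := by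
  rw [← map_pow, prod_X_sq, mk_squareHom, map_prod, Fin.prod_univ_castSucc]
  simp only [aeval_X, Fin.snoc_castSucc, Fin.snoc_last]

theorem exists_coverHom_add_mul_eq (b : MvPolynomial (Fin 5) ℂ ⧸ (hypersurfaceIdeal f hf).toIdeal)
    (hb : ∀ g : MuPrime, signActionQuot f hf g b = b) :
    ∃ a c, b = coverHom f hf a +
      coverHom f hf c * Ideal.Quotient.mk (hypersurfaceIdeal f hf).toIdeal (∏ i, X i) := by
  classical
  obtain ⟨b, rfl⟩ := Ideal.Quotient.mk_surjective b
  have := Fintype.ofFinite MuPrime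
  -- An invariant class lifts to an invariant polynomial: averaging any lift does not change its
  -- class. The splitting for polynomials then applies.
  let b' := average (signAction.comp MuPrime.subtype) b
  have hb' : Ideal.Quotient.mk (hypersurfaceIdeal f hf).toIdeal b' =
      Ideal.Quotient.mk (hypersurfaceIdeal f hf).toIdeal b := by
    have h1 : Ideal.Quotient.mk (hypersurfaceIdeal f hf).toIdeal b' =
        (Fintype.card MuPrime : ℂ)⁻¹ • ∑ g : MuPrime, signActionQuot f hf g
          (Ideal.Quotient.mk (hypersurfaceIdeal f hf).toIdeal b) := by
      refine (map_smul (Ideal.Quotient.mkₐ ℂ (hypersurfaceIdeal f hf).toIdeal) _ _).trans ?_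
      rw [map_sum]
      rfl
    rw [h1, Finset.sum_congr rfl fun g _ ↦ hb g, Finset.sum_const, Finset.card_univ,
      ← Nat.cast_smul_eq_nsmul ℂ, smul_smul, inv_mul_cancel₀ (by simp), one_smul]
  obtain ⟨a, c, hac⟩ := exists_squareHom_add_mul_eq (b := b') fun g hg ↦
    apply_average (signAction.comp MuPrime.subtype) (fun g c ↦ (signHom g).commutes c) ⟨g, hg⟩ b
  rw [← hb', hac, map_add, map_mul, mk_squareHom, mk_squareHom]
  exact ⟨_, _, rfl⟩

theorem mem_branchLocus (x : P3) :
    x ∈ branchLocus f ↔ (∏ i, X i) * f ∈ x.asHomogeneousIdeal := by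
  refine Iff.trans ?_ (x.isPrime.mul_mem_iff_mem_or_mem (x := ∏ i, X i) (y := f)).symm
  refine Iff.trans (b := x ∈ Finset.univ.sup (fun i : Fin 4 ↦ zeros 1 (X i)) ∨ x ∈ zeros 1 f)
    Iff.rfl ?_
  exact or_congr (mem_sup_zeros 1 x) Set.singleton_subset_iff

theorem prod_X_mul_mem (hf : f.IsHomogeneous 4) :
    (∏ i, X i) * f ∈ weightedHomogeneousSubmodule ℂ (1 : Fin 4 → ℕ) 8 := by
  have h := SetLike.prod_mem_graded (weightedHomogeneousSubmodule ℂ (1 : Fin 4 → ℕ)) 1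
    (fun i ↦ (X i : MvPolynomial (Fin 4) ℂ)) (F := Finset.univ) fun i _ ↦ X_mem 1 i
  have h4 : ∑ i, (1 : Fin 4 → ℕ) i = 4 := by simp
  rw [h4] at h
  exact SetLike.mul_mem_graded h hf

theorem isDoubleCover_branchLocus (hsq : Squarefree ((∏ i, X i) * f)) {Q : Scheme.{0}}
    {q : Yprime f hf ⟶ Q} {p : Q ⟶ P3}
    (hq : IsGeometricQuotient ((actionYprime f hf).comp Gprime.subtype) q)
    (hp : q ≫ p = coverMap f hf) : IsDoubleCover p (branchLocus f) := by
  refine IsGeometricQuotient.isDoubleCover ((signActionQuot f hf).comp MuPrime.subtype)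
    (coverHom f hf).toRingHom 2 two_pos (coverHom_mem f hf) (coverHom_irrelevant f hf)
    (fun g ↦ signActionQuot_algebraMap f hf g) (fun g ↦ signActionQuot_coverHom f hf g)
    (i := 4) (by norm_num) (W := Ideal.Quotient.mk _ (∏ i, X i)) (P := (∏ i, X i) * f)
    (mk_mem_quotGrading _ prod_X_mem) (prod_X_mul_mem f hf) hsq (mk_prod_X_sq f hf)
    (fun g ↦ congrArg (Ideal.Quotient.mk _) (signHom_prod_X_of_mem g.2)) ?_
    (exists_coverHom_add_mul_eq f hf) (fun x ↦ ?_) (mem_branchLocus f)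
    ((isGeometricQuotient_actionYprime_iff f hf q).mp hq) hp
  · refine eq_zero_of_add_mul_eq_zero (coverHom_injective f hf)
      (signActionQuot f hf lastSign).toRingHom (signActionQuot_coverHom f hf lastSign) ?_
      hsq.ne_zero (mk_prod_X_sq f hf)
    exact (congrArg (Ideal.Quotient.mk _) signHom_lastSign_prod_X).trans (map_neg _ _)
  · obtain ⟨i, hi⟩ := exists_mem_basicOpen_X x
    exact ⟨X i ^ 4, SetLike.pow_mem_graded 4 (X_mem 1 i), fun h ↦ hi (x.isPrime.mem_of_pow_mem _ h)⟩

end Hypersurface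

end DoubleCover

end

theorem mainTheorem7 :
    IsGeometricQuotient actionG Phi ∧
    (∃ (Z : Scheme.{0}) (q : P11114 ⟶ Z), IsGeometricQuotient (actionG.comp Gprime.subtype) q) ∧
    (∀ (Z : Scheme.{0}) (q : P11114 ⟶ Z), IsGeometricQuotient (actionG.comp Gprime.subtype) q →
      ∃ p : Z ⟶ P11114, q ≫ p = Phi ∧ (∀ p' : Z ⟶ P11114, q ≫ p' = Phi → p' = p) ∧
        IsDoubleCover p toricBoundary) ∧
    ∀ (f : MvPolynomial (Fin 4) ℂ) (hf : f.IsHomogeneous 4),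
      Squarefree ((∏ i, MvPolynomial.X i) * f) →
      (∃ (Q : Scheme.{0}) (q : Yprime f hf ⟶ Q),
        IsGeometricQuotient ((actionYprime f hf).comp Gprime.subtype) q) ∧
      ∀ (Q : Scheme.{0}) (q : Yprime f hf ⟶ Q),
        IsGeometricQuotient ((actionYprime f hf).comp Gprime.subtype) q →
        ∃ p : Q ⟶ P3, q ≫ p = coverMap f hf ∧
          (∀ p' : Q ⟶ P3, q ≫ p' = coverMap f hf → p' = p) ∧
          IsDoubleCover p (branchLocus f) ∧
          ∀ (Y : Scheme.{0}) (π : Y ⟶ P3), IsDoubleCover π (branchLocus f) →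
            ∃ e : Y ≅ Q, e.hom ≫ p = π := by
  refine ⟨isGeometricQuotient_Phi, exists_isGeometricQuotient_P11114, fun Z q hq ↦ ?_,
    fun f hf hsq ↦ ⟨exists_isGeometricQuotient_Yprime f hf, fun Q q hq ↦ ?_⟩⟩
  · obtain ⟨p, hp⟩ := hq.exists_desc Phi fun g ↦ isGeometricQuotient_Phi.invariant g
    exact ⟨p, hp, fun p' hp' ↦ hq.hom_ext (hp'.trans hp.symm), isDoubleCover_toricBoundary hq hp⟩
  -- Descent is carried out for `MuPrime`, whose action comes from the graded ring, so invariance of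
  -- `coverMap` reduces to that of the `y_i ^ 2`.
  · obtain ⟨p, hp⟩ := ((isGeometricQuotient_actionYprime_iff f hf q).mp hq).exists_desc
      (coverMap f hf) (ProjTools.projAction_projMapDeg _ (coverHom f hf).toRingHom 2 two_pos
        (coverHom_mem f hf) (coverHom_irrelevant f hf)
        fun g ↦ signActionQuot_coverHom f hf g)
    have hcov := isDoubleCover_branchLocus f hf hsq hq hp
    exact ⟨p, hp, fun p' hp' ↦ hq.hom_ext (hp'.trans hp.symm), hcov,
      fun Y π hπ ↦ hπ.exists_iso_P3 hcov⟩
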